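/- Let $k$ be an algebraically closed field. A variety over $k$ is an integral scheme of finite type over $k$, and rational maps and birational equivalences are understood over $k$. A variety is ruled if it is birationally equivalent to $Y \times_k \mathbb{P}^1_k$ for some variety $Y$ over $k$. A dominant rational map $f : X \dashrightarrow R$ of varieties has degree $d \in \mathbb{N}$ if the extension of function fields $k(X)/k(R)$ is finite of degree $d$, and it is then called separable if this extension is separable. The separable degree of nonruledness $\mathrm{snr}(X)$ of a variety $X$ is the smallest natural number $d$ for which there exists a separable dominant rational map of degree $d$ from $X$ to a ruled variety, with $\mathrm{snr}(X) = \infty$ if there is no such $d$ (this happens only if $\dim X = 0$). For an $\mathcal{O}_X$-module $M$, a $k$-linear subspace $W \subseteq \Gamma(X, M)$ and an integer $n \geq 1$, we say that $W$ separates $n$ general points if there is a dense open subset $U \subseteq X$ such that for all distinct closed points $x_1, \dots, x_n \in U$ there is a section $s \in W$ with $s(x_i) = 0$ in the fiber $M(x_i) = M_{x_i}/\mathfrak{m}_{x_i} M_{x_i}$ for $i = 1, \dots, n-1$ and $s(x_n) \neq 0$ in $M(x_n)$. **Proposition.** Let $X$ be a smooth proper variety over $k$, let $N = \dim X$, and let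 $\omega_X = \bigwedge^N \Omega_{X/k}$ be its canonical sheaf. Let $n$ be a positive integer. If $\Gamma(X, \omega_X)$ separates $n$ general points, then $\mathrm{snr}(X) > n$. In other words, every generically finite, separable, dominant rational map from $X$ to a ruled variety has degree greater than $n$. -/

import Mathlib

universe u

noncomputable section

namespace SepNonruled

open CategoryTheory CategoryTheory.Limits AlgebraicGeometry TopologicalSpace

/-! ### Varieties, the projective line, ruled varieties -/

/-- A scheme over a field `k` is a variety if it is integral and of finite type over `k`.
(The field is algebraically closed in all uses.) -/
structure IsVariety (k : Type u) [Field k] (X : Scheme.{u}) [X.Over (Spec (.of k))] : Prop where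
  isIntegral : IsIntegral X
  locallyOfFiniteType : LocallyOfFiniteType (X ↘ Spec (.of k))
  quasiCompact : QuasiCompact (X ↘ Spec (.of k))

attribute [local instance] MvPolynomial.gradedAlgebra

/-- The projective line over `k`, as `Proj k[x₀, x₁]`. -/
def projLine (k : Type u) [Field k] : Scheme.{u} :=
  Proj (MvPolynomial.homogeneousSubmodule (Fin 2) k)

/-- The structure morphism of the projective line: the map to `Spec` of the degree `0` part of
`k[x₀, x₁]`, followed by the map to `Spec k` given by the constants. -/
def projLineHom (k : Type u) [Field k] : projLine k ⟶ Spec (.of k) :=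
  Proj.toSpecZero (MvPolynomial.homogeneousSubmodule (Fin 2) k) ≫
    Spec.map (CommRingCat.ofHom
      (algebraMap k (MvPolynomial.homogeneousSubmodule (Fin 2) k 0)))

/-- A variety over `k` is ruled if it is birational over `k` to the product of
another variety with the projective line. -/
def IsRuled (k : Type u) [Field k] (R : Scheme.{u}) [R.Over (Spec (.of k))] : Prop :=
  ∃ (Y : Scheme.{u}) (_ : Y.Over (Spec (.of k))), IsVariety k Y ∧
    Scheme.BirationalOver (R ↘ Spec (.of k))
      (pullback.fst (Y ↘ Spec (.of k)) (projLineHom k) ≫ (Y ↘ Spec (.of k)))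

/-! ### Dominant rational maps: degree and separability -/

/-- A dominant rational map of integral schemes sends the generic point to the generic point. -/
theorem fromFunctionField_closedPoint {X Y : Scheme.{u}} [IsIntegral X] [IsIntegral Y]
    (f : X ⤏ Y) [hf : f.IsDominant] :
    f.fromFunctionField (IsLocalRing.closedPoint X.functionField) = genericPoint Y := by
  obtain ⟨g, rfl⟩ := f.exists_rep
  have hg : IsDominant g.hom := (g.isDominant_toRationalMap_iff).mp hf
  have hx : genericPoint X ∈ g.domain :=
    (genericPoint_specializes _).mem_open g.domain.2 g.dense_domain.nonempty.choose_spec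
  rw [Scheme.RationalMap.fromFunctionField_toRationalMap]
  change g.hom ((g.domain.fromSpecStalkOfMem _ hx) (IsLocalRing.closedPoint X.functionField)) = _
  set p := (g.domain.fromSpecStalkOfMem _ hx) (IsLocalRing.closedPoint X.functionField) with hp
  have hp' : g.domain.ι p = genericPoint X := by
    change (g.domain.fromSpecStalkOfMem _ hx ≫ g.domain.ι) (IsLocalRing.closedPoint _) = _
    exact (congrArg (fun h : Spec (X.presheaf.stalk (genericPoint X)) ⟶ X ↦
      h (IsLocalRing.closedPoint _)) (g.domain.fromSpecStalkOfMem_ι _ hx)).trans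
      Scheme.fromSpecStalk_closedPoint
  have hpg : closure {p} = Set.univ := by
    have h := g.domain.ι.isOpenEmbedding.isInducing.closure_eq_preimage_closure_image {p}
    rw [Set.image_singleton, hp', genericPoint_closure] at h
    simpa using h
  have h2 : IsGenericPoint (g.hom p) (Set.univ : Set Y) := by
    have h3 := (show IsGenericPoint p Set.univ from hpg).image g.hom.continuous
    rwa [Set.image_univ, g.hom.denseRange.closure_eq] at h3
  exact h2.eq (genericPoint_spec Y)

/-- The homomorphism of function fields `k(Y) → k(X)` induced by a dominant rational
map `X ⤏ Y` of integral schemes. -/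
def functionFieldHom {X Y : Scheme.{u}} [IsIntegral X] [IsIntegral Y]
    (f : X ⤏ Y) [f.IsDominant] : Y.functionField →+* X.functionField :=
  (Y.presheaf.stalkSpecializes
      (specializes_of_eq (fromFunctionField_closedPoint f)) ≫
    Scheme.stalkClosedPointTo f.fromFunctionField).hom

/-- The dominant rational map `f : X ⤏ Y` of integral schemes has degree `d`: the extension of
function fields `k(X) / k(Y)` is finite of degree `d`. -/
def HasDegree {X Y : Scheme.{u}} [IsIntegral X] [IsIntegral Y]
    (f : X ⤏ Y) [f.IsDominant] (d : ℕ) : Prop :=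
  letI := (functionFieldHom f).toAlgebra
  Module.Finite Y.functionField X.functionField ∧
    Module.finrank Y.functionField X.functionField = d

/-- The dominant, generically finite rational map `f : X ⤏ Y` of integral schemes is separable:
the algebraic extension of function fields `k(X) / k(Y)` is separable. -/
def IsSeparableMap {X Y : Scheme.{u}} [IsIntegral X] [IsIntegral Y]
    (f : X ⤏ Y) [f.IsDominant] : Prop :=
  letI := (functionFieldHom f).toAlgebra
  Algebra.IsSeparable Y.functionField X.functionField

/-- The separable degree of nonruledness: the smallest natural number `d` such that there is a
separable dominant rational map of degree `d` over `k` from `X` to a ruled variety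
(and `⊤` if there is no such `d`). -/
def snr (k : Type u) [Field k] (X : Scheme.{u}) [X.Over (Spec (.of k))] [IsIntegral X] : ℕ∞ :=
  sInf {e : ℕ∞ | ∃ d : ℕ, e = d ∧
    ∃ (R : Scheme.{u}) (_ : R.Over (Spec (.of k))) (_ : IsIntegral R) (f : X ⤏ R)
      (_ : f.IsDominant), IsVariety k R ∧ IsRuled k R ∧ f.IsOver (Spec (.of k)) ∧
        HasDegree f d ∧ IsSeparableMap f}

/-! ### Differential forms -/

/-- The algebra structure over `k` on the sections of the structure sheaf of a `k`-scheme. -/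
instance sectionAlgebra (k : Type u) [Field k] (X : Scheme.{u}) [X.Over (Spec (.of k))]
    (U : X.Opens) : Algebra k Γ(X, U) :=
  ((Scheme.ΓSpecIso (.of k)).inv ≫ (X ↘ Spec (.of k)).appTop ≫
    X.presheaf.map (homOfLE le_top).op).hom.toAlgebra

/-- The algebra structure over `k` on the local rings of a `k`-scheme. -/
instance stalkAlgebra (k : Type u) [Field k] (X : Scheme.{u}) [X.Over (Spec (.of k))]
    (x : X) : Algebra k (X.presheaf.stalk x) :=
  ((Scheme.ΓSpecIso (.of k)).inv ≫ (X ↘ Spec (.of k)).appTop ≫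
    X.presheaf.germ ⊤ x trivial).hom.toAlgebra

/-- The natural map `⋀ᴺ Ω_{A/k} → ⋀ᴺ Ω_{B/k}` of differential forms of degree `N`
for a homomorphism of `k`-algebras `A → B`. -/
def formsMap (k : Type*) (A B : Type*) [CommRing k] [CommRing A] [CommRing B] [Algebra k A]
    [Algebra k B] [Algebra A B] [IsScalarTower k A B] (N : ℕ) :
    ⋀[A]^N (Ω[A⁄k]) →ₗ[A] ⋀[B]^N (Ω[B⁄k]) :=
  exteriorPower.alternatingMapLinearEquiv
    { ((exteriorPower.ιMulti B N (M := Ω[B⁄k])).toMultilinearMap.restrictScalars A).compLinearMap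
        (fun _ ↦ KaehlerDifferential.map k k A B) with
      map_eq_zero_of_eq' := fun _ _ _ h hij ↦
        (exteriorPower.ιMulti B N (M := Ω[B⁄k])).map_eq_zero_of_eq _
          (congrArg (KaehlerDifferential.map k k A B) h) hij }

theorem formsMap_ιMulti (k : Type*) (A B : Type*) [CommRing k] [CommRing A] [CommRing B]
    [Algebra k A] [Algebra k B] [Algebra A B] [IsScalarTower k A B] (N : ℕ) (v : Fin N → Ω[A⁄k]) :
    formsMap k A B N (exteriorPower.ιMulti A N v) =
      exteriorPower.ιMulti B N (fun i ↦ KaehlerDifferential.map k k A B (v i)) := by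
  rw [formsMap, exteriorPower.alternatingMapLinearEquiv_apply_ιMulti]
  rfl

theorem formsMap_formsMap (k : Type*) (A B C : Type*) [CommRing k] [CommRing A] [CommRing B]
    [CommRing C] [Algebra k A] [Algebra k B] [Algebra k C] [Algebra A B] [Algebra A C]
    [Algebra B C] [IsScalarTower k A B] [IsScalarTower k A C] [IsScalarTower k B C]
    [IsScalarTower A B C] (N : ℕ) (t : ⋀[A]^N (Ω[A⁄k])) :
    formsMap k B C N (formsMap k A B N t) = formsMap k A C N t := by
  have h : (formsMap k B C N).restrictScalars A ∘ₗ formsMap k A B N = formsMap k A C N := by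
    apply exteriorPower.linearMap_ext
    ext v
    simp only [LinearMap.compAlternatingMap_apply, LinearMap.comp_apply,
      LinearMap.restrictScalars_apply, formsMap_ιMulti]
    congr 2
    ext i
    have h2 : (KaehlerDifferential.map k k B C).restrictScalars A ∘ₗ
        KaehlerDifferential.map k k A B = KaehlerDifferential.map k k A C := by
      apply Derivation.liftKaehlerDifferential_unique
      ext a
      simp [← IsScalarTower.algebraMap_apply A B C]
    exact LinearMap.congr_fun h2 (v i)
  exact LinearMap.congr_fun h t

/-- The natural map `⋀ᴺ Ω_{Γ(X, U)/k} → ⋀ᴺ Ω_{𝒪_{X,x}/k}` induced by the germ map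
`Γ(X, U) → 𝒪_{X,x}` at a point `x` of `U`. -/
def formsGerm (k : Type u) [Field k] (X : Scheme.{u}) [X.Over (Spec (.of k))] (N : ℕ)
    (U : X.Opens) (x : X) (hx : x ∈ U) :
    ⋀[Γ(X, U)]^N (Ω[Γ(X, U)⁄k]) →ₗ[k] ⋀[X.presheaf.stalk x]^N (Ω[X.presheaf.stalk x⁄k]) :=
  letI : Algebra Γ(X, U) (X.presheaf.stalk x) := (X.presheaf.germ U x hx).hom.toAlgebra
  haveI : IsScalarTower k Γ(X, U) (X.presheaf.stalk x) := by
    refine IsScalarTower.of_algebraMap_eq' ?_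
    have h := congrArg CommRingCat.Hom.hom (congrArg
      (fun g ↦ (Scheme.ΓSpecIso (.of k)).inv ≫ (X ↘ Spec (.of k)).appTop ≫ g)
      (X.presheaf.germ_res (homOfLE (le_top : U ≤ ⊤)) x hx))
    exact h.symm
  (formsMap k Γ(X, U) (X.presheaf.stalk x) N).restrictScalars k

/-- Differential forms on `U` can be restricted to `V ⊆ U` without changing their germs. -/
theorem exists_restrict_forms (k : Type u) [Field k] (X : Scheme.{u})
    [X.Over (Spec (.of k))] (N : ℕ) {U V : X.Opens} (hVU : V ≤ U)
    (t : ⋀[Γ(X, U)]^N (Ω[Γ(X, U)⁄k])) :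
    ∃ r : ⋀[Γ(X, V)]^N (Ω[Γ(X, V)⁄k]), ∀ y (hy : y ∈ V),
      formsGerm k X N V y hy r = formsGerm k X N U y (hVU hy) t := by
  let : Algebra Γ(X, U) Γ(X, V) := (X.presheaf.map (homOfLE hVU).op).hom.toAlgebra
  have : IsScalarTower k Γ(X, U) Γ(X, V) := by
    refine IsScalarTower.of_algebraMap_eq' ?_
    have h := congrArg CommRingCat.Hom.hom (congrArg
      (fun g ↦ (Scheme.ΓSpecIso (.of k)).inv ≫ (X ↘ Spec (.of k)).appTop ≫ g)
      (X.presheaf.map_comp (homOfLE (le_top : U ≤ ⊤)).op (homOfLE hVU).op))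
    exact h
  refine ⟨formsMap k Γ(X, U) Γ(X, V) N t, fun y hy ↦ ?_⟩
  let : Algebra Γ(X, U) (X.presheaf.stalk y) := (X.presheaf.germ U y (hVU hy)).hom.toAlgebra
  let : Algebra Γ(X, V) (X.presheaf.stalk y) := (X.presheaf.germ V y hy).hom.toAlgebra
  have h : ∀ (W : X.Opens) (hW : y ∈ W),
      (X.presheaf.germ W y hW).hom.comp (algebraMap k Γ(X, W)) =
        algebraMap k (X.presheaf.stalk y) := fun W hW ↦
    congrArg CommRingCat.Hom.hom (congrArg
      (fun g ↦ (Scheme.ΓSpecIso (.of k)).inv ≫ (X ↘ Spec (.of k)).appTop ≫ g)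
      (X.presheaf.germ_res (homOfLE (le_top : W ≤ ⊤)) y hW))
  have : IsScalarTower k Γ(X, U) (X.presheaf.stalk y) :=
    IsScalarTower.of_algebraMap_eq' (h U (hVU hy)).symm
  have : IsScalarTower k Γ(X, V) (X.presheaf.stalk y) :=
    IsScalarTower.of_algebraMap_eq' (h V hy).symm
  have : IsScalarTower Γ(X, U) Γ(X, V) (X.presheaf.stalk y) :=
    IsScalarTower.of_algebraMap_eq'
      (congrArg CommRingCat.Hom.hom (X.presheaf.germ_res (homOfLE hVU) y hy)).symm
  exact formsMap_formsMap k Γ(X, U) Γ(X, V) (X.presheaf.stalk y) N t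

/-- The space of global sections of the sheaf `⋀ᴺ Ω_{X/k}` of differential forms of degree `N`,
that is, of the sheaf associated with the presheaf `U ↦ ⋀ᴺ Ω_{Γ(X, U)/k}`.
A section is recorded by its germs: it is a family of elements of the stalks
`⋀ᴺ Ω_{𝒪_{X,x}/k}` which is locally induced by elements of `⋀ᴺ Ω_{Γ(X, U)/k}`. -/
def globalForms (k : Type u) [Field k] (X : Scheme.{u}) [X.Over (Spec (.of k))] (N : ℕ) :
    Submodule k (∀ x : X, ⋀[X.presheaf.stalk x]^N (Ω[X.presheaf.stalk x⁄k])) where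
  carrier := {s | ∀ x : X, ∃ (U : X.Opens) (_ : x ∈ U) (t : ⋀[Γ(X, U)]^N (Ω[Γ(X, U)⁄k])),
    ∀ y (hy : y ∈ U), s y = formsGerm k X N U y hy t}
  zero_mem' := fun x ↦ ⟨⊤, trivial, 0, fun y hy ↦ by simp⟩
  add_mem' := by
    intro a b ha hb x
    obtain ⟨U, hxU, t, ht⟩ := ha x
    obtain ⟨V, hxV, r, hr⟩ := hb x
    obtain ⟨t', ht'⟩ := exists_restrict_forms k X N (inf_le_left : U ⊓ V ≤ U) t
    obtain ⟨r', hr'⟩ := exists_restrict_forms k X N (inf_le_right : U ⊓ V ≤ V) r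
    refine ⟨U ⊓ V, ⟨hxU, hxV⟩, t' + r', fun y hy ↦ ?_⟩
    rw [map_add, ht' y hy, hr' y hy, ← ht y hy.1, ← hr y hy.2, Pi.add_apply]
  smul_mem' := by
    intro c a ha x
    obtain ⟨U, hxU, t, ht⟩ := ha x
    refine ⟨U, hxU, c • t, fun y hy ↦ ?_⟩
    rw [Pi.smul_apply, ht y hy, map_smul]

/-- Let `M` be a sheaf of modules on a `k`-scheme `X`, given by its stalks `M x`, and let `W` be a
linear subspace of its space of global sections, where a section `s` is recorded by its
germs `s x`. Then `W` separates `n` general points (`n ≥ 1`) if there is a dense open `U` such that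
for all distinct closed points `x₁, …, xₙ` in `U` (here indexed by `0, …, n - 1`) there is a section in `W` whose value in
the fiber `M(x) = M x / 𝔪ₓ M x` is zero at `x₁, …, xₙ₋₁` and nonzero at `xₙ`. -/
def SeparatesGeneralPoints {k : Type u} [Field k] {X : Scheme.{u}} {M : X → Type u}
    [∀ x, AddCommGroup (M x)] [∀ x, Module (X.presheaf.stalk x) (M x)] [∀ x, Module k (M x)]
    (W : Submodule k (∀ x, M x)) (n : ℕ) : Prop :=
  ∃ U : X.Opens, Dense (U : Set X) ∧
    ∀ x : Fin n → X, Function.Injective x → (∀ i, x i ∈ U ∧ IsClosed {x i}) →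
      ∃ s ∈ W, ∀ i : Fin n,
        s (x i) ∈ IsLocalRing.maximalIdeal (X.presheaf.stalk (x i)) •
            (⊤ : Submodule (X.presheaf.stalk (x i)) (M (x i))) ↔ (i : ℕ) + 1 < n

end SepNonruled
end

/-! ### Euler's formula and integrality of traces -/

namespace SepNonruled

/-! Let X ⇢ R be separable of degree d with R ruled, put L = k(X) and F = k(R) = K(t), and let ω be
a global form of top degree on X. Its trace is a form on a ruled variety that is regular along the
P¹ direction, hence zero. Over a general point of R one can write ω = g dt ∧ dy₁ ∧ … with t and the
yᵢ coming from R, so the vanishing of the trace says that the values of g at the d points of the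
fiber sum to zero. A form vanishing at all but one of these points therefore vanishes at the last.
If d ≤ n, complete the fiber to n general points with a fiber point in the last place: this
contradicts separation.

No trace map on forms is needed, only the trace from L to F of the coordinate of ω with respect to
dt ∧ dy₁ ∧ …. In `trace_formsCoord_eq_zero` this trace lies in K[t], and replacing t by 1/t shows
that -t² times it lies in K[1/t], which forces it to be zero.

The integrality over the Dedekind domain A = K[t] or K[1/t] is `trace_mul_det_mem`, which imposes no
condition on ramification. The integral closure B of A in L is locally a complete intersection over
A (`exists_generators_relations`). By Euler's formula the inverse of the Jacobian of the relations
lies, up to a factor prime to the given maximal ideal, in the trace dual of B. By the chain rule,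
the product of this Jacobian with that of arbitrary elements of B under derivations preserving A is
in B. Global forms enter through the localizations of B, at which they are regular by the valuative
criterion (`isRegularForm_globalForms`).

The fiber is found by spreading L/F out to a finite étale extension of finitely generated domains
(`exists_fiber_of_essFiniteType`), where trace commutes with passage to a rational point
(`exists_fiber`). The two halves meet in `lt_finrank_of_separatesGeneralPoints`. -/

open Polynomial in
/-- Euler's formula: if `f` is monic over `A` and has the simple roots `S` in a field `M`, then
`∑ g(r) / f'(r)` over the roots lies in `A`, for all `g` over `A`. -/
theorem sum_aeval_div_derivative_mem {A M : Type*} [CommRing A] [Field M] [Algebra A M]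
    [DecidableEq M] (f : A[X]) (hf : f.Monic) (S : Finset M)
    (hS : f.map (algebraMap A M) = ∏ r ∈ S, (X - C r)) (g : A[X]) :
    ∑ r ∈ S, aeval r g / aeval r (derivative f) ∈ (algebraMap A M).range := by
  have : Nontrivial A := (algebraMap A M).domain_nontrivial
  have hdeg : f.degree = S.card := by
    rw [← hf.degree_map (algebraMap A M), hS, degree_prod]
    simp
  have hroot : ∀ r ∈ S, aeval r f = 0 := fun r hr ↦ by
    rw [← eval_map_algebraMap, hS, eval_prod]
    exact Finset.prod_eq_zero hr (by simp)
  have hd : ∀ r ∈ S, aeval r (derivative f) = ∏ j ∈ S.erase r, (r - j) := fun r hr ↦ by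
    rw [← eval_map_algebraMap, ← derivative_map, hS]
    have := Lagrange.eval_nodal_derivative_eval_node_eq (s := S) (v := id) hr
    rw [Lagrange.nodal] at this
    simpa [Lagrange.nodal, eval_prod] using this
  -- By Lagrange interpolation at the roots, the sum is the coefficient of degree |S| - 1 of the
  -- remainder of g modulo f. The remainder has coefficients in A because f is monic.
  refine ⟨(g %ₘ f).coeff (S.card - 1), ?_⟩
  have hlt : ((g %ₘ f).map (algebraMap A M)).degree < S.card :=
    degree_map_le.trans_lt (hdeg ▸ degree_modByMonic_lt g hf)
  rw [← coeff_map, Lagrange.coeff_eq_sum (s := S) (v := id) (Set.injOn_id _) hlt]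
  refine Finset.sum_congr rfl fun r hr ↦ ?_
  rw [hd r hr, id, eval_map_algebraMap]
  congr 1
  conv_rhs => rw [← modByMonic_add_div g f]
  simp [hroot r hr]

-- For a monomial c, the sum over the grid of roots is a product of one-variable sums, so Euler's
-- formula applies to each variable; the general case follows by linearity.
open Polynomial in
theorem sum_aeval_div_prod_derivative_mem {A M ι : Type*} [CommRing A] [Field M] [Algebra A M]
    [Fintype ι] [DecidableEq ι] [DecidableEq M] (f : ι → A[X]) (hf : ∀ i, (f i).Monic)
    (S : ι → Finset M)
    (hS : ∀ i, (f i).map (algebraMap A M) = ∏ r ∈ S i, (X - C r)) (c : MvPolynomial ι A) :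
    ∑ p ∈ Fintype.piFinset S, MvPolynomial.aeval p c / ∏ i, aeval (p i) (derivative (f i)) ∈
      (algebraMap A M).range := by
  induction c using MvPolynomial.induction_on' with
  | monomial u a =>
    have h : ∑ p ∈ Fintype.piFinset S, MvPolynomial.aeval p (MvPolynomial.monomial u a) /
        ∏ i, aeval (p i) (derivative (f i)) =
        algebraMap A M a * ∏ i, ∑ r ∈ S i, aeval r (X ^ (u i) : A[X]) /
          aeval r (derivative (f i)) := by
      rw [Finset.prod_univ_sum, Finset.mul_sum]
      refine Finset.sum_congr rfl fun p _ ↦ ?_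
      rw [MvPolynomial.aeval_monomial, Finset.prod_div_distrib, mul_div_assoc]
      congr 2
      rw [Finsupp.prod_fintype _ _ (by simp)]
      simp
    rw [h]
    exact mul_mem ⟨a, rfl⟩ (prod_mem fun i _ ↦ sum_aeval_div_derivative_mem _ (hf i) _ (hS i) _)
  | add p q hp hq =>
    simp only [map_add, add_div, Finset.sum_add_distrib]
    exact add_mem hp hq

theorem exists_map_eq_C_mul (A : Type*) {F ι : Type*} [CommRing A] [IsDomain A] [Field F]
    [Algebra A F] [IsFractionRing A F] (g : MvPolynomial ι F) :
    ∃ (g₀ : MvPolynomial ι A) (s : A), s ≠ 0 ∧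
      MvPolynomial.map (algebraMap A F) g₀ = MvPolynomial.C (algebraMap A F s) * g := by
  let := MvPolynomial.algebraMvPolynomial (σ := ι) (R := A) (S := F)
  obtain ⟨⟨g₀, ⟨_, s, hs0, rfl⟩⟩, hs⟩ := IsLocalization.surj
    (Submonoid.map MvPolynomial.C (nonZeroDivisors A) : Submonoid (MvPolynomial ι A)) g
  refine ⟨g₀, s, nonZeroDivisors.ne_zero hs0, ?_⟩
  simp only [MvPolynomial.algebraMap_def, MvPolynomial.map_C] at hs
  rw [mul_comm, hs]

open Polynomial in
/-- If `c` annihilates the kernel of `A[x] → L` modulo the minimal polynomials `fᵢ(xᵢ)` of the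
generators `bᵢ`, then `c(b) / ∏ fᵢ'(bᵢ)` has integral trace. -/
theorem trace_aeval_div_prod_derivative_mem {A F L ι : Type*} [CommRing A] [IsDomain A]
    [IsIntegrallyClosed A] [Field F] [Field L] [Algebra A F] [IsFractionRing A F] [Algebra F L]
    [Algebra A L] [IsScalarTower A F L] [FiniteDimensional F L] [Algebra.IsSeparable F L]
    [Fintype ι] (b : ι → L) (hb : ∀ i, IsIntegral A (b i))
    (hgen : Function.Surjective (MvPolynomial.aeval b : MvPolynomial ι F →ₐ[F] L))
    (c : MvPolynomial ι A)
    (hc : ∀ g : MvPolynomial ι A, MvPolynomial.aeval b g = 0 →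
      c * g ∈ Ideal.span (Set.range fun i ↦ aeval (MvPolynomial.X i) (minpoly A (b i)))) :
    Algebra.trace F L (MvPolynomial.aeval b c / ∏ i, aeval (b i) (derivative (minpoly A (b i)))) ∈
      (algebraMap A F).range := by
  classical
  let M := AlgebraicClosure F
  let f : ι → A[X] := fun i ↦ minpoly A (b i)
  have hfF : ∀ i, (f i).map (algebraMap A F) = minpoly F (b i) := fun i ↦
    (minpoly.isIntegrallyClosed_eq_field_fractions' F (hb i)).symm
  let S : ι → Finset M := fun i ↦ ((minpoly F (b i)).aroots M).toFinset
  have hS : ∀ i, (f i).map (algebraMap A M) = ∏ r ∈ S i, (X - C r) := fun i ↦ by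
    rw [IsScalarTower.algebraMap_eq A F M, ← Polynomial.map_map, hfF]
    have hnd : ((minpoly F (b i)).aroots M).Nodup :=
      nodup_aroots_iff_of_splits (minpoly.ne_zero (Algebra.IsIntegral.isIntegral _))
        (IsAlgClosed.splits _) |>.mpr (Algebra.IsSeparable.isSeparable F (b i))
    rw [Finset.prod_eq_multiset_prod, Multiset.toFinset_val, hnd.dedup]
    conv_lhs => rw [(IsAlgClosed.splits ((minpoly F (b i)).map (algebraMap F M))).eq_prod_roots]
    rw [((minpoly.monic (Algebra.IsIntegral.isIntegral (b i))).map _).leadingCoeff, C_1, one_mul]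
  have hmem : ∀ (i : ι) (r : M), r ∈ S i ↔ aeval r (f i) = 0 := fun i r ↦ by
    rw [← eval_map_algebraMap, hS, eval_prod, Finset.prod_eq_zero_iff]
    simp only [eval_sub, eval_X, eval_C, sub_eq_zero]
    exact ⟨fun h ↦ ⟨r, h, rfl⟩, fun ⟨a, ha, e⟩ ↦ e ▸ ha⟩
  obtain ⟨a, ha⟩ := sum_aeval_div_prod_derivative_mem f (fun i ↦ minpoly.monic (hb i)) S hS c
  refine ⟨a, (algebraMap F M).injective ?_⟩
  rw [← IsScalarTower.algebraMap_apply, ha, trace_eq_sum_embeddings M]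
  have hσ : ∀ (σ : L →ₐ[F] M) (g : MvPolynomial ι A),
      σ (MvPolynomial.aeval b g) = MvPolynomial.aeval (fun i ↦ σ (b i)) g := fun σ g ↦ by
    rw [← AlgHom.restrictScalars_apply A σ, ← AlgHom.comp_apply, MvPolynomial.comp_aeval]
    rfl
  symm
  -- The trace is the part of the grid sum over the points (σ(bᵢ)) for embeddings σ. It remains to
  -- see that the other grid points contribute zero.
  refine Finset.sum_of_injOn (fun (σ : L →ₐ[F] M) i ↦ σ (b i)) ?_ ?_ ?_ ?_
  · intro σ _ τ _ h
    have : σ.comp (MvPolynomial.aeval b) = τ.comp (MvPolynomial.aeval b) := by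
      ext i
      simpa using congrFun h i
    ext x
    obtain ⟨x, rfl⟩ := hgen x
    exact DFunLike.congr_fun this x
  · intro σ _
    simp only [Finset.mem_coe, Fintype.mem_piFinset, hmem]
    intro i
    have := congrArg (σ.restrictScalars A) (minpoly.aeval A (b i))
    rw [← Polynomial.aeval_algHom_apply, map_zero] at this
    exact this
  · intro p hp hp'
    -- Some relation g among the bᵢ fails at p, while c * g lies in the ideal of the minimal
    -- polynomials and vanishes on the whole grid; so c(p) = 0.
    suffices h : ∃ g : MvPolynomial ι A, MvPolynomial.aeval b g = 0 ∧ MvPolynomial.aeval p g ≠ 0 by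
      obtain ⟨g, hg, hg'⟩ := h
      have h0 : MvPolynomial.aeval p (c * g) = 0 := by
        have : Ideal.span (Set.range fun i ↦ aeval (MvPolynomial.X i) (minpoly A (b i))) ≤
            RingHom.ker (MvPolynomial.aeval p : MvPolynomial ι A →ₐ[A] M) := by
          rw [Ideal.span_le]
          rintro _ ⟨i, rfl⟩
          change MvPolynomial.aeval p (aeval (MvPolynomial.X i) (f i)) = 0
          rw [← Polynomial.aeval_algHom_apply, MvPolynomial.aeval_X]
          exact (hmem i _).mp (Fintype.mem_piFinset.mp hp i)
        exact this (hc g hg)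
      rw [map_mul] at h0
      rw [(mul_eq_zero.mp h0).resolve_right hg', zero_div]
    by_contra! h
    apply hp'
    -- If p satisfied all relations over A, then, clearing denominators, also those over F, and bᵢ ↦
    -- pᵢ would define an embedding of L.
    have hker : ∀ g : MvPolynomial ι F, MvPolynomial.aeval b g = 0 →
        MvPolynomial.aeval p g = 0 := by
      intro g hg
      obtain ⟨g₀, s, hs0, hs⟩ := exists_map_eq_C_mul A g
      have e1 := congrArg (MvPolynomial.aeval b) hs
      have e2 := congrArg (MvPolynomial.aeval p) hs
      rw [MvPolynomial.aeval_map_algebraMap, map_mul, MvPolynomial.aeval_C] at e1 e2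
      rw [hg, mul_zero] at e1
      rw [h g₀ e1] at e2
      refine (mul_eq_zero.mp e2.symm).resolve_left ?_
      simpa using hs0
    let σ : L →ₐ[F] M := AlgHom.liftOfSurjective (MvPolynomial.aeval b) hgen
      (MvPolynomial.aeval p) hker
    refine ⟨σ, by simp, ?_⟩
    ext i
    have := AlgHom.liftOfSurjective_apply (MvPolynomial.aeval b) hgen
      (MvPolynomial.aeval p) hker (MvPolynomial.X i)
    simpa using this
  · intro σ _
    rw [map_div₀, map_prod, hσ]
    congr 1
    refine Finset.prod_congr rfl fun i _ ↦ ?_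
    exact (Polynomial.aeval_algHom_apply (σ.restrictScalars A) (b i) _).symm

end SepNonruled

/-! ### Dedekind extensions are local complete intersections -/

namespace SepNonruled

open IsLocalRing in
/-- A surjection from a local ring whose maximal ideal has at most `m + 1` generators onto a
discrete valuation ring has a kernel with at most `m` generators. -/
theorem exists_span_range_eq_ker {R V ι : Type*} [CommRing R] [IsLocalRing R] [IsNoetherianRing R]
    [CommRing V] [IsDomain V] [IsDiscreteValuationRing V] [Fintype ι] (π : R →+* V)
    (hπ : Function.Surjective π)
    (hR : Module.finrank (ResidueField R) (CotangentSpace R) ≤ Fintype.card ι + 1) :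
    ∃ g : ι → R, Ideal.span (Set.range g) = RingHom.ker π := by
  classical
  obtain ⟨ϖ, hϖ⟩ := IsDiscreteValuationRing.exists_irreducible V
  obtain ⟨t, rfl⟩ := hπ ϖ
  have hloc : IsLocalHom π := hπ.isLocalHom
  have hmap : ∀ x ∈ maximalIdeal R, π x ∈ maximalIdeal V := fun x hx ↦ by
    rw [mem_maximalIdeal, mem_nonunits_iff] at hx ⊢
    exact fun h ↦ hx (hloc.map_nonunit _ h)
  have ht : t ∈ maximalIdeal R := fun h ↦ hϖ.not_isUnit (h.map π)
  have hI : RingHom.ker π ≤ maximalIdeal R := le_maximalIdeal (RingHom.ker_ne_top π)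
  let tm : maximalIdeal R := ⟨t, ht⟩
  let T : Set (maximalIdeal R) := {x | (x : R) ∈ RingHom.ker π}
  have hspan : Submodule.span R (insert tm T) = ⊤ := by
    rw [eq_top_iff]
    rintro ⟨x, hx⟩ -
    have h1 : π x ∈ Ideal.span {π t} := hϖ.maximalIdeal_eq ▸ hmap x hx
    obtain ⟨y, hy⟩ := Ideal.mem_span_singleton'.mp h1
    obtain ⟨y, rfl⟩ := hπ y
    have h2 : x - y * t ∈ RingHom.ker π := by
      rw [RingHom.mem_ker, map_sub, map_mul, hy, sub_self]
    have h3 : (⟨x, hx⟩ : maximalIdeal R) = y • tm + ⟨x - y * t, hI h2⟩ := by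
      ext
      simp [tm]
    rw [h3]
    exact add_mem (Submodule.smul_mem _ _ (Submodule.subset_span (Set.mem_insert _ _)))
      (Submodule.subset_span (Set.mem_insert_of_mem _ h2))
  -- If t were in the square of the maximal ideal, its image would be a uniformizer lying in the
  -- square of the maximal ideal of V.
  have hcot : (maximalIdeal R).toCotangent tm ≠ 0 := by
    intro h
    rw [Ideal.toCotangent_eq_zero] at h
    have h1 : π t ∈ (maximalIdeal V) ^ 2 := by
      have := Ideal.mem_map_of_mem π h
      rw [Ideal.map_pow] at this
      exact Ideal.pow_right_mono (Ideal.map_le_iff_le_comap.mpr hmap) 2 this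
    rw [hϖ.maximalIdeal_eq, Ideal.span_singleton_pow, Ideal.mem_span_singleton] at h1
    obtain ⟨c, hc⟩ := h1
    have : IsUnit (π t) := by
      refine IsUnit.of_mul_eq_one c (mul_left_cancel₀ hϖ.ne_zero ?_)
      rw [mul_one, ← mul_assoc, ← pow_two, ← hc]
    exact hϖ.not_isUnit this
  let k := ResidueField R
  let φ := (maximalIdeal R).toCotangent
  have hli : LinearIndepOn k id {φ tm} := LinearIndepOn.singleton (v := id) hcot
  have hsub : {φ tm} ⊆ φ '' (insert tm T) := by
    rw [Set.singleton_subset_iff]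
    exact ⟨tm, Set.mem_insert _ _, rfl⟩
  -- A basis of the cotangent space consisting of the class of t and of classes of elements of the
  -- kernel. Discarding t saves the one generator.
  let b := hli.extend hsub
  have hb1 : b ⊆ φ '' (insert tm T) := hli.extend_subset hsub
  have hb2 : Submodule.span k b = ⊤ := by
    rw [hli.span_extend_eq_span hsub, CotangentSpace.span_image_eq_top_iff, hspan]
  have hb3 : LinearIndepOn k id b := hli.linearIndepOn_extend hsub
  have hb4 : φ tm ∈ b := hli.subset_extend hsub rfl
  have hfin : b.Finite := hb3.finite
  have hcard : (b \ {φ tm}).ncard ≤ Fintype.card ι := by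
    rw [Set.ncard_sdiff_singleton_of_mem hb4]
    have : b.ncard ≤ Module.finrank k (CotangentSpace R) := by
      have := hfin.fintype
      have h2 := hb3.linearIndependent.fintype_card_le_finrank
      rwa [← Nat.card_eq_fintype_card, Nat.card_coe_set_eq] at h2
    have := this.trans hR
    omega
  have hpre : ∀ x ∈ b \ {φ tm}, ∃ y : R, ∃ hy : y ∈ RingHom.ker π, φ ⟨y, hI hy⟩ = x := by
    rintro x ⟨hx, hx'⟩
    obtain ⟨y, hy | hy, rfl⟩ := hb1 hx
    · exact absurd (congrArg φ hy) hx'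
    · exact ⟨y, hy, rfl⟩
  have hfin' : (b \ {φ tm}).Finite := hfin.subset Set.sdiff_subset
  obtain ⟨e⟩ : Nonempty ((b \ {φ tm} : Set _) ↪ ι) := by
    have := hfin'.fintype
    refine Function.Embedding.nonempty_of_card_le ?_
    rwa [← Nat.card_eq_fintype_card, Nat.card_coe_set_eq]
  choose! y hy hyφ using hpre
  -- Indices not needed for the basis receive the generator 0.
  let g : ι → R := fun i ↦ if h : ∃ x, e x = i then y h.choose else 0
  have hg : ∀ x, g (e x) = y x := fun x ↦ by
    have h : ∃ x', e x' = e x := ⟨x, rfl⟩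
    rw [show g (e x) = y h.choose from dif_pos h, e.injective h.choose_spec]
  have hgI : Ideal.span (Set.range g) ≤ RingHom.ker π := by
    rw [Ideal.span_le]
    rintro _ ⟨i, rfl⟩
    by_cases h : ∃ x, e x = i
    · obtain ⟨x, rfl⟩ := h
      rw [hg]
      exact hy x x.2
    · rw [show g i = 0 from dif_neg h]
      exact zero_mem _
  have hgen : maximalIdeal R ≤ Ideal.span (Set.range g) ⊔ Ideal.span {t} := by
    let J := Submodule.comap (maximalIdeal R).subtype (Ideal.span (Set.range g) ⊔ Ideal.span {t})
    suffices h : J = ⊤ by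
      intro x hx
      have : (⟨x, hx⟩ : maximalIdeal R) ∈ J := h ▸ Submodule.mem_top
      exact this
    rw [← CotangentSpace.map_eq_top_iff, eq_top_iff]
    intro z _
    have hz : z ∈ Submodule.span k b := hb2 ▸ Submodule.mem_top
    have hJ : (Submodule.map (maximalIdeal R).toCotangent J : Set (CotangentSpace R)) =
        (Submodule.span k (φ '' J) : Submodule k (CotangentSpace R)) := by
      have : Submodule.restrictScalars R (Submodule.span k (φ '' J)) =
          Submodule.span R (φ '' J) := Submodule.restrictScalars_span R k
            Ideal.Quotient.mk_surjective _
      rw [← Submodule.coe_restrictScalars R (Submodule.span k (φ '' J)), this,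
        ← Submodule.map_span, Submodule.span_eq]
    rw [← SetLike.mem_coe, hJ]
    refine Submodule.span_mono ?_ hz
    intro x hx
    by_cases hx' : x = φ tm
    · exact ⟨tm, Submodule.mem_sup_right (Ideal.mem_span_singleton_self t), hx'.symm⟩
    · have hxb : x ∈ b \ {φ tm} := ⟨hx, hx'⟩
      refine ⟨⟨y x, hI (hy x hxb)⟩, Submodule.mem_sup_left (Ideal.subset_span ⟨e ⟨x, hxb⟩, ?_⟩),
        hyφ x hxb⟩
      rw [hg]
      rfl
  refine ⟨g, le_antisymm hgI ?_⟩
  -- Nakayama: a kernel element has the form j + z t with j in the span of g. Then z t is in the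
  -- kernel, and so is z, since V is a domain and t maps to a nonzero element.
  refine Submodule.le_of_le_smul_of_le_jacobson_bot (I := maximalIdeal R)
    (IsNoetherian.noetherian _) (IsLocalRing.jacobson_eq_maximalIdeal _ bot_ne_top).ge ?_
  intro x hx
  obtain ⟨j, hj, w, hw, rfl⟩ := Submodule.mem_sup.mp (hgen (hI hx))
  obtain ⟨z, rfl⟩ := Ideal.mem_span_singleton'.mp hw
  refine add_mem (Submodule.mem_sup_left hj) (Submodule.mem_sup_right ?_)
  rw [mul_comm]
  refine Submodule.smul_mem_smul ht ?_
  have h1 := hgI hj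
  rw [RingHom.mem_ker] at h1 hx ⊢
  rw [map_add, h1, zero_add, map_mul] at hx
  exact (mul_eq_zero.mp hx).resolve_right hϖ.ne_zero

/-- The relations between generators of a Dedekind domain `B` over a Dedekind domain `A` are,
locally on `B`, generated by as many elements as there are generators. -/
theorem exists_generators_relations {A B ι : Type*} [CommRing A] [IsDedekindDomain A]
    [CommRing B] [IsDedekindDomain B] [Algebra A B] [Fintype ι] (x : ι → B)
    (hx : Function.Surjective (MvPolynomial.aeval x : MvPolynomial ι A →ₐ[A] B))
    (Q : Ideal B) [Q.IsMaximal] (hQ : Q ≠ ⊥) :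
    ∃ (g : ι → MvPolynomial ι A) (s : MvPolynomial ι A), MvPolynomial.aeval x s ∉ Q ∧
      (∀ i, MvPolynomial.aeval x (g i) = 0) ∧
      ∀ f, MvPolynomial.aeval x f = 0 → s * f ∈ Ideal.span (Set.range g) := by
  classical
  let P := MvPolynomial ι A
  let ψ : P →+* B := (MvPolynomial.aeval x : P →ₐ[A] B).toRingHom
  let q : Ideal P := Q.comap ψ
  have hq : q.IsPrime := Ideal.IsPrime.comap ψ
  let R := Localization.AtPrime q
  let V := Localization.AtPrime Q
  let π : R →+* V := Localization.localRingHom q Q ψ rfl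
  have : IsDiscreteValuationRing V :=
    IsLocalization.AtPrime.isDiscreteValuationRing_of_dedekind_domain B hQ V
  have hπ : Function.Surjective π := by
    intro v
    obtain ⟨b, s, rfl⟩ := IsLocalization.exists_mk'_eq Q.primeCompl v
    obtain ⟨b, rfl⟩ := hx b
    obtain ⟨s, hs⟩ := s
    obtain ⟨s, rfl⟩ := hx s
    exact ⟨IsLocalization.mk' R b ⟨s, hs⟩, Localization.localRingHom_mk' q Q ψ rfl b ⟨s, hs⟩⟩
  -- Polynomial rings over a Dedekind domain are regular, so the cotangent dimension of R is its
  -- Krull dimension, at most one more than the number of variables.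
  have hreg : IsRegularLocalRing R := IsRegularRing.isRegularLocalRing_localization q
  have hdim : Module.finrank (IsLocalRing.ResidueField R) (IsLocalRing.CotangentSpace R) ≤
      Fintype.card ι + 1 := by
    have h1 := (IsRegularLocalRing.iff_finrank_cotangentSpace R).mp hreg
    have h2 : ringKrullDim R ≤ ringKrullDim P := by
      rw [IsLocalization.AtPrime.ringKrullDim_eq_height q R]
      exact Ideal.height_le_ringKrullDim_of_isPrime
    rw [MvPolynomial.ringKrullDim_of_isNoetherianRing, Nat.card_eq_fintype_card] at h2
    have h3 : ringKrullDim A ≤ 1 := by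
      exact_mod_cast (Ring.krullDimLE_iff (n := 1) (R := A)).mp inferInstance
    have h4 : ((Module.finrank (IsLocalRing.ResidueField R) (IsLocalRing.CotangentSpace R) : ℕ) :
        WithBot ℕ∞) ≤ ((Fintype.card ι + 1 : ℕ) : WithBot ℕ∞) := by
      rw [h1]
      refine h2.trans ?_
      rw [Nat.cast_add, add_comm, Nat.cast_one]
      gcongr
    exact_mod_cast h4
  obtain ⟨g', hg'⟩ := exists_span_range_eq_ker π hπ hdim
  choose g₀ s₀ hgs using fun i ↦ IsLocalization.exists_mk'_eq q.primeCompl (g' i)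
  have hinj : Function.Injective (algebraMap B V) :=
    IsLocalization.injective V Q.primeCompl_le_nonZeroDivisors
  have hπa : ∀ p : P, π (algebraMap P R p) = algebraMap B V (ψ p) := fun p ↦
    Localization.localRingHom_to_map q Q ψ rfl p
  have hg0 : ∀ i, algebraMap P R (g₀ i) = g' i * algebraMap P R (s₀ i) := fun i ↦ by
    rw [← hgs i, IsLocalization.mk'_spec]
  have hspan : Ideal.span (Set.range g') = (Ideal.span (Set.range g₀)).map (algebraMap P R) := by
    rw [Ideal.map_span]
    apply le_antisymm
    · rw [Ideal.span_le]
      rintro _ ⟨i, rfl⟩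
      have hu : IsUnit (algebraMap P R (s₀ i)) := IsLocalization.map_units R (s₀ i)
      refine (Ideal.mul_unit_mem_iff_mem _ hu).mp ?_
      rw [← hg0]
      exact Ideal.subset_span ⟨_, ⟨i, rfl⟩, rfl⟩
    · rw [Ideal.span_le]
      rintro _ ⟨_, ⟨i, rfl⟩, rfl⟩
      rw [hg0]
      exact Ideal.mul_mem_right _ _ (Ideal.subset_span ⟨i, rfl⟩)
  have hker : ∀ f : P, ψ f = 0 → ∃ s ∉ q, s * f ∈ Ideal.span (Set.range g₀) := by
    intro f hf
    have h1 : algebraMap P R f ∈ (Ideal.span (Set.range g₀)).map (algebraMap P R) := by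
      rw [← hspan, hg', RingHom.mem_ker, hπa, hf, map_zero]
    obtain ⟨s, hs, h⟩ := (IsLocalization.algebraMap_mem_map_algebraMap_iff q.primeCompl R _ _).mp h1
    exact ⟨s, hs, h⟩
  -- A single s works for the whole kernel because the kernel is finitely generated.
  obtain ⟨s, hs, hs'⟩ : ∃ s ∉ q, ∀ f ∈ RingHom.ker ψ, s * f ∈ Ideal.span (Set.range g₀) := by
    obtain ⟨T, hT⟩ := (IsNoetherian.noetherian (RingHom.ker ψ) : (RingHom.ker ψ).FG)
    have hmemT : ∀ f ∈ T, ψ f = 0 := fun f hf ↦ by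
      have : f ∈ RingHom.ker ψ := hT ▸ Ideal.subset_span hf
      exact this
    choose! σ hσ hσ' using fun (f : P) (hf : ψ f = 0) ↦ hker f hf
    refine ⟨∏ f ∈ T, σ f, ?_, ?_⟩
    · rw [hq.prod_mem_iff]
      rintro ⟨f, hf, h⟩
      exact hσ f (hmemT f hf) h
    · intro f hf
      rw [← hT] at hf
      induction hf using Submodule.span_induction with
      | mem f hf =>
        rw [← Finset.prod_erase_mul _ _ hf, mul_assoc]
        exact Ideal.mul_mem_left _ _ (hσ' f (hmemT f hf))
      | zero => simp
      | add a b _ _ ha hb => rw [mul_add]; exact add_mem ha hb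
      | smul a b _ hb => rw [smul_eq_mul, mul_left_comm]; exact Ideal.mul_mem_left _ _ hb
  refine ⟨g₀, s, hs, fun i ↦ hinj ?_, fun f hf ↦ hs' f hf⟩
  have h1 : g' i ∈ RingHom.ker π := hg' ▸ Ideal.subset_span ⟨i, rfl⟩
  have h2 := congrArg π (hg0 i)
  rw [map_mul, h1, zero_mul, hπa] at h2
  rw [map_zero]
  exact h2

end SepNonruled

/-! ### Jacobian determinants and the trace dual -/

namespace SepNonruled

open scoped Matrix

/-- The chain rule for a derivation of `L` preserving a subring `A`. -/
theorem exists_derivation_aeval {k A L ι : Type*} [CommRing k] [CommRing A] [CommRing L]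
    [Algebra k L] [Algebra A L] [Fintype ι] (D : Derivation k L L)
    (hD : ∀ a, D (algebraMap A L a) ∈ (algebraMap A L).range) (x : ι → L)
    (g : MvPolynomial ι A) :
    ∃ e : MvPolynomial ι A, D (MvPolynomial.aeval x g) = MvPolynomial.aeval x e +
      ∑ i, MvPolynomial.aeval x (MvPolynomial.pderiv i g) * D (x i) := by
  classical
  induction g using MvPolynomial.induction_on with
  | C a =>
    obtain ⟨a', ha'⟩ := hD a
    exact ⟨MvPolynomial.C a', by simp [ha']⟩
  | add p q hp hq =>
    obtain ⟨e, he⟩ := hp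
    obtain ⟨e', he'⟩ := hq
    refine ⟨e + e', ?_⟩
    simp only [map_add, he, he', add_mul, Finset.sum_add_distrib]
    ring
  | mul_X p j hp =>
    obtain ⟨e, he⟩ := hp
    refine ⟨e * MvPolynomial.X j, ?_⟩
    have : ∀ i, MvPolynomial.aeval x (MvPolynomial.pderiv i (p * MvPolynomial.X j)) * D (x i) =
        x j * (MvPolynomial.aeval x (MvPolynomial.pderiv i p) * D (x i)) +
        if i = j then MvPolynomial.aeval x p * D (x j) else 0 := fun i ↦ by
      rw [Derivation.leibniz, MvPolynomial.pderiv_X]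
      by_cases h : i = j
      · subst h
        simp
        ring
      · simp [h, Ne.symm h]
        ring
    rw [Finset.sum_congr rfl fun i _ ↦ this i, Finset.sum_add_distrib, ← Finset.mul_sum,
      Finset.sum_ite_eq' _ _ fun _ ↦ _, if_pos (Finset.mem_univ j),
      map_mul (MvPolynomial.aeval x) p, map_mul (MvPolynomial.aeval x) e, MvPolynomial.aeval_X,
      Derivation.leibniz, he, smul_eq_mul, smul_eq_mul]
    ring

open Polynomial in
/-- Let `B` be the integral closure of a Dedekind domain `A` in a finite separable extension `L`
of the fraction field `F` of `A`. For derivations `Dⱼ` of `L` preserving `A`, the Jacobian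
determinants `det (Dⱼ bᵢ)` with `bᵢ ∈ B` lie in the dual of `B` with respect to the trace. -/
theorem trace_mul_det_mem {k A F L κ : Type*} [CommRing k] [CommRing A] [IsDedekindDomain A]
    (hA : ¬ IsField A) [Field F] [Field L] [Algebra A F] [IsFractionRing A F] [Algebra F L]
    [Algebra A L] [IsScalarTower A F L] [FiniteDimensional F L] [Algebra.IsSeparable F L]
    [Algebra k L] [Fintype κ] [DecidableEq κ] (D : κ → Derivation k L L)
    (hD : ∀ j a, D j (algebraMap A L a) ∈ (algebraMap A L).range)
    (b : κ → integralClosure A L) (c : integralClosure A L) :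
    Algebra.trace F L (c * (Matrix.of fun i j ↦ D j (b i)).det) ∈ (algebraMap A F).range := by
  classical
  let B := integralClosure A L
  have : IsDedekindDomain B := integralClosure.isDedekindDomain A F L
  have : Module.Finite A B := IsIntegralClosure.finite A F L B
  have hinjAL : Function.Injective (algebraMap A L) := by
    rw [IsScalarTower.algebraMap_eq A F L]
    exact (algebraMap F L).injective.comp (IsFractionRing.injective A F)
  have : IsFractionRing B L := integralClosure.isFractionRing_of_finite_extension F L
  have hB : ¬ IsField B := fun h ↦ hA
    (isField_of_isIntegral_of_isField (S := B) (fun x y hxy ↦ hinjAL (congrArg Subtype.val hxy)) h)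
  set h : L := (Matrix.of fun i j ↦ D j (b i)).det with hh
  -- The multipliers s that carry h into the dual of B. Producing, for each maximal ideal, an
  -- element of 𝔞 outside it shows that 𝔞 is everything.
  let 𝔞 : Ideal B :=
    { carrier := {s | ∀ c : B, Algebra.trace F L (c * (s * h)) ∈ (algebraMap A F).range}
      zero_mem' := fun c ↦ by simp
      add_mem' := fun {s t} hs ht c ↦ by
        have e : (c : L) * (((s + t : B) : L) * h) = c * (s * h) + c * (t * h) := by
          push_cast
          ring
        rw [e, map_add]
        exact add_mem (hs c) (ht c)
      smul_mem' := fun r s hs c ↦ by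
        have e : (c : L) * (((r • s : B) : L) * h) = ((c * r : B) : L) * (s * h) := by
          simp only [smul_eq_mul]
          push_cast
          ring
        rw [e]
        exact hs (c * r) }
  suffices h𝔞 : 𝔞 = ⊤ by
    have h1 : (1 : B) ∈ 𝔞 := h𝔞 ▸ Submodule.mem_top
    simpa using h1 c
  by_contra h𝔞
  obtain ⟨Q, hQ, h𝔞Q⟩ := Ideal.exists_le_maximal 𝔞 h𝔞
  have hQ0 : Q ≠ ⊥ := Ring.ne_bot_of_isMaximal_of_not_isField hQ hB
  obtain ⟨T, hT⟩ := (Algebra.FiniteType.out : (⊤ : Subalgebra A B).FG)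
  -- The given elements b are completed to a generating family of B over A.
  let ι := κ ⊕ T
  let y : ι → B := Sum.elim b (↑)
  let x : ι → L := fun i ↦ (y i : L)
  have hy : Function.Surjective (MvPolynomial.aeval y : MvPolynomial ι A →ₐ[A] B) := by
    rw [← AlgHom.range_eq_top, eq_top_iff, ← hT, Algebra.adjoin_le_iff]
    intro t ht
    exact ⟨MvPolynomial.X (Sum.inr ⟨t, ht⟩), by simp [y]⟩
  have hyx : ∀ g : MvPolynomial ι A, ((MvPolynomial.aeval y g : B) : L) = MvPolynomial.aeval x g :=
    fun g ↦ by
      change B.val (MvPolynomial.aeval y g) = _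
      rw [← AlgHom.comp_apply, MvPolynomial.comp_aeval]
      rfl
  have hyx0 : ∀ g : MvPolynomial ι A, MvPolynomial.aeval y g = 0 ↔ MvPolynomial.aeval x g = 0 :=
    fun g ↦ by rw [← hyx, ZeroMemClass.coe_eq_zero]
  have hgen : Function.Surjective (MvPolynomial.aeval x : MvPolynomial ι F →ₐ[F] L) := by
    intro l
    obtain ⟨p, q, hq, rfl⟩ := IsFractionRing.div_surjective (A := B) l
    obtain ⟨a, ha, z, hz⟩ := (Algebra.IsIntegral.isIntegral (R := A) q).isAlgebraic
      |>.exists_nonzero_dvd hq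
    obtain ⟨r, hr⟩ := hy (p * z)
    refine ⟨MvPolynomial.C (algebraMap A F a)⁻¹ * MvPolynomial.map (algebraMap A F) r, ?_⟩
    have hq0 : (q : L) ≠ 0 := by simpa using nonZeroDivisors.ne_zero hq
    have hz' : algebraMap A L a = q * z := congrArg (Subtype.val : B → L) hz
    have ha0 : algebraMap A L a ≠ 0 := by simpa using (hinjAL.ne ha)
    rw [map_mul, MvPolynomial.aeval_C, MvPolynomial.aeval_map_algebraMap, ← hyx, hr, map_inv₀,
      ← IsScalarTower.algebraMap_apply, inv_mul_eq_div]
    change ((p * z : B) : L) / _ = (p : L) / (q : L)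
    rw [div_eq_div_iff ha0 hq0, hz']
    push_cast
    change (p : L) * z * q = p * (q * z)
    ring
  obtain ⟨g, s, hsQ, hg, hsg⟩ := exists_generators_relations y hy Q hQ0
  let f : ι → MvPolynomial ι A := fun i ↦ aeval (MvPolynomial.X i) (minpoly A (x i))
  have hf0 : ∀ i, MvPolynomial.aeval x (f i) = 0 := fun i ↦ by
    simp only [f]
    rw [← Polynomial.aeval_algHom_apply, MvPolynomial.aeval_X, minpoly.aeval]
  choose M hM using fun i ↦ (Ideal.mem_span_range_iff_exists_fun.mp
    (hsg (f i) ((hyx0 _).mpr (hf0 i))))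
  let Mm : Matrix ι ι (MvPolynomial ι A) := Matrix.of M
  have hMg : Mm *ᵥ g = fun i ↦ s * f i := funext fun i ↦ hM i
  -- Cramer's rule
  have hΔ : ∀ j, Mm.det * g j ∈ Ideal.span (Set.range f) := fun j ↦ by
    have h1 : Mm.adjugate *ᵥ (Mm *ᵥ g) = Mm.det • g := by
      rw [Matrix.mulVec_mulVec, Matrix.adjugate_mul, Matrix.smul_mulVec, Matrix.one_mulVec]
    rw [← smul_eq_mul, ← Pi.smul_apply, ← h1, hMg]
    refine sum_mem fun i _ ↦ ?_
    exact Ideal.mul_mem_left _ _ (Ideal.mul_mem_left _ _ (Ideal.subset_span ⟨i, rfl⟩))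
  -- the Jacobian matrix of the relations
  let G : Matrix ι ι L := Matrix.of fun l i ↦ MvPolynomial.aeval x (MvPolynomial.pderiv i (g l))
  have hMG : Mm.map (MvPolynomial.aeval x) * G =
      Matrix.diagonal fun i ↦ MvPolynomial.aeval x s *
        aeval (x i) (derivative (minpoly A (x i))) := by
    ext i l
    have h1 := congrArg (fun p ↦ MvPolynomial.aeval x (MvPolynomial.pderiv l p)) (hM i)
    have hgx : ∀ j, MvPolynomial.aeval x (g j) = 0 := fun j ↦ (hyx0 _).mp (hg j)
    simp only [map_sum, Derivation.leibniz, map_add, smul_eq_mul, map_mul, hgx, hf0, zero_mul,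
      add_zero] at h1
    rw [Matrix.mul_apply]
    refine Eq.trans (by simp [Mm, G]) (h1.trans ?_)
    have h2 : MvPolynomial.pderiv l (f i) =
        aeval (MvPolynomial.X i : MvPolynomial ι A) (derivative (minpoly A (x i))) *
          MvPolynomial.pderiv l (MvPolynomial.X i) := by
      simp only [f]
      rw [Derivation.map_aeval, smul_eq_mul]
    rw [h2, map_mul, ← Polynomial.aeval_algHom_apply, MvPolynomial.aeval_X, MvPolynomial.pderiv_X]
    by_cases hil : i = l
    · subst hil
      simp
    · simp [hil]
  have hdet : MvPolynomial.aeval x Mm.det * G.det = MvPolynomial.aeval x s ^ Fintype.card ι *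
      ∏ i, aeval (x i) (derivative (minpoly A (x i))) := by
    have h1 := congrArg Matrix.det hMG
    rw [Matrix.det_mul, Matrix.det_diagonal, Finset.prod_mul_distrib, Finset.prod_const,
      Finset.card_univ] at h1
    rw [← h1, AlgHom.map_det]
    rfl
  have hs0 : MvPolynomial.aeval x s ≠ 0 := fun h0 ↦ hsQ (by
    rw [(hyx0 s).mpr h0]
    exact zero_mem _)
  have hprod : ∏ i, aeval (x i) (derivative (minpoly A (x i))) ≠ 0 := by
    rw [Finset.prod_ne_zero_iff]
    intro i _
    have h1 := (Algebra.IsSeparable.isSeparable F (x i)).aeval_derivative_ne_zero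
      (minpoly.aeval F (x i))
    rw [minpoly.isIntegrallyClosed_eq_field_fractions' F (y i).2, derivative_map,
      aeval_map_algebraMap] at h1
    exact h1
  have hJ0 : G.det ≠ 0 := fun h0 ↦ by
    rw [h0, mul_zero] at hdet
    exact mul_ne_zero (pow_ne_zero _ hs0) hprod hdet.symm
  -- the product of the two Jacobians is integral
  have hint : ∃ r : MvPolynomial ι A, G.det * h = MvPolynomial.aeval x r := by
    choose e he using fun l j ↦ exists_derivation_aeval (D j) (hD j) x (g l)
    have he' : ∀ l j, ∑ i, G l i * D j (x i) = - MvPolynomial.aeval x (e l j) := fun l j ↦ by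
      have h1 := he l j
      rw [(hyx0 _).mp (hg l), map_zero] at h1
      rw [eq_neg_iff_add_eq_zero, add_comm]
      exact h1.symm
    -- The derivative columns are padded by unit columns for the additional generators: the matrix
    -- becomes square and keeps the determinant h.
    let D' : Matrix ι ι L := Matrix.of fun i ↦ Sum.elim (fun j ↦ D j (x i))
      (fun t ↦ if i = Sum.inr t then 1 else 0)
    have hD' : D'.det = h := by
      have : D' = Matrix.fromBlocks (Matrix.of fun i j ↦ D j (b i)) 0
          (Matrix.of fun (t : T) j ↦ D j (t : B)) 1 := by
        ext i j
        rcases i with i | i <;> rcases j with j | j <;> simp [D', x, y, Matrix.one_apply]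
        exact if_congr Sum.inr_injective.eq_iff rfl rfl
      rw [this, Matrix.det_fromBlocks_zero₁₂, Matrix.det_one, mul_one]
    let E : Matrix ι ι (MvPolynomial ι A) := Matrix.of fun l ↦ Sum.elim (fun j ↦ - e l j)
      (fun t ↦ MvPolynomial.pderiv (Sum.inr t) (g l))
    refine ⟨E.det, ?_⟩
    -- Differentiating the relations g = 0 shows that each entry of G * D' is a polynomial in the
    -- generators, although the derivatives of the generators need not be integral.
    rw [← hD', ← Matrix.det_mul, AlgHom.map_det]
    congr 1
    ext l j
    rw [Matrix.mul_apply]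
    rcases j with j | j
    · simpa [D', E] using he' l j
    · refine (Finset.sum_eq_single (Sum.inr j) ?_ ?_).trans ?_
      · intro i _ hi
        simp [D', hi]
      · simp
      · simp [D', E, G]
  obtain ⟨r, hr⟩ := hint
  -- The determinant identity contributes `Fintype.card ι` factors s. One more is needed for the
  -- numerator: s carries every relation into the span of g, and det M carries that span into the
  -- ideal of the minimal polynomials.
  refine hsQ (hQ.isPrime.mem_of_pow_mem (Fintype.card ι + 1) (h𝔞Q fun c ↦ ?_))
  obtain ⟨c, rfl⟩ := hy c
  have key := trace_aeval_div_prod_derivative_mem (F := F) x (fun i ↦ (y i).2) hgen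
    (c * r * s * Mm.det) (fun p hp ↦ ?_)
  · convert! key using 2
    have e1 : ((MvPolynomial.aeval y s ^ (Fintype.card ι + 1) : B) : L) =
        MvPolynomial.aeval x s ^ (Fintype.card ι + 1) := by
      rw [← hyx]
      rfl
    rw [e1, hyx, eq_div_iff hprod]
    have h1 : MvPolynomial.aeval x Mm.det = MvPolynomial.aeval x s ^ Fintype.card ι *
      (∏ i, aeval (x i) (derivative (minpoly A (x i)))) / G.det := by
      rw [eq_div_iff hJ0, hdet]
    rw [map_mul, map_mul, map_mul, h1, ← hr]
    field_simp
    rw [pow_succ]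
    ring
  · have h1 := hsg p ((hyx0 p).mpr hp)
    have h2 : c * r * s * Mm.det * p = c * r * (Mm.det * (s * p)) := by ring
    rw [h2]
    refine Ideal.mul_mem_left _ _ ?_
    obtain ⟨w, hw⟩ := Ideal.mem_span_range_iff_exists_fun.mp h1
    rw [← hw, Finset.mul_sum]
    refine sum_mem fun j _ ↦ ?_
    rw [mul_left_comm]
    exact Ideal.mul_mem_left _ _ (hΔ j)

end SepNonruled

namespace SepNonruled

noncomputable section

/-! ### Coordinates on differential forms -/

/-- The coordinate of a differential form of top degree with respect to a basis. -/
def formsCoord {k E : Type*} [CommRing k] [CommRing E] [Algebra k E] {N : ℕ}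
    (b : Module.Basis (Fin N) E (Ω[E⁄k])) : ⋀[E]^N (Ω[E⁄k]) →ₗ[E] E :=
  exteriorPower.alternatingMapLinearEquiv b.det

theorem formsCoord_ιMulti {k E : Type*} [CommRing k] [CommRing E] [Algebra k E] {N : ℕ}
    (b : Module.Basis (Fin N) E (Ω[E⁄k])) (v : Fin N → Ω[E⁄k]) :
    formsCoord b (exteriorPower.ιMulti E N v) = b.det v :=
  exteriorPower.alternatingMapLinearEquiv_apply_ιMulti _ _

/-- The top exterior power is free of rank one: alternating maps are determined by injective tuples
of basis vectors, here permutations of the basis, on which both sides change by the sign. -/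
theorem formsCoord_smul_ιMulti {k E : Type*} [CommRing k] [CommRing E] [Algebra k E] {N : ℕ}
    (b : Module.Basis (Fin N) E (Ω[E⁄k])) (t : ⋀[E]^N (Ω[E⁄k])) :
    formsCoord b t • exteriorPower.ιMulti E N b = t := by
  have h : (LinearMap.toSpanSingleton E _ (exteriorPower.ιMulti E N b)) ∘ₗ formsCoord b =
      LinearMap.id := by
    apply exteriorPower.linearMap_ext
    refine b.ext_alternating fun v hv ↦ ?_
    obtain ⟨σ, rfl⟩ : ∃ σ : Equiv.Perm (Fin N), ⇑σ = v :=
      ⟨Equiv.ofBijective v (Finite.injective_iff_bijective.mp hv), rfl⟩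
    have h1 := (exteriorPower.ιMulti E N (M := Ω[E⁄k])).map_perm b σ
    have h2 := b.det.map_perm b σ
    rw [b.det_self] at h2
    change (formsCoord b (exteriorPower.ιMulti E N (b ∘ σ))) • _ = exteriorPower.ιMulti E N (b ∘ σ)
    rw [formsCoord_ιMulti, h1, h2, smul_assoc, one_smul]
  exact LinearMap.congr_fun h t

theorem formsCoord_formsMap {k A B : Type*} [CommRing k] [CommRing A] [CommRing B] [Algebra k A]
    [Algebra k B] [Algebra A B] [IsScalarTower k A B] {N : ℕ}
    (bA : Module.Basis (Fin N) A (Ω[A⁄k])) (bB : Module.Basis (Fin N) B (Ω[B⁄k]))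
    (h : ∀ i, KaehlerDifferential.map k k A B (bA i) = bB i) (t : ⋀[A]^N (Ω[A⁄k])) :
    formsCoord bB (formsMap k A B N t) = algebraMap A B (formsCoord bA t) := by
  conv_lhs => rw [← formsCoord_smul_ιMulti bA t]
  rw [map_smul, formsMap_ιMulti, algebra_compatible_smul B, map_smul, formsCoord_ιMulti, funext h,
    b_det_self bB, smul_eq_mul, mul_one]
where
  b_det_self {N : ℕ} (b : Module.Basis (Fin N) B (Ω[B⁄k])) : b.det (fun i ↦ b i) = 1 := b.det_self

/-- The derivation sending an element to the `j`-th coordinate of its differential. -/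
def coordDerivation {k E : Type*} [CommRing k] [CommRing E] [Algebra k E] {ι : Type*}
    (b : Module.Basis ι E (Ω[E⁄k])) (j : ι) : Derivation k E E :=
  (b.coord j).compDer (KaehlerDifferential.D k E)

theorem coordDerivation_apply {k E : Type*} [CommRing k] [CommRing E] [Algebra k E] {ι : Type*}
    (b : Module.Basis ι E (Ω[E⁄k])) (j : ι) (x : E) :
    coordDerivation b j x = b.repr (KaehlerDifferential.D k E x) j := rfl

/-- This connects wedge products of exact differentials with the Jacobian determinants of
`trace_mul_det_mem`. -/
theorem formsCoord_ιMulti_D {k E : Type*} [CommRing k] [CommRing E] [Algebra k E] {N : ℕ}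
    (b : Module.Basis (Fin N) E (Ω[E⁄k])) (v : Fin N → E) :
    formsCoord b (exteriorPower.ιMulti E N fun i ↦ KaehlerDifferential.D k E (v i)) =
      (Matrix.of fun i j ↦ coordDerivation b j (v i)).det := by
  rw [formsCoord_ιMulti, b.det_apply, ← Matrix.det_transpose]
  rfl

/-! ### Forms regular at all valuations -/

/-- A differential form of a field `L` over `k` which is regular at all valuation rings of `L`
containing `k`. -/
def IsRegularForm (k L : Type*) [CommRing k] [Field L] [Algebra k L] {N : ℕ}
    (ω : ⋀[L]^N (Ω[L⁄k])) : Prop :=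
  ∀ V : Subalgebra k L, (∀ x : L, x ∈ V ∨ x⁻¹ ∈ V) → ω ∈ Set.range (formsMap k V L N)

/-- The quotient rule: q v = p gives dv = q⁻¹ (dp - v dq). It is applied to a localization V of the
integral closure B, with S = B. -/
theorem span_D_eq_top_of_forall_mul_mem {k V : Type*} [CommRing k] [CommRing V] [Algebra k V]
    (S : Set V) (h : ∀ v : V, ∃ p ∈ S, ∃ q ∈ S, IsUnit q ∧ q * v = p) :
    Submodule.span V (KaehlerDifferential.D k V '' S) = ⊤ := by
  rw [eq_top_iff, ← KaehlerDifferential.span_range_derivation, Submodule.span_le]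
  rintro _ ⟨v, rfl⟩
  obtain ⟨p, hp, q, hq, ⟨u, rfl⟩, hv⟩ := h v
  have h1 : KaehlerDifferential.D k V v =
      (↑u⁻¹ : V) • (KaehlerDifferential.D k V p - v • KaehlerDifferential.D k V u) := by
    rw [← hv, Derivation.leibniz, add_sub_cancel_right, smul_smul, Units.inv_mul, one_smul]
  rw [h1]
  exact Submodule.smul_mem _ _ (sub_mem (Submodule.subset_span ⟨p, hp, rfl⟩)
    (Submodule.smul_mem _ _ (Submodule.subset_span ⟨u, hq, rfl⟩)))

/-- The coordinate of an everywhere regular form has integral trace. -/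
theorem trace_formsCoord_mem {k A F L : Type*} [CommRing k] [CommRing A] [IsDedekindDomain A]
    (hA : ¬ IsField A) [Field F] [Field L] [Algebra A F] [IsFractionRing A F] [Algebra F L]
    [Algebra A L] [IsScalarTower A F L] [FiniteDimensional F L] [Algebra.IsSeparable F L]
    [Algebra k A] [Algebra k L] [IsScalarTower k A L] {N : ℕ}
    (b : Module.Basis (Fin N) L (Ω[L⁄k]))
    (hD : ∀ j a, coordDerivation b j (algebraMap A L a) ∈ (algebraMap A L).range)
    (ω : ⋀[L]^N (Ω[L⁄k])) (hω : IsRegularForm k L ω) :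
    Algebra.trace F L (formsCoord b ω) ∈ (algebraMap A F).range := by
  let B := integralClosure A L
  have : IsDedekindDomain B := integralClosure.isDedekindDomain A F L
  have hinjAL : Function.Injective (algebraMap A L) := by
    rw [IsScalarTower.algebraMap_eq A F L]
    exact (algebraMap F L).injective.comp (IsFractionRing.injective A F)
  have : IsFractionRing B L := integralClosure.isFractionRing_of_finite_extension F L
  have hB : ¬ IsField B := fun h ↦ hA
    (isField_of_isIntegral_of_isField (S := B) (fun x y hxy ↦ hinjAL (congrArg Subtype.val hxy)) h)
  let W : Submodule B L :=
    { carrier := {x | ∀ c : B, Algebra.trace F L (c * x) ∈ (algebraMap A F).range}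
      zero_mem' := fun c ↦ by simp
      add_mem' := fun {s t} hs ht c ↦ by
        rw [mul_add, map_add]
        exact add_mem (hs c) (ht c)
      smul_mem' := fun r s hs c ↦ by
        have e : (c : L) * (r • s) = ((c * r : B) : L) * s := by
          rw [Algebra.smul_def]
          push_cast
          exact (mul_assoc _ _ _).symm
        rw [e]
        exact hs (c * r) }
  suffices h : formsCoord b ω ∈ W by simpa using h 1
  let 𝔞 : Ideal B := W.comap (LinearMap.toSpanSingleton B L (formsCoord b ω))
  suffices h𝔞 : 𝔞 = ⊤ by
    have h1 : (1 : B) ∈ 𝔞 := h𝔞 ▸ Submodule.mem_top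
    simpa [𝔞] using h1
  by_contra h𝔞
  obtain ⟨Q, hQ, h𝔞Q⟩ := Ideal.exists_le_maximal 𝔞 h𝔞
  have hQ0 : Q ≠ ⊥ := Ring.ne_bot_of_isMaximal_of_not_isField hQ hB
  -- The local ring of B at Q, realized inside L, is a discrete valuation ring containing k, so the
  -- form is regular there.
  let V' := Localization.subalgebra.ofField L Q.primeCompl Q.primeCompl_le_nonZeroDivisors
  have : IsLocalization.AtPrime V' Q := Localization.subalgebra.isLocalization_ofField L _ _
  have : IsDiscreteValuationRing V' :=
    IsLocalization.AtPrime.isDiscreteValuationRing_of_dedekind_domain B hQ0 V'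
  have : IsFractionRing V' L := Localization.subalgebra.isFractionRing_ofField L _ _
  let V : Subalgebra k L := V'.restrictScalars k
  have hV : ∀ x : L, x ∈ V ↔ ∃ (p q : B) (_ : q ∈ Q.primeCompl), x = p * (q : L)⁻¹ :=
    fun x ↦ Iff.rfl
  obtain ⟨t, rfl⟩ := hω V fun x ↦ by
    rcases ValuationRing.isInteger_or_isInteger V' x with ⟨y, hy⟩ | ⟨y, hy⟩
    · exact Or.inl (hy ▸ y.2)
    · exact Or.inr (hy ▸ y.2)
  have hq0 : ∀ q ∈ Q.primeCompl, (q : L) ≠ 0 := fun q hq h0 ↦ hq (by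
    rw [show q = 0 from Subtype.ext h0]
    exact zero_mem _)
  have hBV : ∀ p : B, (p : L) ∈ V := fun p ↦ (hV _).mpr ⟨p, 1, Q.primeCompl.one_mem, by simp⟩
  let S : Set V := {v | (v : L) ∈ B}
  have hS : Submodule.span V (KaehlerDifferential.D k V '' S) = ⊤ := by
    refine span_D_eq_top_of_forall_mul_mem S fun v ↦ ?_
    obtain ⟨p, q, hq, hv⟩ := (hV v).mp v.2
    refine ⟨⟨p, hBV p⟩, p.2, ⟨q, hBV q⟩, q.2, ?_, Subtype.ext ?_⟩
    · refine IsUnit.of_mul_eq_one ⟨(q : L)⁻¹, (hV _).mpr ⟨1, q, hq, by simp⟩⟩ (Subtype.ext ?_)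
      exact mul_inv_cancel₀ (hq0 q hq)
    · change (q : L) * v = p
      rw [hv, mul_comm, inv_mul_cancel_right₀ (hq0 q hq)]
  -- Up to a denominator prime to Q, a form over V is a B-combination of wedges of differentials of
  -- elements of B, whose coordinates lie in the dual W. Applied to ω, this puts an element outside
  -- Q into 𝔞.
  have key : ∀ t : ⋀[V]^N (Ω[V⁄k]), ∃ s ∈ Q.primeCompl,
      (s : L) * formsCoord b (formsMap k V L N t) ∈ W := by
    intro t
    have ht := (exteriorPower.ιMulti_span_of_span V N (Ω[V⁄k]) hS).ge (Submodule.mem_top (x := t))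
    induction ht using Submodule.span_induction with
    | zero => exact ⟨1, Q.primeCompl.one_mem, by simp⟩
    | add x y _ _ hx hy =>
      obtain ⟨s, hs, hx⟩ := hx
      obtain ⟨r, hr, hy⟩ := hy
      refine ⟨s * r, mul_mem hs hr, ?_⟩
      have e : ((s * r : B) : L) * formsCoord b (formsMap k V L N (x + y)) =
          r • ((s : L) * formsCoord b (formsMap k V L N x)) +
          s • ((r : L) * formsCoord b (formsMap k V L N y)) := by
        rw [map_add, map_add, Algebra.smul_def, Algebra.smul_def]
        push_cast
        change _ = (r : L) * _ + (s : L) * _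
        ring
      rw [e]
      exact add_mem (W.smul_mem _ hx) (W.smul_mem _ hy)
    | smul v x _ hx =>
      obtain ⟨s, hs, hx⟩ := hx
      obtain ⟨p, q, hq, hv⟩ := (hV v).mp v.2
      refine ⟨q * s, mul_mem hq hs, ?_⟩
      have e : ((q * s : B) : L) * formsCoord b (formsMap k V L N (v • x)) =
          p • ((s : L) * formsCoord b (formsMap k V L N x)) := by
        rw [map_smul, algebra_compatible_smul L, map_smul, smul_eq_mul, Algebra.smul_def]
        change _ * ((v : L) * _) = (p : L) * _
        have := hq0 q hq
        rw [hv]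
        push_cast
        field_simp
      rw [e]
      exact W.smul_mem _ hx
    | mem x hx =>
      obtain ⟨a, ha, rfl⟩ := hx
      choose c hcS hc using fun i ↦ ha ⟨i, rfl⟩
      refine ⟨1, Q.primeCompl.one_mem, fun d ↦ ?_⟩
      have e : formsCoord b (formsMap k V L N (exteriorPower.ιMulti V N a)) =
          (Matrix.of fun i j ↦ coordDerivation b j (c i : L)).det := by
        rw [formsMap_ιMulti, ← formsCoord_ιMulti_D]
        congr 2
        ext i
        rw [← hc, KaehlerDifferential.map_D]
        rfl
      rw [e, OneMemClass.coe_one, one_mul]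
      exact trace_mul_det_mem hA (coordDerivation b) hD (fun i ↦ ⟨c i, hcS i⟩) d
  obtain ⟨s, hs, h⟩ := key t
  exact hs (h𝔞Q h)

end

end SepNonruled

/-! ### Vanishing of traces over a rational function field -/

namespace SepNonruled

noncomputable section

open Polynomial in
/-- If `F = K(t)` is a rational function field and the derivations of `L` dual to a basis of
differentials preserve `K[t]`, then the coordinates of everywhere regular forms of `L` have
trace in `K[t]`. -/
theorem trace_formsCoord_mem_range_aeval {k K F L : Type*} [CommRing k] [Field K] [Field F]
    [Field L] [Algebra k K] [Algebra K F] [Algebra F L] [Algebra K L] [IsScalarTower K F L]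
    [Algebra k L] [IsScalarTower k K L] [FiniteDimensional F L] [Algebra.IsSeparable F L] {N : ℕ}
    (t : F) (ht : Transcendental K t) (hgen : IntermediateField.adjoin K {t} = ⊤)
    (b : Module.Basis (Fin N) L (Ω[L⁄k]))
    (hD : ∀ j a, coordDerivation b j (algebraMap K L a) ∈ (algebraMap K L).range)
    (hDt : ∀ j, ∃ p : K[X], coordDerivation b j (algebraMap F L t) = algebraMap F L (aeval t p))
    (ω : ⋀[L]^N (Ω[L⁄k])) (hω : IsRegularForm k L ω) :
    ∃ p : K[X], Algebra.trace F L (formsCoord b ω) = aeval t p := by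
  let : Algebra K[X] F := (aeval t : K[X] →ₐ[K] F).toAlgebra
  let : Algebra K[X] L := ((Algebra.ofId F L).restrictScalars K |>.comp (aeval t)).toAlgebra
  have : IsScalarTower K[X] F L := IsScalarTower.of_algebraMap_eq' rfl
  have hFL : ∀ p : K[X], algebraMap K[X] L p = algebraMap F L (aeval t p) := fun _ ↦ rfl
  have : FaithfulSMul K[X] F := (faithfulSMul_iff_algebraMap_injective _ _).mpr
    (transcendental_iff_injective.mp ht)
  have : IsFractionRing K[X] F := IsFractionRing.of_field _ _ fun z ↦ by
    have hz : z ∈ IntermediateField.adjoin K {t} := hgen ▸ IntermediateField.mem_top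
    exact (IntermediateField.mem_adjoin_simple_iff K z).mp hz
  have : IsScalarTower k K[X] L := IsScalarTower.of_algebraMap_eq fun a ↦ by
    rw [hFL, IsScalarTower.algebraMap_apply k K K[X], algebraMap_eq, aeval_C,
      ← IsScalarTower.algebraMap_apply K F L, ← IsScalarTower.algebraMap_apply k K L]
  have hD' : ∀ j (p : K[X]), coordDerivation b j (algebraMap K[X] L p) ∈
      (algebraMap K[X] L).range := fun j p ↦ by
    induction p using Polynomial.induction_on' with
    | add p q hp hq => rw [map_add, map_add]; exact add_mem hp hq
    | monomial n a =>
      rw [← C_mul_X_pow_eq_monomial, map_mul, map_pow, Derivation.leibniz, Derivation.leibniz_pow]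
      obtain ⟨a', ha'⟩ := hD j a
      obtain ⟨q, hq⟩ := hDt j
      have h1 : algebraMap K[X] L X = algebraMap F L t := by rw [hFL, aeval_X]
      have h2 : ∀ a : K, algebraMap K[X] L (C a) = algebraMap K L a := fun a ↦ by
        rw [hFL, aeval_C, ← IsScalarTower.algebraMap_apply]
      rw [h2, ← ha', ← h2, ← h2, h1, hq, ← h1, ← hFL, ← map_pow, ← map_pow, smul_eq_mul,
        smul_eq_mul, smul_eq_mul, nsmul_eq_mul]
      exact ⟨C a * ((n : K[X]) * (X ^ (n - 1) * q)) + X ^ n * C a', by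
        simp only [map_add, map_mul, map_pow, map_natCast]⟩
  obtain ⟨p, hp⟩ := trace_formsCoord_mem (A := K[X]) (F := F) (Polynomial.not_isField K) b hD' ω hω
  exact ⟨p, hp.symm⟩

-- This is the vanishing of regular one-forms on P¹: p(t) dt = -t² p(t) d(1/t) cannot be polynomial
-- in both coordinates. After clearing denominators, a nonzero p would make a polynomial of degree
-- at most deg q equal to one of degree at least deg q + 2.
open Polynomial in
theorem eq_zero_of_aeval_eq_sq_mul {K F : Type*} [Field K] [Field F] [Algebra K F] (t x : F)
    (ht : Transcendental K t) (p q : K[X]) (hp : x = aeval t p)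
    (hq : - t ^ 2 * x = aeval t⁻¹ q) : x = 0 := by
  have ht0 : t ≠ 0 := fun h ↦ ht (h ▸ isAlgebraic_zero)
  have h1 : aeval t q.reverse = aeval t⁻¹ q * t ^ q.natDegree := by
    let := invertibleOfNonzero (inv_ne_zero ht0)
    have := eval₂_reverse_mul_pow (algebraMap K F) t⁻¹ q
    rw [invOf_eq_inv, inv_inv] at this
    rw [aeval_def, aeval_def, ← this, mul_assoc, ← mul_pow, inv_mul_cancel₀ ht0, one_pow, mul_one]
  have h2 : aeval t q.reverse = aeval t (- X ^ (2 + q.natDegree) * p) := by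
    rw [h1, ← hq, hp, map_mul, map_neg, map_pow, aeval_X]
    ring
  have h3 := transcendental_iff_injective.mp ht h2
  by_cases hp0 : p = 0
  · rw [hp, hp0, map_zero]
  · have h4 := congrArg natDegree h3
    rw [neg_mul, natDegree_neg, natDegree_mul (pow_ne_zero _ X_ne_zero) hp0, natDegree_X_pow] at h4
    have := q.reverse_natDegree_le
    omega

/-- On a ruled variety, traces of everywhere regular forms of top degree vanish. -/
theorem trace_formsCoord_eq_zero {k K F L : Type*} [CommRing k] [Field K] [Field F]
    [Field L] [Algebra k K] [Algebra K F] [Algebra F L] [Algebra K L] [IsScalarTower K F L]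
    [Algebra k L] [IsScalarTower k K L] [FiniteDimensional F L] [Algebra.IsSeparable F L] {N : ℕ}
    (t : F) (ht : Transcendental K t) (hgen : IntermediateField.adjoin K {t} = ⊤)
    (bK : Module.Basis (Fin N) K (Ω[K⁄k])) (b : Module.Basis (Fin (N + 1)) L (Ω[L⁄k]))
    (hb0 : b 0 = KaehlerDifferential.D k L (algebraMap F L t))
    (hb : ∀ i : Fin N, b i.succ = KaehlerDifferential.map k k K L (bK i))
    (ω : ⋀[L]^(N + 1) (Ω[L⁄k])) (hω : IsRegularForm k L ω) :
    Algebra.trace F L (formsCoord b ω) = 0 := by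
  have ht0 : t ≠ 0 := fun h ↦ ht (h ▸ isAlgebraic_zero)
  have htL : algebraMap F L t ≠ 0 := by simpa using ht0
  have hDK : ∀ a : K, KaehlerDifferential.D k L (algebraMap K L a) =
      ∑ i : Fin N, algebraMap K L (bK.repr (KaehlerDifferential.D k K a) i) • b i.succ := fun a ↦ by
    rw [← KaehlerDifferential.map_D k k K L, ← bK.sum_repr (KaehlerDifferential.D k K a), map_sum]
    refine Finset.sum_congr rfl fun i _ ↦ ?_
    rw [map_smul, ← hb, algebra_compatible_smul L, bK.sum_repr]
  have hD : ∀ j a, coordDerivation b j (algebraMap K L a) ∈ (algebraMap K L).range := fun j a ↦ by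
    rw [coordDerivation_apply, hDK, map_sum, Finset.sum_apply']
    refine sum_mem fun i _ ↦ ?_
    rw [map_smul, b.repr_self, Finsupp.smul_apply, Finsupp.single_apply]
    split_ifs
    · exact ⟨bK.repr (KaehlerDifferential.D k K a) i, by simp⟩
    · exact ⟨0, by simp⟩
  -- The basis b' replaces dt by d(1/t) = -t⁻² dt, so the coordinate of a top form is multiplied by
  -- -t².
  let w : Fin (N + 1) → Lˣ := Fin.cons (-(Units.mk0 _ htL) ^ 2)⁻¹ fun _ ↦ 1
  let b' := b.unitsSMul w
  have hcoord : ∀ j x, coordDerivation b' j x = (w j)⁻¹ • coordDerivation b j x := fun j x ↦ by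
    rw [coordDerivation_apply, Module.Basis.repr_unitsSMul, coordDerivation_apply]
  have hform : formsCoord b' ω = algebraMap F L (- t ^ 2) * formsCoord b ω := by
    have h1 : b'.det = (algebraMap F L (- t ^ 2)) • b.det := by
      rw [Module.Basis.det_unitsSMul, Fin.prod_univ_succ]
      congr 1
      simp [w]
    rw [formsCoord, h1, map_smul]
    rfl
  have hDt : ∀ j, coordDerivation b j (algebraMap F L t) = if j = 0 then 1 else 0 := fun j ↦ by
    rw [coordDerivation_apply, ← hb0, b.repr_self, Finsupp.single_apply]
    simp [eq_comm]
  obtain ⟨p, hp⟩ := trace_formsCoord_mem_range_aeval t ht hgen b hD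
    (fun j ↦ ⟨if j = 0 then 1 else 0, by rw [hDt]; split_ifs <;> simp⟩) ω hω
  obtain ⟨q, hq⟩ := trace_formsCoord_mem_range_aeval t⁻¹ (fun h ↦ ht (IsAlgebraic.inv_iff.mp h))
    (by
      rw [eq_top_iff, ← hgen, IntermediateField.adjoin_simple_le_iff]
      simpa using inv_mem (IntermediateField.mem_adjoin_simple_self K t⁻¹)) b'
    (fun j a ↦ by
      rw [hcoord]
      induction j using Fin.cases with
      | zero =>
        refine ⟨0, ?_⟩
        rw [coordDerivation_apply, hDK, map_sum, Finset.sum_apply', Finset.sum_eq_zero]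
        · simp
        · intro i _
          rw [map_smul, b.repr_self, Finsupp.smul_apply, Finsupp.single_apply,
            if_neg (Fin.succ_ne_zero i), smul_zero]
      | succ i => simpa [w] using hD i.succ a)
    (fun j ↦ ⟨if j = 0 then 1 else 0, by
      rw [hcoord, map_inv₀, Derivation.leibniz_inv, hDt]
      induction j using Fin.cases with
      | zero => simp [w, Units.smul_def, htL]
      | succ i => simp⟩) ω hω
  rw [hform, ← Algebra.smul_def, map_smul, smul_eq_mul] at hq
  exact eq_zero_of_aeval_eq_sq_mul t _ ht p q hp hq

end

end SepNonruled

/-! ### Étale coordinates -/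

namespace SepNonruled

noncomputable section

/-- Elements `z` of a `k`-algebra `E` are étale coordinates if `E` is formally étale over the
polynomial ring `k[z]`. -/
def IsEtaleCoord (k : Type*) {E ι : Type*} [CommRing k] [CommRing E] [Algebra k E]
    (z : ι → E) : Prop :=
  (MvPolynomial.aeval z : MvPolynomial ι k →ₐ[k] E).toRingHom.FormallyEtale

/-- Differentials base change along formally étale maps, so Ω of E is E ⊗ Ω of k[z], which is free
on the dzᵢ. -/
theorem IsEtaleCoord.exists_basis {k E ι : Type*} [CommRing k] [CommRing E] [Algebra k E]
    {z : ι → E} (hz : IsEtaleCoord k z) :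
    ∃ b : Module.Basis ι E (Ω[E⁄k]), ∀ i, b i = KaehlerDifferential.D k E (z i) := by
  let : Algebra (MvPolynomial ι k) E := (MvPolynomial.aeval z).toAlgebra
  have : Algebra.FormallyEtale (MvPolynomial ι k) E := hz
  have : IsScalarTower k (MvPolynomial ι k) E :=
    IsScalarTower.of_algebraMap_eq fun a ↦ (MvPolynomial.aeval_C z a).symm
  refine ⟨((KaehlerDifferential.mvPolynomialBasis k ι).baseChange E).map
    (KaehlerDifferential.tensorKaehlerEquivOfFormallyEtale k (MvPolynomial ι k) E), fun i ↦ ?_⟩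
  rw [Module.Basis.map_apply, Module.Basis.baseChange_apply,
    KaehlerDifferential.mvPolynomialBasis_apply,
    KaehlerDifferential.tensorKaehlerEquivOfFormallyEtale_apply,
    KaehlerDifferential.mapBaseChange_tmul, one_smul, KaehlerDifferential.map_D]
  congr 1
  exact MvPolynomial.aeval_X z i

theorem formallyEtale_of_isFractionRing {R F : Type*} [CommRing R] [Field F] [Algebra R F]
    [IsFractionRing R F] : Algebra.FormallyEtale R F :=
  Algebra.FormallyEtale.of_isLocalization (nonZeroDivisors R)

/-- A separating transcendence basis gives étale coordinates. -/
theorem isEtaleCoord_of_isSeparable {k L ι : Type*} [Field k] [Field L] [Algebra k L]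
    (z : ι → L) (hz : AlgebraicIndependent k z)
    [Algebra.IsSeparable (IntermediateField.adjoin k (Set.range z)) L] : IsEtaleCoord k z := by
  let E := IntermediateField.adjoin k (Set.range z)
  have hzE : ∀ p : MvPolynomial ι k, MvPolynomial.aeval z p ∈ E := fun p ↦
    (IntermediateField.mem_adjoin_range_iff k z _).mpr ⟨p, 1, by simp⟩
  let φ : MvPolynomial ι k →ₐ[k] E := (MvPolynomial.aeval z).codRestrict E.toSubalgebra hzE
  let : Algebra (MvPolynomial ι k) E := φ.toAlgebra
  have : FaithfulSMul (MvPolynomial ι k) E := (faithfulSMul_iff_algebraMap_injective _ _).mpr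
    fun p q h ↦ hz (congrArg Subtype.val h)
  have : IsFractionRing (MvPolynomial ι k) E := IsFractionRing.of_field _ _ fun x ↦ by
    obtain ⟨r, s, h⟩ := (IntermediateField.mem_adjoin_range_iff k z _).mp x.2
    exact ⟨r, s, Subtype.ext h⟩
  have h1 : φ.toRingHom.FormallyEtale := formallyEtale_of_isFractionRing (R := MvPolynomial ι k)
  have h2 : (algebraMap E L).FormallyEtale :=
    RingHom.formallyEtale_algebraMap.mpr (Algebra.FormallyEtale.of_isSeparable E L)
  exact h1.comp h2

theorem exists_isEtaleCoord (k K : Type*) [Field k] [PerfectField k] [Field K] [Algebra k K]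
    [Algebra.EssFiniteType k K] :
    ∃ (n : ℕ) (z : Fin n → K), AlgebraicIndependent k z ∧ IsEtaleCoord k z := by
  obtain ⟨s, hs, hsep⟩ := exists_isTranscendenceBasis_and_isSeparable_of_perfectField k K
  let e := s.equivFin.symm
  let z : Fin s.card → K := fun i ↦ e i
  have hz : AlgebraicIndependent k z := hs.1.comp e e.injective
  have hr : Set.range z = s := by
    rw [show z = Subtype.val ∘ e from rfl, Set.range_comp, e.surjective.range_eq, Set.image_univ,
      Subtype.range_coe]
  rw [← hr] at hsep
  exact ⟨_, z, hz, isEtaleCoord_of_isSeparable z hz⟩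

open Polynomial in
theorem formallyEtale_mapRingHom {R S : Type*} [CommRing R] [CommRing S] (f : R →+* S)
    (hf : f.FormallyEtale) : (mapRingHom f).FormallyEtale := by
  let : Algebra R S := f.toAlgebra
  have : Algebra.FormallyEtale R S := hf
  let : Algebra R[X] S[X] := Polynomial.algebra R S
  have h : Algebra.FormallyEtale R[X] S[X] :=
    Algebra.FormallyEtale.of_equiv (Algebra.IsPushout.equiv R R[X] S S[X])
  exact h

open Polynomial in
/-- Étale coordinates of `K` together with `t` are étale coordinates of a separable extension of
the rational function field `K(t)`. -/
theorem IsEtaleCoord.cons {k K F L : Type*} [Field k] [Field K] [Field F]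
    [Field L] [Algebra k K] [Algebra K F] [Algebra F L] [Algebra K L] [IsScalarTower K F L]
    [Algebra k L] [IsScalarTower k K L] [Algebra.IsSeparable F L] {n : ℕ}
    (t : F) (ht : Transcendental K t) (hgen : IntermediateField.adjoin K {t} = ⊤)
    (y : Fin n → K) (hy : IsEtaleCoord k y) (hya : AlgebraicIndependent k y) :
    IsEtaleCoord k (Fin.cons (algebraMap F L t) fun i ↦ algebraMap K L (y i) : Fin (n + 1) → L) ∧
    AlgebraicIndependent k
      (Fin.cons (algebraMap F L t) fun i ↦ algebraMap K L (y i) : Fin (n + 1) → L) := by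
  let : Algebra K[X] F := (aeval t : K[X] →ₐ[K] F).toAlgebra
  have : FaithfulSMul K[X] F := (faithfulSMul_iff_algebraMap_injective _ _).mpr
    (transcendental_iff_injective.mp ht)
  have : IsFractionRing K[X] F := IsFractionRing.of_field _ _ fun z ↦ by
    have hz : z ∈ IntermediateField.adjoin K {t} := hgen ▸ IntermediateField.mem_top
    exact (IntermediateField.mem_adjoin_simple_iff K z).mp hz
  have h3 : (aeval t : K[X] →ₐ[K] F).toRingHom.FormallyEtale :=
    formallyEtale_of_isFractionRing (R := K[X]) (F := F)
  have h4 : (algebraMap F L).FormallyEtale :=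
    RingHom.formallyEtale_algebraMap.mpr (Algebra.FormallyEtale.of_isSeparable F L)
  have h2 := formallyEtale_mapRingHom _ hy
  have h1 : (MvPolynomial.finSuccEquiv k n).toAlgHom.toRingHom.FormallyEtale := by
    let : Algebra (MvPolynomial (Fin (n + 1)) k) (MvPolynomial (Fin n) k)[X] :=
      (MvPolynomial.finSuccEquiv k n).toAlgHom.toRingHom.toAlgebra
    exact Algebra.FormallyEtale.of_equiv
      (AlgEquiv.ofRingEquiv (f := (MvPolynomial.finSuccEquiv k n).toRingEquiv) fun _ ↦ rfl)
  -- The coordinate map factors as k[t, y] ≅ k[y][t] → K[t] → K(t) = F → L. Each factor is formally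
  -- étale and injective.
  have e : (MvPolynomial.aeval (Fin.cons (algebraMap F L t) fun i ↦ algebraMap K L (y i) :
      Fin (n + 1) → L) : MvPolynomial (Fin (n + 1)) k →ₐ[k] L).toRingHom =
      (algebraMap F L).comp ((aeval t : K[X] →ₐ[K] F).toRingHom.comp
        ((mapRingHom (MvPolynomial.aeval y : MvPolynomial (Fin n) k →ₐ[k] K).toRingHom).comp
          (MvPolynomial.finSuccEquiv k n).toAlgHom.toRingHom)) := by
    apply MvPolynomial.ringHom_ext
    · intro a
      have : MvPolynomial.finSuccEquiv k n (MvPolynomial.C a) = C (MvPolynomial.C a) := by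
        simp [MvPolynomial.finSuccEquiv_apply]
      simp [this, ← IsScalarTower.algebraMap_apply]
    · intro i
      induction i using Fin.cases with
      | zero => simp [MvPolynomial.finSuccEquiv_X_zero]
      | succ i => simp [MvPolynomial.finSuccEquiv_X_succ, ← IsScalarTower.algebraMap_apply]
  constructor
  · rw [IsEtaleCoord, e]
    exact ((h1.comp h2).comp h3).comp h4
  · change Function.Injective (MvPolynomial.aeval (Fin.cons (algebraMap F L t)
      fun i ↦ algebraMap K L (y i) : Fin (n + 1) → L) :
        MvPolynomial (Fin (n + 1)) k →ₐ[k] L).toRingHom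
    rw [e]
    exact (algebraMap F L).injective.comp ((transcendental_iff_injective.mp ht).comp
      ((Polynomial.map_injective _ hya).comp (MvPolynomial.finSuccEquiv k n).injective))

end

end SepNonruled

/-! ### Traces on fibers of finite étale extensions -/

namespace SepNonruled

noncomputable section

open scoped TensorProduct

theorem trace_tmul_baseChange {R S : Type*} (T : Type*) [CommRing R] [CommRing S] [CommRing T]
    [Algebra R S] [Algebra R T] [Module.Free R S] [Module.Finite R S] (x : S) :
    Algebra.trace T (T ⊗[R] S) (1 ⊗ₜ x) = algebraMap R T (Algebra.trace R S x) := by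
  rw [Algebra.trace_apply, Algebra.trace_apply, ← LinearMap.trace_baseChange]
  congr 1
  ext y
  simp

theorem trace_pi_eq_sum {k ι : Type*} [Field k] [Fintype ι] (v : ι → k) :
    Algebra.trace k (ι → k) v = ∑ i, v i := by
  classical
  rw [Algebra.trace_apply, LinearMap.trace_eq_matrix_trace k (Pi.basisFun k ι), Matrix.trace]
  refine Finset.sum_congr rfl fun i _ ↦ ?_
  simp

/-- The trace of a finite étale algebra over an algebraically closed field is the sum over its
rational points. -/
theorem exists_algHom_trace_eq_sum (k C : Type*) [Field k] [IsAlgClosed k] [CommRing C]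
    [Algebra k C] [Module.Finite k C] [Algebra.FormallyEtale k C] :
    ∃ f : Fin (Module.finrank k C) → (C →ₐ[k] k), Function.Injective f ∧
      ∀ c, Algebra.trace k C c = ∑ i, f i c := by
  classical
  have : IsArtinianRing C := isArtinian_of_tower k inferInstance
  have : Finite (PrimeSpectrum C) :=
    Finite.of_equiv _ IsArtinianRing.primeSpectrumEquivMaximalSpectrum.symm
  have := Fintype.ofFinite (PrimeSpectrum C)
  let ε : C ≃ₐ[k] (PrimeSpectrum C → k) := Algebra.FormallyEtale.equivPiOfIsSepClosed k C
  have hcard : Fintype.card (PrimeSpectrum C) = Module.finrank k C := by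
    rw [ε.toLinearEquiv.finrank_eq, Module.finrank_pi]
  let σ : Fin (Module.finrank k C) ≃ PrimeSpectrum C := (Fintype.equivFinOfCardEq hcard).symm
  refine ⟨fun i ↦ (Pi.evalAlgHom k _ (σ i)).comp ε.toAlgHom, fun i j hij ↦ ?_, fun c ↦ ?_⟩
  · by_contra hne
    have h := DFunLike.congr_fun hij (ε.symm (Pi.single (σ i) 1))
    have hne' : σ j ≠ σ i := fun h ↦ hne (σ.injective h).symm
    have h' : ε (ε.symm (Pi.single (σ i) 1)) (σ i) = ε (ε.symm (Pi.single (σ i) 1)) (σ j) := h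
    rw [AlgEquiv.apply_symm_apply, Pi.single_eq_same, Pi.single_eq_of_ne hne'] at h'
    exact one_ne_zero h'
  · rw [← Algebra.trace_eq_of_algEquiv ε, trace_pi_eq_sum, ← σ.sum_comp]
    rfl

/-- A nonzero integral element of B divides a nonzero element of A, so denominators can be taken in
A. This makes L the base change of B to the fraction field of A. -/
theorem isLocalization_algebraMapSubmonoid_of_isIntegral {A B L : Type*} [CommRing A] [IsDomain A]
    [CommRing B] [IsDomain B] [Algebra A B] [FaithfulSMul A B] [Algebra.IsIntegral A B] [Field L]
    [Algebra B L] [IsFractionRing B L] :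
    IsLocalization (Algebra.algebraMapSubmonoid B (nonZeroDivisors A)) L where
  map_units := by
    rintro ⟨_, a, ha, rfl⟩
    rw [isUnit_iff_ne_zero, Ne, map_eq_zero_iff _ (IsFractionRing.injective B L),
      map_eq_zero_iff _ (FaithfulSMul.algebraMap_injective A B)]
    exact nonZeroDivisors.ne_zero ha
  surj := fun l ↦ by
    obtain ⟨p, q, hq, rfl⟩ := IsFractionRing.div_surjective (A := B) l
    obtain ⟨a, ha, z, hz⟩ := (Algebra.IsIntegral.isIntegral (R := A) q).isAlgebraic
      |>.exists_nonzero_dvd hq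
    refine ⟨⟨p * z, ⟨_, a, mem_nonZeroDivisors_of_ne_zero ha, rfl⟩⟩, ?_⟩
    have hq0 : algebraMap B L q ≠ 0 := by
      simpa using nonZeroDivisors.ne_zero hq
    simp only [hz, map_mul]
    field_simp
  exists_of_eq := fun h ↦ ⟨1, by rw [IsFractionRing.injective B L h]⟩

/-- The fiber of a finite étale extension of domains at a rational point consists of as many
maximal ideals as the degree of the extension of fraction fields. An element of trace zero which
vanishes at all but one of them vanishes at the last one. -/
theorem exists_fiber {k : Type*} {A B F L : Type u} [Field k] [IsAlgClosed k] [CommRing A]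
    [IsDomain A] [CommRing B] [IsDomain B] [Algebra A B] [Algebra.Etale A B] [Module.Finite A B]
    [Field F] [Field L] [Algebra A F] [IsFractionRing A F] [Algebra B L] [IsFractionRing B L]
    [Algebra F L] [Algebra A L] [IsScalarTower A F L] [IsScalarTower A B L]
    [FaithfulSMul A B] (χ : A →+* k) (hχ : Function.Surjective χ) :
    ∃ q : Fin (Module.finrank F L) → Ideal B, Function.Injective q ∧ (∀ i, (q i).IsMaximal) ∧
      ∀ g : B, Algebra.trace F L (algebraMap B L g) = 0 →
        ∀ i, (∀ j, j ≠ i → g ∈ q j) → g ∈ q i := by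
  classical
  let m := RingHom.ker χ
  have hm : m.IsPrime := RingHom.ker_isPrime χ
  -- Over the local ring O, the extension becomes free, so its rank and trace specialize both to F
  -- and to the residue point k.
  let O := Localization.AtPrime m
  let : Algebra A k := χ.toAlgebra
  let χO : O →+* k := IsLocalization.lift (M := m.primeCompl) (g := χ) fun s ↦
    (isUnit_iff_ne_zero.mpr fun h ↦ s.2 h)
  let : Algebra O k := χO.toAlgebra
  have : IsScalarTower A O k := IsScalarTower.of_algebraMap_eq fun a ↦
    (IsLocalization.lift_eq (M := m.primeCompl) (g := χ) _ a).symm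
  let E := O ⊗[A] B
  have : Module.Free O E := Module.free_of_flat_of_isLocalRing
  -- the generic fiber
  have hloc : IsLocalization (Algebra.algebraMapSubmonoid B (nonZeroDivisors A)) L :=
    isLocalization_algebraMapSubmonoid_of_isIntegral
  let φO : O →+* F := IsLocalization.lift (M := m.primeCompl) (g := algebraMap A F) fun s ↦
    (isUnit_iff_ne_zero.mpr fun h ↦ s.2 (by
      rw [(map_eq_zero_iff _ (IsFractionRing.injective A F)).mp h]
      exact zero_mem m))
  let : Algebra O F := φO.toAlgebra
  have : IsScalarTower A O F := IsScalarTower.of_algebraMap_eq fun a ↦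
    (IsLocalization.lift_eq (M := m.primeCompl) (g := algebraMap A F) _ a).symm
  have : IsFractionRing O F :=
    IsFractionRing.isFractionRing_of_isDomain_of_isLocalization m.primeCompl O F
  have hpush : Algebra.IsPushout A B F L :=
    Algebra.isPushout_of_isLocalization (nonZeroDivisors A) F B L
  let e : F ⊗[A] B ≃ₐ[F] L := Algebra.IsPushout.equiv A F B L
  have he : ∀ g : B, e (1 ⊗ₜ g) = algebraMap B L g := fun g ↦ by
    simp [e, Algebra.IsPushout.equiv_tmul]
  let e' : F ⊗[O] E ≃ₐ[F] L := (Algebra.TensorProduct.cancelBaseChange A O F F B).trans e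
  have he' : ∀ g : B, e' (1 ⊗ₜ (1 ⊗ₜ g)) = algebraMap B L g := fun g ↦ by
    have h := Algebra.TensorProduct.cancelBaseChange_tmul A O F F B 1 1 g
    rw [one_smul] at h
    exact (congrArg e h).trans (he g)
  have htr : ∀ g : B, Algebra.trace F L (algebraMap B L g) =
      algebraMap O F (Algebra.trace O E (1 ⊗ₜ g)) := fun g ↦ by
    rw [← he']
    exact (Algebra.trace_eq_of_algEquiv e' _).trans (trace_tmul_baseChange F _)
  have hrank : Module.finrank F L = Module.finrank O E := by
    rw [← e'.toLinearEquiv.finrank_eq, Module.finrank_baseChange]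
  -- the special fiber
  let C := k ⊗[O] E
  have hrank' : Module.finrank F L = Module.finrank k C := by
    rw [hrank, ← Module.finrank_baseChange (R := k) (S := O)]
  obtain ⟨f, hf, hfs⟩ := exists_algHom_trace_eq_sum k C
  rw [hrank']
  let ψ : Fin (Module.finrank k C) → B →+* k := fun i ↦ (f i).toRingHom.comp
    ((Algebra.TensorProduct.includeRight : E →ₐ[O] C).toRingHom.comp
      (Algebra.TensorProduct.includeRight : B →ₐ[A] E).toRingHom)
  have hψ : ∀ p g, ψ p g = f p (1 ⊗ₜ (1 ⊗ₜ g)) := fun _ _ ↦ rfl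
  have hψA : ∀ p a, ψ p (algebraMap A B a) = χ a := fun p a ↦ by
    have h1 : (1 : O) ⊗ₜ[A] algebraMap A B a = algebraMap O E (algebraMap A O a) := by
      rw [Algebra.TensorProduct.algebraMap_apply, Algebra.algebraMap_self_apply,
        Algebra.TensorProduct.tmul_one_eq_one_tmul]
    have h2 : (1 : k) ⊗ₜ[O] algebraMap O E (algebraMap A O a) = χ a ⊗ₜ[O] (1 : E) := by
      rw [← Algebra.TensorProduct.tmul_one_eq_one_tmul, ← IsScalarTower.algebraMap_apply]
      rfl
    rw [hψ, h1]
    exact (congrArg (f p) h2).trans (AlgHom.commutes (f p) (χ a))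
  have hψs : ∀ p, Function.Surjective (ψ p) := fun p x ↦ by
    obtain ⟨a, rfl⟩ := hχ x
    exact ⟨algebraMap A B a, hψA p a⟩
  -- All ψ p agree with χ on A, and χ is surjective, so the kernel determines ψ p, which in turn
  -- determines the point f p of the fiber.
  have hinj : Function.Injective fun p ↦ RingHom.ker (ψ p) := by
    intro p p' hp
    have h1 : ∀ g, ψ p g = ψ p' g := fun g ↦ by
      obtain ⟨a, ha⟩ := hχ (ψ p g)
      have h2 : g - algebraMap A B a ∈ RingHom.ker (ψ p) := by
        rw [RingHom.mem_ker, map_sub, hψA, ha, sub_self]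
      rw [show RingHom.ker (ψ p) = RingHom.ker (ψ p') from hp, RingHom.mem_ker, map_sub, hψA, ha,
        sub_eq_zero] at h2
      exact h2.symm
    refine hf (AlgHom.ext fun c ↦ ?_)
    induction c using TensorProduct.induction_on with
    | zero => exact (map_zero (f p)).trans (map_zero (f p')).symm
    | add x y hx hy =>
      exact (map_add (f p) x y).trans ((congrArg₂ (· + ·) hx hy).trans (map_add (f p') x y).symm)
    | tmul x y =>
      induction y using TensorProduct.induction_on with
      | zero =>
        rw [TensorProduct.tmul_zero]
        exact (map_zero (f p)).trans (map_zero (f p')).symm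
      | add y z hy hz =>
        rw [TensorProduct.tmul_add]
        exact (map_add (f p) _ _).trans
          ((congrArg₂ (· + ·) hy hz).trans (map_add (f p') _ _).symm)
      | tmul o g =>
        have h3 : x ⊗ₜ[O] (o ⊗ₜ[A] g) = (o • x) • ((1 : k) ⊗ₜ[O] ((1 : O) ⊗ₜ[A] g)) := by
          rw [TensorProduct.smul_tmul', smul_eq_mul, mul_one, TensorProduct.smul_tmul,
            TensorProduct.smul_tmul', smul_eq_mul, mul_one]
        rw [h3]
        exact (map_smul (f p) _ _).trans ((congrArg ((o • x) • ·) (h1 g)).trans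
          (map_smul (f p') _ _).symm)
  refine ⟨fun i ↦ RingHom.ker (ψ i), hinj,
    fun i ↦ RingHom.ker_isMaximal_of_surjective _ (hψs _), fun g hg i h ↦ ?_⟩
  rw [htr] at hg
  have h1 : Algebra.trace O E (1 ⊗ₜ g) = 0 :=
    (map_eq_zero_iff (algebraMap O F) (IsFractionRing.injective O F)).mp hg
  have h2 : ∑ p, ψ p g = 0 := by
    refine (hfs (1 ⊗ₜ (1 ⊗ₜ g))).symm.trans ((trace_tmul_baseChange k _).trans ?_)
    rw [h1, map_zero]
  rw [Finset.sum_eq_single i (fun p _ hp ↦ h p hp) (by simp)] at h2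
  exact h2

end

end SepNonruled

/-! ### Spreading out properties of function fields -/

namespace SepNonruled

noncomputable section

open nonZeroDivisors

/-- L is the local ring of B at its generic point, and the étale locus is open. Allowing all
multiples g of f lets this condition be combined with others. -/
theorem exists_formallyEtale_localization {R B L : Type*} [CommRing R] [CommRing B] [IsDomain B]
    [Algebra R B] [Algebra.FinitePresentation R B] [Field L] [Algebra B L] [IsFractionRing B L]
    [Algebra R L] [IsScalarTower R B L] [Algebra.FormallyEtale R L] :
    ∃ f : B, f ≠ 0 ∧ ∀ g : B, f ∣ g → ∀ (C : Type*) [CommRing C] [Algebra B C]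
      [IsLocalization.Away g C] [Algebra R C] [IsScalarTower R B C], Algebra.FormallyEtale R C := by
  have : IsLocalization.AtPrime L (⊥ : Ideal B) := by
    rw [IsLocalization.AtPrime, Ideal.primeCompl_bot]
    infer_instance
  let e : L ≃ₐ[B] Localization.AtPrime (⊥ : Ideal B) :=
    IsLocalization.algEquiv (⊥ : Ideal B).primeCompl _ _
  have : Algebra.IsEtaleAt R (⊥ : Ideal B) := Algebra.FormallyEtale.of_equiv (e.restrictScalars R)
  obtain ⟨f, hf, hfe⟩ := Algebra.exists_etale_of_isEtaleAt (R := R) (⊥ : Ideal B)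
  refine ⟨f, by simpa using hf, ?_⟩
  intro g hfg C _ _ _ _ _
  have h := Algebra.basicOpen_subset_etaleLocus_iff_etale.mpr hfe
  have h2 : (PrimeSpectrum.basicOpen g : Set (PrimeSpectrum B)) ⊆
      PrimeSpectrum.basicOpen f := by
    obtain ⟨c, rfl⟩ := hfg
    exact PrimeSpectrum.basicOpen_mul_le_left f c
  have := Algebra.basicOpen_subset_etaleLocus_iff.mp (h2.trans h)
  let e' : Localization.Away g ≃ₐ[B] C := IsLocalization.algEquiv (Submonoid.powers g) _ _
  exact Algebra.FormallyEtale.of_equiv (e'.restrictScalars R)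

/-- Some nonzero a in A makes finitely many generators of B integral after multiplication; inverting
a makes the generators themselves integral. -/
theorem exists_integral_localization {A B : Type*} [CommRing A] [IsDomain A] [CommRing B]
    [Algebra A B] [Algebra.FiniteType A B] [Algebra.IsAlgebraic A B] :
    ∃ a : A, a ≠ 0 ∧ ∀ c : A, a ∣ c → ∀ (A' B' : Type*) [CommRing A'] [CommRing B']
      [Algebra A A'] [IsLocalization.Away c A'] [Algebra B B']
      [IsLocalization.Away (algebraMap A B c) B'] [Algebra A' B'] [Algebra A B']
      [IsScalarTower A A' B'] [IsScalarTower A B B'], Module.Finite A' B' := by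
  obtain ⟨s, hs⟩ := ‹Algebra.FiniteType A B›.out
  obtain ⟨a, ha, h⟩ := Algebra.IsAlgebraic.exists_integral_multiples A s
  refine ⟨a, ha, ?_⟩
  intro c hac A' B' _ _ _ _ _ _ _ _ _ _
  have hint : ∀ b : B, IsIntegral A' (algebraMap B B' b) := fun b ↦ by
    have hb : b ∈ Algebra.adjoin A (s : Set B) := hs ▸ Algebra.mem_top
    induction hb using Algebra.adjoin_induction with
    | mem x hx =>
      obtain ⟨e, rfl⟩ := hac
      have hu : IsUnit (algebraMap A A' a) :=
        isUnit_of_mul_isUnit_left (y := algebraMap A A' e) (by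
          rw [← map_mul]; exact IsLocalization.Away.algebraMap_isUnit (a * e))
      obtain ⟨u, hu⟩ := hu
      have h1 : IsIntegral A' (algebraMap B B' (a • x)) :=
        ((h x hx).map (IsScalarTower.toAlgHom A B B')).tower_top
      have h2 : algebraMap B B' x = (↑u⁻¹ : A') • algebraMap B B' (a • x) := by
        rw [Algebra.smul_def a x, map_mul, ← IsScalarTower.algebraMap_apply A B B',
          IsScalarTower.algebraMap_apply A A' B', ← hu, ← Algebra.smul_def, smul_smul,
          Units.inv_mul, one_smul]
      rw [h2]
      exact h1.smul _
    | algebraMap r =>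
      rw [← IsScalarTower.algebraMap_apply, IsScalarTower.algebraMap_apply A A' B']
      exact isIntegral_algebraMap
    | add x y _ _ hx hy => rw [map_add]; exact hx.add hy
    | mul x y _ _ hx hy => rw [map_mul]; exact hx.mul hy
  have hint' : Algebra.IsIntegral A' B' := ⟨fun x ↦ by
    obtain ⟨n, b, hb⟩ := IsLocalization.Away.surj (algebraMap A B c) x
    obtain ⟨u, hu⟩ := IsLocalization.Away.algebraMap_isUnit (S := A') c
    have h2 : x = (↑(u⁻¹ ^ n) : A') • algebraMap B B' b := by
      rw [← hb, ← IsScalarTower.algebraMap_apply, IsScalarTower.algebraMap_apply A A' B', ← hu,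
        ← map_pow, Algebra.smul_def, mul_left_comm, ← map_mul, ← Units.val_pow_eq_pow_val,
        ← Units.val_mul, inv_pow, inv_mul_cancel, Units.val_one, map_one, mul_one]
    rw [h2]
    exact (hint b).smul _⟩
  have : Algebra.FinitePresentation B B' :=
    IsLocalization.Away.finitePresentation (algebraMap A B c)
  have : Algebra.FiniteType B B' := inferInstance
  have : Algebra.FiniteType A B' := Algebra.FiniteType.trans (S := B) ‹_› this
  have : Algebra.FiniteType A' B' := Algebra.FiniteType.of_restrictScalars_finiteType A A' B'
  exact Algebra.IsIntegral.finite

theorem exists_ringHom_surjective {k A : Type*} [Field k] [IsAlgClosed k] [CommRing A]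
    [Nontrivial A] [Algebra k A] [Algebra.FiniteType k A] :
    ∃ χ : A →ₐ[k] k, Function.Surjective χ := by
  obtain ⟨m, hm⟩ := Ideal.exists_maximal A
  let : Field (A ⧸ m) := Ideal.Quotient.field m
  have := finite_of_finite_type_of_isJacobsonRing k (A ⧸ m)
  let e : k ≃ₐ[k] A ⧸ m := AlgEquiv.ofBijective (Algebra.ofId k (A ⧸ m))
    IsAlgClosed.algebraMap_bijective_of_isIntegral
  exact ⟨e.symm.toAlgHom.comp (Ideal.Quotient.mkₐ k m),
    e.symm.surjective.comp Ideal.Quotient.mk_surjective⟩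

/-- In a Jacobson domain the maximal ideals intersect in zero. Were they finite in number, one of
them would be zero by primeness, and B would be a field finite over k. -/
theorem infinite_maximalSpectrum {k B : Type*} [Field k] [CommRing B] [IsDomain B]
    [Algebra k B] [Algebra.FiniteType k B] (z : B) (hz : Transcendental k z) :
    {q : Ideal B | q.IsMaximal}.Infinite := by
  intro hfin
  have hJ : IsJacobsonRing B := isJacobsonRing_of_finiteType (A := k)
  have h0 : sInf {q : Ideal B | q.IsMaximal} = ⊥ := by
    have := IsJacobsonRing.out hJ (I := ⊥) (Ideal.isPrime_bot.isRadical)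
    simpa [Ideal.jacobson] using this
  have h1 : ∃ q ∈ hfin.toFinset, q ≤ (⊥ : Ideal B) := by
    have h2 : hfin.toFinset.inf id ≤ (⊥ : Ideal B) := by
      rw [← h0]
      refine le_sInf fun q hq ↦ ?_
      exact Finset.inf_le (f := id) (hfin.mem_toFinset.mpr hq)
    exact (Ideal.IsPrime.inf_le' Ideal.isPrime_bot).mp h2
  obtain ⟨q, hq, hq0⟩ := h1
  have hq : q.IsMaximal := hfin.mem_toFinset.mp hq
  rw [le_bot_iff] at hq0
  subst hq0
  let : Field B := (Ring.isField_iff_maximal_bot.mpr hq).toField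
  have := finite_of_finite_type_of_isJacobsonRing k B
  exact hz (Algebra.IsAlgebraic.isAlgebraic z)

end

end SepNonruled

/-! ### General fibers of a separable extension -/

namespace SepNonruled

noncomputable section

open nonZeroDivisors

/-- A finite separable extension of fraction fields is generically finite étale: after localization
there are fibers over rational points and given étale coordinates of the fraction field are étale
coordinates. -/
theorem exists_localization_fiber {k A B F L : Type u} [Field k] [IsAlgClosed k]
    [CommRing A] [IsDomain A] [Algebra k A] [Algebra.FiniteType k A]
    [CommRing B] [IsDomain B] [Algebra k B] [Algebra.FiniteType k B] [Algebra A B]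
    [IsScalarTower k A B] [Field F] [Algebra A F] [IsFractionRing A F] [Field L] [Algebra B L]
    [IsFractionRing B L] [Algebra F L] [Algebra A L] [IsScalarTower A F L] [IsScalarTower A B L]
    [Algebra k L] [IsScalarTower k B L] [FiniteDimensional F L] [Algebra.IsSeparable F L]
    {N : ℕ} (z : Fin N → B) (hz : IsEtaleCoord k fun i ↦ algebraMap B L (z i)) :
    ∃ c : B, c ≠ 0 ∧ ∀ (B' : Type u) [CommRing B'] [Algebra B B'] [IsLocalization.Away c B']
      [Algebra B' L] [IsScalarTower B B' L] [Algebra k B'] [IsScalarTower k B B'],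
      (IsEtaleCoord k fun i ↦ algebraMap B B' (z i)) ∧
      ∃ q : Fin (Module.finrank F L) → Ideal B', Function.Injective q ∧ (∀ i, (q i).IsMaximal) ∧
        ∀ g : B', Algebra.trace F L (algebraMap B' L g) = 0 →
          ∀ i, (∀ j, j ≠ i → g ∈ q j) → g ∈ q i := by
  have hAL : Function.Injective (algebraMap A L) := by
    rw [IsScalarTower.algebraMap_eq A F L]
    exact (algebraMap F L).injective.comp (IsFractionRing.injective A F)
  have hAB : Function.Injective (algebraMap A B) := by
    rw [IsScalarTower.algebraMap_eq A B L] at hAL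
    exact Function.Injective.of_comp hAL
  have : FaithfulSMul A B := (faithfulSMul_iff_algebraMap_injective _ _).mpr hAB
  have : FaithfulSMul A L := (faithfulSMul_iff_algebraMap_injective _ _).mpr hAL
  have : IsNoetherianRing A := Algebra.FiniteType.isNoetherianRing k A
  have : Algebra.FiniteType A B := Algebra.FiniteType.of_restrictScalars_finiteType k A B
  have : Algebra.FinitePresentation A B := Algebra.FinitePresentation.of_finiteType.mp ‹_›
  have : Algebra.IsAlgebraic A L := (IsFractionRing.comap_isAlgebraic_iff (A := A) (K := F)
    (C := L)).mpr inferInstance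
  have : Algebra.IsAlgebraic A B := ⟨fun b ↦ by
    rw [← isAlgebraic_algebraMap_iff (A := L) (IsFractionRing.injective B L)]
    exact Algebra.IsAlgebraic.isAlgebraic _⟩
  have h1 : Algebra.FormallyEtale A F := formallyEtale_of_isFractionRing
  have h2 : Algebra.FormallyEtale F L := Algebra.FormallyEtale.of_isSeparable F L
  have h3 : Algebra.FormallyEtale A L := Algebra.FormallyEtale.comp A F L
  obtain ⟨f₁, hf₁, H₁⟩ := exists_formallyEtale_localization (R := A) (B := B) (L := L)
  let P := MvPolynomial (Fin N) k
  let : Algebra P B := (MvPolynomial.aeval z).toAlgebra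
  let : Algebra P L := (MvPolynomial.aeval fun i ↦ algebraMap B L (z i)).toAlgebra
  have hcomp : ∀ (C : Type u) [CommRing C] [Algebra B C] [Algebra k C] [IsScalarTower k B C]
      (p : P), MvPolynomial.aeval (fun i ↦ algebraMap B C (z i)) p =
        algebraMap B C (MvPolynomial.aeval z p) := fun C _ _ _ _ p ↦
    MvPolynomial.aeval_algebraMap_apply C z p
  have : IsScalarTower P B L := IsScalarTower.of_algebraMap_eq (hcomp L)
  have : IsScalarTower k P B := IsScalarTower.of_algebraMap_eq fun a ↦
    (MvPolynomial.aeval_C z a).symm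
  have : Algebra.FiniteType P B := Algebra.FiniteType.of_restrictScalars_finiteType k P B
  have : Algebra.FinitePresentation P B := Algebra.FinitePresentation.of_finiteType.mp ‹_›
  have : Algebra.FormallyEtale P L := hz
  obtain ⟨f₂, hf₂, H₂⟩ := exists_formallyEtale_localization (R := P) (B := B) (L := L)
  obtain ⟨a₁, ha₁, H₃⟩ := exists_integral_localization (A := A) (B := B)
  -- The bad locus in B is enlarged to one coming from A, so that source and target are localized at
  -- the same element and the map between them stays finite.
  obtain ⟨a₂, ha₂, hdvd⟩ := (Algebra.IsAlgebraic.isAlgebraic (R := A) (f₁ * f₂)).exists_nonzero_dvd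
    (mem_nonZeroDivisors_of_ne_zero (mul_ne_zero hf₁ hf₂))
  have ha : a₁ * a₂ ≠ 0 := mul_ne_zero ha₁ ha₂
  have hdvd' : f₁ * f₂ ∣ algebraMap A B (a₁ * a₂) := by
    rw [map_mul]
    exact hdvd.mul_left _
  refine ⟨algebraMap A B (a₁ * a₂), (map_ne_zero_iff _ hAB).mpr ha, ?_⟩
  intro B' _ _ _ _ _ _ _
  constructor
  · let : Algebra P B' := (MvPolynomial.aeval fun i ↦ algebraMap B B' (z i)).toAlgebra
    have : IsScalarTower P B B' := IsScalarTower.of_algebraMap_eq (hcomp B')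
    exact H₂ _ ((dvd_mul_left f₂ f₁).trans hdvd') B'
  let A' := Localization.Away (a₁ * a₂)
  let : Algebra A B' := ((algebraMap B B').comp (algebraMap A B)).toAlgebra
  have : IsScalarTower A B B' := IsScalarTower.of_algebraMap_eq fun _ ↦ rfl
  let φ : A' →+* B' := IsLocalization.Away.lift (g := algebraMap A B') (a₁ * a₂)
    (IsLocalization.Away.algebraMap_isUnit (S := B') (algebraMap A B (a₁ * a₂)))
  let : Algebra A' B' := φ.toAlgebra
  have : IsScalarTower A A' B' := IsScalarTower.of_algebraMap_eq fun x ↦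
    (IsLocalization.Away.lift_eq _ _ x).symm
  have hc0 : algebraMap A B (a₁ * a₂) ≠ 0 := (map_ne_zero_iff _ hAB).mpr ha
  have : IsDomain B' := IsLocalization.Away.isDomain B' hc0
  have : IsDomain A' := IsLocalization.Away.isDomain A' ha
  let φF : A' →+* F := IsLocalization.Away.lift (g := algebraMap A F) (a₁ * a₂)
    (isUnit_iff_ne_zero.mpr ((map_ne_zero_iff _ (IsFractionRing.injective A F)).mpr ha))
  let : Algebra A' F := φF.toAlgebra
  have : IsScalarTower A A' F := IsScalarTower.of_algebraMap_eq fun x ↦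
    (IsLocalization.Away.lift_eq _ _ x).symm
  have hpow : ∀ {R : Type u} [CommRing R] [IsDomain R] {r : R}, r ≠ 0 → Submonoid.powers r ≤ R⁰ :=
    fun h ↦ Submonoid.powers_le.mpr (mem_nonZeroDivisors_of_ne_zero h)
  have : IsFractionRing A' F :=
    IsFractionRing.isFractionRing_of_isDomain_of_isLocalization (Submonoid.powers (a₁ * a₂)) A' F
  have : IsFractionRing B' L := IsFractionRing.isFractionRing_of_isDomain_of_isLocalization
    (Submonoid.powers (algebraMap A B (a₁ * a₂))) B' L
  let : Algebra A' L := ((algebraMap F L).comp (algebraMap A' F)).toAlgebra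
  have : IsScalarTower A' F L := IsScalarTower.of_algebraMap_eq fun _ ↦ rfl
  have : IsScalarTower A' B' L := IsScalarTower.of_algebraMap_eq' <| by
    refine IsLocalization.ringHom_ext (Submonoid.powers (a₁ * a₂)) ?_
    ext x
    change algebraMap F L (algebraMap A' F (algebraMap A A' x)) =
      algebraMap B' L (algebraMap A' B' (algebraMap A A' x))
    rw [← IsScalarTower.algebraMap_apply A A' F, ← IsScalarTower.algebraMap_apply A F L,
      ← IsScalarTower.algebraMap_apply A A' B', IsScalarTower.algebraMap_apply A B B',
      ← IsScalarTower.algebraMap_apply B B' L, ← IsScalarTower.algebraMap_apply A B L]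
  have : Module.Finite A' B' := H₃ _ (dvd_mul_right a₁ a₂) A' B'
  have : Algebra.FormallyEtale A B' := H₁ _ ((dvd_mul_right f₁ f₂).trans hdvd') B'
  have : Algebra.FinitePresentation B B' :=
    IsLocalization.Away.finitePresentation (algebraMap A B (a₁ * a₂))
  have : Algebra.FinitePresentation A B' := Algebra.FinitePresentation.trans A B B'
  have : Algebra.Etale A B' := ⟨inferInstance, inferInstance⟩
  have : Algebra.Etale A A' := Algebra.Etale.of_isLocalizationAway (a₁ * a₂)
  have : Algebra.Etale A' B' := Algebra.Etale.of_restrictScalars A A' B'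
  have hAL' : Function.Injective (algebraMap A' L) :=
    (algebraMap F L).injective.comp (IsFractionRing.injective A' F)
  have : FaithfulSMul A' B' := by
    rw [faithfulSMul_iff_algebraMap_injective]
    rw [IsScalarTower.algebraMap_eq A' B' L] at hAL'
    exact Function.Injective.of_comp hAL'
  have : Algebra.FinitePresentation A A' := inferInstance
  have : Algebra.FiniteType k A' := Algebra.FiniteType.trans (S := A) ‹_› inferInstance
  obtain ⟨χ, hχ⟩ := exists_ringHom_surjective (k := k) (A := A')
  exact exists_fiber (k := k) (A := A') (B := B') (F := F) (L := L) χ.toRingHom hχ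

/-- A finitely generated field extension is the fraction field of a finitely generated algebra. -/
theorem exists_subalgebra_isFractionRing (k F : Type*) [Field k] [Field F] [Algebra k F]
    [Algebra.EssFiniteType k F] :
    ∃ s : Finset F, IsFractionRing (Algebra.adjoin k (s : Set F)) F := by
  obtain ⟨s, hs⟩ := IntermediateField.fg_top k F
  refine ⟨s, .of_field _ _ fun x ↦ ?_⟩
  have hx : x ∈ IntermediateField.adjoin k (s : Set F) := hs ▸ IntermediateField.mem_top
  obtain ⟨a, ha, b, hb, h⟩ := IntermediateField.mem_adjoin_iff_div.mp hx
  exact ⟨⟨a, ha⟩, ⟨b, hb⟩, h⟩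

theorem exists_common_denominator {B L : Type*} [CommRing B] [IsDomain B] [Field L]
    [Algebra B L] [IsFractionRing B L] (s : Finset L) :
    ∃ c : B, c ≠ 0 ∧ ∀ (B' : Type*) [CommRing B'] [Algebra B B'] [IsLocalization.Away c B']
      [Algebra B' L] [IsScalarTower B B' L], ∀ x ∈ s, x ∈ Set.range (algebraMap B' L) := by
  obtain ⟨c, hc⟩ := IsLocalization.exist_integer_multiples_of_finset B⁰ s
  refine ⟨c, nonZeroDivisors.ne_zero c.2, fun B' _ _ _ _ _ x hx ↦ ?_⟩
  obtain ⟨b, hb⟩ := hc x hx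
  obtain ⟨u, hu⟩ := IsLocalization.Away.algebraMap_isUnit (S := B') (c : B)
  refine ⟨↑u⁻¹ * algebraMap B B' b, ?_⟩
  have hu0 : algebraMap B' L u ≠ 0 := (u.isUnit.map (algebraMap B' L)).ne_zero
  refine mul_left_cancel₀ hu0 ?_
  rw [← map_mul, Units.mul_inv_cancel_left, ← IsScalarTower.algebraMap_apply, hb, hu,
    ← IsScalarTower.algebraMap_apply, Algebra.smul_def]

/-- Two-step localization of a finitely generated algebra `B` over which a finite separable
extension `L / F` of its fraction field `L` has good fibers. -/
theorem exists_fiber_of_essFiniteType {k B F L : Type u} [Field k] [IsAlgClosed k]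
    [CommRing B] [IsDomain B] [Algebra k B] [Algebra.FiniteType k B]
    [Field F] [Algebra k F] [Algebra.EssFiniteType k F] [Field L] [Algebra B L]
    [IsFractionRing B L] [Algebra F L] [Algebra k L] [IsScalarTower k B L] [IsScalarTower k F L]
    [FiniteDimensional F L] [Algebra.IsSeparable F L] {N : ℕ} (z : Fin N → L)
    (hz : IsEtaleCoord k z) :
    ∃ c : B, c ≠ 0 ∧ ∀ (B₁ : Type u) [CommRing B₁] [Algebra B B₁] [IsLocalization.Away c B₁]
      [Algebra B₁ L] [IsScalarTower B B₁ L] [Algebra k B₁] [IsScalarTower k B B₁],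
      ∃ (z₁ : Fin N → B₁), (∀ i, algebraMap B₁ L (z₁ i) = z i) ∧ ∃ c₁ : B₁, c₁ ≠ 0 ∧
      ∀ (B' : Type u) [CommRing B'] [Algebra B₁ B'] [IsLocalization.Away c₁ B']
      [Algebra B' L] [IsScalarTower B₁ B' L] [Algebra k B'] [IsScalarTower k B₁ B'],
      (IsEtaleCoord k fun i ↦ algebraMap B₁ B' (z₁ i)) ∧
      ∃ q : Fin (Module.finrank F L) → Ideal B', Function.Injective q ∧ (∀ i, (q i).IsMaximal) ∧
        ∀ g : B', Algebra.trace F L (algebraMap B' L g) = 0 →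
          ∀ i, (∀ j, j ≠ i → g ∈ q j) → g ∈ q i := by
  classical
  obtain ⟨s, hs⟩ := exists_subalgebra_isFractionRing k F
  -- The first localization makes room in B₁ for a finitely generated model A of F and for the
  -- coordinates z. The second one makes the extension of A finite étale.
  obtain ⟨c, hc0, hc⟩ := exists_common_denominator (B := B) (L := L)
    (s.image (algebraMap F L) ∪ Finset.univ.image z)
  refine ⟨c, hc0, ?_⟩
  intro B₁ _ _ _ _ _ _ _
  have hc := hc B₁
  have h1 : ∀ i, ∃ b : B₁, algebraMap B₁ L b = z i := fun i ↦ hc _ (by simp)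
  choose z₁ hz₁ using h1
  refine ⟨z₁, hz₁, ?_⟩
  have : IsDomain B₁ := IsLocalization.Away.isDomain B₁ hc0
  have : IsFractionRing B₁ L := IsFractionRing.isFractionRing_of_isDomain_of_isLocalization
    (Submonoid.powers c) B₁ L
  have : IsScalarTower k B₁ L := IsScalarTower.of_algebraMap_eq fun a ↦ by
    rw [IsScalarTower.algebraMap_apply k B B₁, ← IsScalarTower.algebraMap_apply B B₁ L,
      ← IsScalarTower.algebraMap_apply k B L]
  have : Algebra.FinitePresentation B B₁ := IsLocalization.Away.finitePresentation c
  have : Algebra.FiniteType k B₁ := Algebra.FiniteType.trans (S := B) ‹_› inferInstance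
  let A := Algebra.adjoin k (s : Set F)
  have : Algebra.FiniteType k A := (Subalgebra.fg_iff_finiteType _).mp (Subalgebra.fg_adjoin_finset s)
  let j : B₁ →ₐ[k] L := IsScalarTower.toAlgHom k B₁ L
  have hj : Function.Injective j := IsFractionRing.injective B₁ L
  have hA : ∀ a : A, algebraMap F L a ∈ j.range := by
    have h2 : A ≤ j.range.comap (IsScalarTower.toAlgHom k F L) := Algebra.adjoin_le fun x hx ↦ by
      obtain ⟨b, hb⟩ := hc (algebraMap F L x)
        (Finset.mem_union_left _ (Finset.mem_image_of_mem _ hx))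
      exact ⟨b, hb⟩
    exact fun a ↦ h2 a.2
  let e := AlgEquiv.ofInjective j hj
  let φ : A →ₐ[k] B₁ := e.symm.toAlgHom.comp
    (((IsScalarTower.toAlgHom k F L).comp A.val).codRestrict j.range hA)
  let : Algebra A B₁ := φ.toAlgebra
  have : IsScalarTower k A B₁ := IsScalarTower.of_algebraMap_eq fun a ↦ (φ.commutes a).symm
  have : IsScalarTower A F L := inferInstance
  have : IsScalarTower A B₁ L := IsScalarTower.of_algebraMap_eq fun a ↦ by
    have h3 : e (φ a) = ⟨algebraMap F L a, hA a⟩ := e.apply_symm_apply _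
    exact (congrArg Subtype.val h3).symm
  obtain ⟨c₁, hc₁, H⟩ := exists_localization_fiber (k := k) (A := A) (B := B₁) (F := F) (L := L) z₁
    (by simpa only [hz₁] using hz)
  exact ⟨c₁, hc₁, H⟩

end

end SepNonruled

/-! ### Global forms and the valuative criterion -/

namespace SepNonruled

noncomputable section

open CategoryTheory AlgebraicGeometry

section

variable (k : Type u) [Field k] (X : Scheme.{u}) [X.Over (Spec (.of k))]

theorem germ_comp_algebraMap (U : X.Opens) (x : X) (hx : x ∈ U) :
    (X.presheaf.germ U x hx).hom.comp (algebraMap k Γ(X, U)) =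
      algebraMap k (X.presheaf.stalk x) :=
  congrArg CommRingCat.Hom.hom (congrArg
    (fun g ↦ (Scheme.ΓSpecIso (.of k)).inv ≫ (X ↘ Spec (.of k)).appTop ≫ g)
    (X.presheaf.germ_res (homOfLE (le_top : U ≤ ⊤)) x hx))

theorem map_comp_algebraMap {U V : X.Opens} (i : V ⟶ U) :
    (X.presheaf.map i.op).hom.comp (algebraMap k Γ(X, U)) = algebraMap k Γ(X, V) := by
  have h := congrArg CommRingCat.Hom.hom (congrArg
      (fun g ↦ (Scheme.ΓSpecIso (.of k)).inv ≫ (X ↘ Spec (.of k)).appTop ≫ g)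
      (X.presheaf.map_comp (homOfLE (le_top : U ≤ ⊤)).op i.op))
  exact h.symm

theorem stalkSpecializes_comp_algebraMap {x y : X} (h : y ⤳ x) :
    (X.presheaf.stalkSpecializes h).hom.comp (algebraMap k (X.presheaf.stalk x)) =
      algebraMap k (X.presheaf.stalk y) :=
  congrArg CommRingCat.Hom.hom (congrArg
    (fun g ↦ (Scheme.ΓSpecIso (.of k)).inv ≫ (X ↘ Spec (.of k)).appTop ≫ g)
    (X.presheaf.germ_stalkSpecializes (U := ⊤) trivial h))

instance isScalarTower_stalk_functionField [IsIntegral X] (x : X) :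
    IsScalarTower k (X.presheaf.stalk x) X.functionField :=
  IsScalarTower.of_algebraMap_eq' (stalkSpecializes_comp_algebraMap k X _).symm

instance isScalarTower_section_functionField [IsIntegral X] (U : X.Opens) [Nonempty U] :
    IsScalarTower k Γ(X, U) X.functionField :=
  IsScalarTower.of_algebraMap_eq' (germ_comp_algebraMap k X U _ _).symm

theorem over_eq_toSpecΓ_comp :
    X ↘ Spec (.of k) = X.toSpecΓ ≫ Spec.map ((Scheme.ΓSpecIso (.of k)).inv ≫
      (X ↘ Spec (.of k)).appTop) := by
  rw [Spec.map_comp, ← Scheme.toSpecΓ_naturality_assoc, toSpecΓ_SpecMap_ΓSpecIso_inv,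
    Category.comp_id]

theorem fromSpecStalk_over (x : X) :
    X.fromSpecStalk x ≫ (X ↘ Spec (.of k)) =
      Spec.map (CommRingCat.ofHom (algebraMap k (X.presheaf.stalk x))) := by
  rw [over_eq_toSpecΓ_comp, Scheme.fromSpecStalk_toSpecΓ_assoc, ← Spec.map_comp, Category.assoc]
  rfl

end

section

variable {k : Type u} [Field k] {X : Scheme.{u}} [X.Over (Spec (.of k))]

theorem formsMap_globalForms [IsIntegral X] {N : ℕ}
    {s : ∀ x : X, ⋀[X.presheaf.stalk x]^N (Ω[X.presheaf.stalk x⁄k])}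
    (hs : s ∈ globalForms k X N) (x : X) :
    formsMap k (X.presheaf.stalk x) X.functionField N (s x) = s (genericPoint X) := by
  obtain ⟨U, hxU, t, ht⟩ := hs x
  have hη : genericPoint X ∈ U :=
    ((genericPoint_spec X).mem_open_set_iff U.isOpen).mpr ⟨x, trivial, hxU⟩
  rw [ht x hxU, ht _ hη]
  have : Nonempty U := ⟨⟨x, hxU⟩⟩
  let : Algebra Γ(X, U) (X.presheaf.stalk x) := (X.presheaf.germ U x hxU).hom.toAlgebra
  have : IsScalarTower k Γ(X, U) (X.presheaf.stalk x) :=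
    IsScalarTower.of_algebraMap_eq' (germ_comp_algebraMap k X U x hxU).symm
  have : IsScalarTower Γ(X, U) (X.presheaf.stalk x) X.functionField :=
    functionField_isScalarTower X U ⟨x, hxU⟩
  exact formsMap_formsMap k Γ(X, U) (X.presheaf.stalk x) X.functionField N t

/-- A global differential form on a proper variety is regular at all valuation rings of the
function field. -/
theorem isRegularForm_globalForms [IsIntegral X] [UniversallyClosed (X ↘ Spec (.of k))] {N : ℕ}
    {s : ∀ x : X, ⋀[X.presheaf.stalk x]^N (Ω[X.presheaf.stalk x⁄k])}
    (hs : s ∈ globalForms k X N) :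
    IsRegularForm k X.functionField (s (genericPoint X)) := by
  intro V hV
  have hVE : ValuativeCriterion.Existence (X ↘ Spec (.of k)) := by
    have h : UniversallyClosed (X ↘ Spec (.of k)) := inferInstance
    rw [UniversallyClosed.eq_valuativeCriterion] at h
    exact h.1
  have : IsFractionRing V X.functionField := .of_field _ _ fun x ↦ by
    rcases hV x with h | h
    · exact ⟨⟨x, h⟩, 1, by simp⟩
    · exact ⟨1, ⟨x⁻¹, h⟩, by simp⟩
  have : ValuationRing V := (ValuationRing.iff_isInteger_or_isInteger V X.functionField).mpr
    fun x ↦ (hV x).imp (fun h ↦ ⟨⟨x, h⟩, rfl⟩) (fun h ↦ ⟨⟨x⁻¹, h⟩, rfl⟩)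
  let S : ValuativeCommSq (X ↘ Spec (.of k)) :=
    { R := V
      K := X.functionField
      i₁ := X.fromSpecStalk (genericPoint X)
      i₂ := Spec.map (CommRingCat.ofHom (algebraMap k V))
      commSq := ⟨by
        rw [fromSpecStalk_over, ← Spec.map_comp, ← CommRingCat.ofHom_comp,
          ← IsScalarTower.algebraMap_eq]⟩ }
  obtain ⟨⟨l, hl₁, hl₂⟩⟩ := (hVE S).exists_lift
  change Spec (.of V) ⟶ X at l
  change Spec.map (CommRingCat.ofHom (algebraMap V X.functionField)) ≫ l =
    X.fromSpecStalk (genericPoint X) at hl₁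
  change l ≫ (X ↘ Spec (.of k)) = Spec.map (CommRingCat.ofHom (algebraMap k V)) at hl₂
  have : IsLocalRing (CommRingCat.of V) := ValuationRing.isLocalRing V
  -- The center of the valuation on X. Its local ring maps to V inside the function field, so the
  -- germ of the section at x provides the required form over V.
  let x : X := l (IsLocalRing.closedPoint (CommRingCat.of V))
  let φ : X.presheaf.stalk x ⟶ CommRingCat.of V := Scheme.stalkClosedPointTo l
  have hφ : Spec.map φ ≫ X.fromSpecStalk x = l := Scheme.Spec_stalkClosedPointTo_fromSpecStalk l
  have h1 : φ ≫ CommRingCat.ofHom (algebraMap V X.functionField) =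
      CommRingCat.ofHom (algebraMap (X.presheaf.stalk x) X.functionField) := by
    apply Spec.map_injective
    rw [← cancel_mono (X.fromSpecStalk x), Spec.map_comp, Category.assoc, hφ, hl₁]
    exact (Scheme.SpecMap_stalkSpecializes_fromSpecStalk
      ((genericPoint_spec X).specializes trivial)).symm
  have h2 : CommRingCat.ofHom (algebraMap k (X.presheaf.stalk x)) ≫ φ =
      CommRingCat.ofHom (algebraMap k V) := by
    apply Spec.map_injective
    rw [Spec.map_comp, ← fromSpecStalk_over, ← Category.assoc, hφ, hl₂]
  let : Algebra (X.presheaf.stalk x) V := φ.hom.toAlgebra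
  have : IsScalarTower k (X.presheaf.stalk x) V :=
    IsScalarTower.of_algebraMap_eq' (congrArg CommRingCat.Hom.hom h2).symm
  have : IsScalarTower (X.presheaf.stalk x) V X.functionField :=
    IsScalarTower.of_algebraMap_eq' (congrArg CommRingCat.Hom.hom h1).symm
  refine ⟨formsMap k (X.presheaf.stalk x) V N (s x), ?_⟩
  rw [formsMap_formsMap]
  exact formsMap_globalForms hs x

end

end

end SepNonruled

/-! ### Forms as functions in étale coordinates -/

namespace SepNonruled

noncomputable section

open CategoryTheory AlgebraicGeometry

theorem mem_range_algebraMap_of_forall_isMaximal {B L : Type*} [CommRing B] [Field L] [Algebra B L]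
    (g : L) (h : ∀ q : Ideal B, q.IsMaximal → ∃ s ∉ q, ∃ a, algebraMap B L s * g = algebraMap B L a) :
    g ∈ Set.range (algebraMap B L) := by
  let I : Ideal B := (LinearMap.range (Algebra.linearMap B L)).comap (LinearMap.toSpanSingleton B L g)
  have hI : ∀ s : B, s ∈ I ↔ ∃ a, algebraMap B L a = algebraMap B L s * g := fun s ↦ by
    simp [I, Algebra.smul_def]
  by_cases hT : I = ⊤
  · obtain ⟨a, ha⟩ := (hI 1).mp (hT ▸ Submodule.mem_top)
    exact ⟨a, by simpa using ha⟩
  · obtain ⟨q, hq, hIq⟩ := Ideal.exists_le_maximal I hT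
    obtain ⟨s, hs, a, ha⟩ := h q hq
    exact absurd (hIq ((hI s).mpr ⟨a, ha.symm⟩)) hs

theorem mem_smul_top_iff_formsCoord_mem {k E : Type*} [CommRing k] [CommRing E] [Algebra k E]
    {N : ℕ} (b : Module.Basis (Fin N) E (Ω[E⁄k])) (m : Ideal E) (t : ⋀[E]^N (Ω[E⁄k])) :
    t ∈ m • (⊤ : Submodule E (⋀[E]^N (Ω[E⁄k]))) ↔ formsCoord b t ∈ m := by
  constructor
  · intro h
    refine Submodule.smul_induction_on h (fun r hr n _ ↦ ?_) fun x y hx hy ↦ ?_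
    · rw [map_smul, smul_eq_mul]
      exact m.mul_mem_right _ hr
    · rw [map_add]
      exact add_mem hx hy
  · intro h
    rw [← formsCoord_smul_ιMulti b t]
    exact Submodule.smul_mem_smul h trivial

theorem IsEtaleCoord.comp_of_formallyEtale {k A B ι : Type*} [CommRing k] [CommRing A] [CommRing B]
    [Algebra k A] [Algebra k B] [Algebra A B] [IsScalarTower k A B] [Algebra.FormallyEtale A B]
    {z : ι → A} (hz : IsEtaleCoord k z) : IsEtaleCoord k fun i ↦ algebraMap A B (z i) := by
  have h : (algebraMap A B).FormallyEtale := RingHom.formallyEtale_algebraMap.mpr inferInstance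
  have e : (MvPolynomial.aeval fun i ↦ algebraMap A B (z i) :
      MvPolynomial ι k →ₐ[k] B).toRingHom =
      (algebraMap A B).comp (MvPolynomial.aeval z : MvPolynomial ι k →ₐ[k] A).toRingHom :=
    RingHom.ext fun p ↦ MvPolynomial.aeval_algebraMap_apply B z p
  rw [IsEtaleCoord, e]
  exact RingHom.FormallyEtale.comp hz h

section

variable {k : Type u} [Field k] {X : Scheme.{u}} [X.Over (Spec (.of k))]

theorem primeIdealOf_fromSpec {U : X.Opens} (hU : IsAffineOpen U) (y : PrimeSpectrum Γ(X, U))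
    (hy : hU.fromSpec y ∈ U) : hU.primeIdealOf ⟨hU.fromSpec y, hy⟩ = y :=
  hU.fromSpec.isOpenEmbedding.injective (hU.fromSpec_primeIdealOf _)

/-- X is a Jacobson space, so a point closed in the open subset U is closed in X. -/
theorem exists_isClosed_primeIdealOf_eq [LocallyOfFiniteType (X ↘ Spec (.of k))] {U : X.Opens}
    (hU : IsAffineOpen U) (q : Ideal Γ(X, U)) (hq : q.IsMaximal) :
    ∃ (x : X) (hx : x ∈ U), IsClosed {x} ∧ (hU.primeIdealOf ⟨x, hx⟩).asIdeal = q := by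
  let y : PrimeSpectrum Γ(X, U) := ⟨q, hq.isPrime⟩
  have hy : hU.fromSpec y ∈ U := by
    have h : hU.fromSpec y ∈ Set.range hU.fromSpec := ⟨y, rfl⟩
    rwa [hU.range_fromSpec] at h
  refine ⟨hU.fromSpec y, hy, ?_, by rw [primeIdealOf_fromSpec]⟩
  have : JacobsonSpace X := LocallyOfFiniteType.jacobsonSpace (X ↘ Spec (.of k))
  have h := hU.fromSpec.isOpenEmbedding.preimage_closedPoints
  have h1 : y ∈ closedPoints (Spec Γ(X, U)) :=
    (PrimeSpectrum.isClosed_singleton_iff_isMaximal y).mpr hq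
  rw [← h] at h1
  exact h1

/-- Étale coordinates trivialize the top forms at every point of U. The local coordinates of s all
agree in the function field, so they come from one function g, and s vanishes in a fiber exactly
when g vanishes at the point. -/
theorem exists_section_eq_formsCoord [IsIntegral X] {U : X.Opens} (hU : IsAffineOpen U)
    [Nonempty U] [LocallyOfFiniteType (X ↘ Spec (.of k))] {N : ℕ} (z : Fin N → Γ(X, U))
    (hz : IsEtaleCoord k z)
    (b : Module.Basis (Fin N) X.functionField (Ω[X.functionField⁄k]))
    (hb : ∀ i, b i = KaehlerDifferential.D k X.functionField (algebraMap Γ(X, U) _ (z i)))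
    {s : ∀ x : X, ⋀[X.presheaf.stalk x]^N (Ω[X.presheaf.stalk x⁄k])}
    (hs : s ∈ globalForms k X N) :
    ∃ g : Γ(X, U), algebraMap Γ(X, U) X.functionField g = formsCoord b (s (genericPoint X)) ∧
      ∀ x (hx : x ∈ U), s x ∈ IsLocalRing.maximalIdeal (X.presheaf.stalk x) •
          (⊤ : Submodule (X.presheaf.stalk x) (⋀[X.presheaf.stalk x]^N (Ω[X.presheaf.stalk x⁄k]))) ↔
        g ∈ (hU.primeIdealOf ⟨x, hx⟩).asIdeal := by
  have key : ∀ x (hx : x ∈ U), ∃ h : X.presheaf.stalk x,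
      algebraMap (X.presheaf.stalk x) X.functionField h = formsCoord b (s (genericPoint X)) ∧
      (s x ∈ IsLocalRing.maximalIdeal (X.presheaf.stalk x) •
          (⊤ : Submodule (X.presheaf.stalk x) (⋀[X.presheaf.stalk x]^N (Ω[X.presheaf.stalk x⁄k]))) ↔
        h ∈ IsLocalRing.maximalIdeal (X.presheaf.stalk x)) := by
    intro x hx
    let : Algebra Γ(X, U) (X.presheaf.stalk x) := (X.presheaf.germ U x hx).hom.toAlgebra
    have : IsScalarTower k Γ(X, U) (X.presheaf.stalk x) :=
      IsScalarTower.of_algebraMap_eq' (germ_comp_algebraMap k X U x hx).symm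
    have : IsScalarTower Γ(X, U) (X.presheaf.stalk x) X.functionField :=
      functionField_isScalarTower X U ⟨x, hx⟩
    have hl : IsLocalization.AtPrime (X.presheaf.stalk x) (hU.primeIdealOf ⟨x, hx⟩).asIdeal :=
      hU.isLocalization_stalk ⟨x, hx⟩
    have : Algebra.FormallyEtale Γ(X, U) (X.presheaf.stalk x) :=
      Algebra.FormallyEtale.of_isLocalization (hU.primeIdealOf ⟨x, hx⟩).asIdeal.primeCompl
    obtain ⟨bx, hbx⟩ := (hz.comp_of_formallyEtale (B := X.presheaf.stalk x)).exists_basis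
    refine ⟨formsCoord bx (s x), ?_, mem_smul_top_iff_formsCoord_mem bx _ _⟩
    rw [← formsCoord_formsMap bx b, formsMap_globalForms hs]
    intro i
    rw [hbx, hb, KaehlerDifferential.map_D,
      ← IsScalarTower.algebraMap_apply Γ(X, U) (X.presheaf.stalk x)]
  choose h hh hmem using key
  obtain ⟨g, hg⟩ : formsCoord b (s (genericPoint X)) ∈
      Set.range (algebraMap Γ(X, U) X.functionField) := by
    refine mem_range_algebraMap_of_forall_isMaximal _ fun q hq ↦ ?_
    obtain ⟨x, hx, -, rfl⟩ := exists_isClosed_primeIdealOf_eq (k := k) hU q hq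
    let : Algebra Γ(X, U) (X.presheaf.stalk x) := (X.presheaf.germ U x hx).hom.toAlgebra
    have : IsScalarTower Γ(X, U) (X.presheaf.stalk x) X.functionField :=
      functionField_isScalarTower X U ⟨x, hx⟩
    have hl : IsLocalization.AtPrime (X.presheaf.stalk x) (hU.primeIdealOf ⟨x, hx⟩).asIdeal :=
      hU.isLocalization_stalk ⟨x, hx⟩
    obtain ⟨⟨a, t⟩, ht⟩ := IsLocalization.surj (hU.primeIdealOf ⟨x, hx⟩).asIdeal.primeCompl (h x hx)
    refine ⟨t, t.2, a, ?_⟩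
    rw [← hh x hx, IsScalarTower.algebraMap_apply Γ(X, U) (X.presheaf.stalk x) X.functionField t,
      IsScalarTower.algebraMap_apply Γ(X, U) (X.presheaf.stalk x) X.functionField a, ← ht, map_mul,
      mul_comm]
  refine ⟨g, hg, fun x hx ↦ ?_⟩
  let : Algebra Γ(X, U) (X.presheaf.stalk x) := (X.presheaf.germ U x hx).hom.toAlgebra
  have : IsScalarTower Γ(X, U) (X.presheaf.stalk x) X.functionField :=
    functionField_isScalarTower X U ⟨x, hx⟩
  have hl : IsLocalization.AtPrime (X.presheaf.stalk x) (hU.primeIdealOf ⟨x, hx⟩).asIdeal :=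
    hU.isLocalization_stalk ⟨x, hx⟩
  have e : h x hx = algebraMap Γ(X, U) (X.presheaf.stalk x) g :=
    IsFractionRing.injective (X.presheaf.stalk x) X.functionField (by
      rw [hh, ← IsScalarTower.algebraMap_apply, hg])
  rw [hmem x hx, e]
  exact IsLocalization.AtPrime.to_map_mem_maximal_iff _ (hU.primeIdealOf ⟨x, hx⟩).asIdeal _

end

end

end SepNonruled

/-! ### Dimension bounds and the choice of points -/

namespace SepNonruled

noncomputable section

open CategoryTheory AlgebraicGeometry

theorem ringKrullDim_le_of_isIntegral_of_injective {R S : Type*} [CommRing R] [CommRing S]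
    [Algebra R S] [Algebra.IsIntegral R S] [FaithfulSMul R S] :
    ringKrullDim R ≤ ringKrullDim S := by
  refine iSup_le fun l ↦ ?_
  obtain ⟨Q, -, hQ, hQl⟩ := Ideal.exists_ideal_over_prime_of_isIntegral l.head.asIdeal (⊥ : Ideal S)
    (by
      rw [← RingHom.ker_eq_comap_bot,
        (RingHom.injective_iff_ker_eq_bot _).mp (FaithfulSMul.algebraMap_injective R S)]
      exact bot_le)
  have : Q.LiesOver (RelSeries.head l).asIdeal := ⟨hQl.symm⟩
  obtain ⟨L, hL, -⟩ := Ideal.exists_ltSeries_of_hasGoingUp l Q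
  rw [← hL]
  exact Order.LTSeries.length_le_krullDim L

/-- By Noether normalization B is integral over a polynomial ring whose number of variables is the
transcendence degree. Chains of primes lift along this extension. -/
theorem natCast_le_ringKrullDim_of_algebraicIndependent {k B : Type u} [Field k] [CommRing B]
    [IsDomain B] [Algebra k B] [Algebra.FiniteType k B] {r : ℕ} (z : Fin r → B)
    (hz : AlgebraicIndependent k z) : (r : WithBot ℕ∞) ≤ ringKrullDim B := by
  obtain ⟨s, g, hg, hi⟩ := exists_integral_inj_algHom_of_fg k B
  let : Algebra (MvPolynomial (Fin s) k) B := g.toAlgebra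
  have : IsScalarTower k (MvPolynomial (Fin s) k) B :=
    IsScalarTower.of_algebraMap_eq fun a ↦ (g.commutes a).symm
  have : FaithfulSMul (MvPolynomial (Fin s) k) B :=
    (faithfulSMul_iff_algebraMap_injective _ _).mpr hg
  have : Algebra.IsIntegral (MvPolynomial (Fin s) k) B := ⟨hi⟩
  have h1 := trdeg_add_eq k (MvPolynomial (Fin s) k) (A := B)
  rw [trdeg_eq_zero (R := MvPolynomial (Fin s) k), add_zero,
    MvPolynomial.trdeg_of_isDomain, Cardinal.mk_fin, Cardinal.lift_natCast] at h1
  have h2 := hz.lift_cardinalMk_le_trdeg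
  rw [← h1, Cardinal.mk_fin, Cardinal.lift_natCast, Cardinal.lift_natCast, Nat.cast_le] at h2
  have h3 := ringKrullDim_add_natCard_le_ringKrullDim_mvPolynomial (R := k) (Fin s)
  rw [ringKrullDim_eq_zero_of_field, zero_add, Nat.card_fin] at h3
  exact ((Nat.cast_le.mpr h2).trans h3).trans ringKrullDim_le_of_isIntegral_of_injective

theorem exteriorPower_eq_zero_of_lt {E M : Type*} [CommRing E] [AddCommGroup M] [Module E M]
    {r N : ℕ} (b : Module.Basis (Fin r) E M) (h : r < N) (t : ⋀[E]^N M) : t = 0 := by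
  have h0 : (LinearMap.id : ⋀[E]^N M →ₗ[E] ⋀[E]^N M) = 0 := by
    apply exteriorPower.linearMap_ext
    refine b.ext_alternating fun v hv ↦ ?_
    have := Fintype.card_le_of_injective v hv
    simp only [Fintype.card_fin] at this
    omega
  exact LinearMap.congr_fun h0 t

/-- A finite injective family in an infinite set can be extended to a larger finite injective
family, with a given member of the family at a given place. -/
theorem exists_injective_extension {α : Type*} {S : Set α} (hS : S.Infinite) {d n : ℕ}
    (q : Fin d → α) (hq : Function.Injective q) (hqS : ∀ i, q i ∈ S) (h : d ≤ n) (i : Fin d)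
    (j : Fin n) :
    ∃ p : Fin n → α, Function.Injective p ∧ (∀ i, p i ∈ S) ∧ p j = q i ∧
      ∀ i, ∃ j, p j = q i := by
  obtain ⟨T, hqT, hTS, hT⟩ := hS.exists_superset_ncard_eq (s := Set.range q) (k := n)
    (by rintro _ ⟨i, rfl⟩; exact hqS i) (Set.finite_range q) (by
      rw [Set.ncard_range_of_injective hq, Nat.card_fin]; exact h)
  have hfin : Finite T := Set.finite_of_ncard_pos (by have := j.2; omega)
  let e : Fin n ≃ T := (Finite.equivFinOfCardEq hT).symm
  let i' : T := ⟨q i, hqT ⟨i, rfl⟩⟩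
  -- The transposition moves the chosen member to place j.
  let e' : Fin n ≃ T := (Equiv.swap j (e.symm i')).trans e
  have he' : e' j = i' := by simp [e']
  refine ⟨fun a ↦ e' a, Subtype.val_injective.comp e'.injective, fun a ↦ hTS (e' a).2,
    congrArg Subtype.val he', fun a ↦ ⟨e'.symm ⟨q a, hqT ⟨a, rfl⟩⟩, by simp⟩⟩

section

variable {k : Type u} [Field k] {X : Scheme.{u}} [X.Over (Spec (.of k))]

theorem finiteType_section [LocallyOfFiniteType (X ↘ Spec (.of k))] {U : X.Opens}
    (hU : IsAffineOpen U) : Algebra.FiniteType k Γ(X, U) := by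
  have h := (X ↘ Spec (.of k)).finiteType_appLE (isAffineOpen_top (Spec (.of k))) hU le_top
  have h2 : (CommRingCat.ofHom (algebraMap k Γ(X, U))) =
      (Scheme.ΓSpecIso (.of k)).inv ≫ (X ↘ Spec (.of k)).appLE ⊤ U le_top := rfl
  have h3 : (algebraMap k Γ(X, U)).FiniteType := by
    have h4 := congrArg CommRingCat.Hom.hom h2
    rw [CommRingCat.hom_comp] at h4
    change algebraMap k Γ(X, U) = _ at h4
    rw [h4]
    refine h.comp (RingHom.FiniteType.of_surjective _ ?_)
    exact (ConcreteCategory.bijective_of_isIso (Scheme.ΓSpecIso (.of k)).inv).surjective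
  exact RingHom.finiteType_algebraMap.mp h3

instance isScalarTower_section_basicOpen {U : X.Opens} (f : Γ(X, U)) :
    IsScalarTower k Γ(X, U) Γ(X, X.basicOpen f) :=
  IsScalarTower.of_algebraMap_eq' (map_comp_algebraMap k X (homOfLE (X.basicOpen_le f))).symm

theorem isScalarTower_basicOpen_functionField [IsIntegral X] {U : X.Opens} [Nonempty U]
    (f : Γ(X, U)) [Nonempty (X.basicOpen f)] :
    IsScalarTower Γ(X, U) Γ(X, X.basicOpen f) X.functionField :=
  IsScalarTower.of_algebraMap_eq' (congrArg CommRingCat.Hom.hom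
    (X.presheaf.germ_res (homOfLE (X.basicOpen_le f)) (genericPoint X) _)).symm

theorem nonempty_basicOpen [IsIntegral X] {U : X.Opens} (f : Γ(X, U)) (hf : f ≠ 0) :
    Nonempty (X.basicOpen f) := by
  by_contra h
  refine hf ((basicOpen_eq_bot_iff f).mp ?_)
  exact (TopologicalSpace.Opens.not_nonempty_iff_eq_bot _).mp fun ⟨x, hx⟩ ↦ h ⟨⟨x, hx⟩⟩

theorem ringKrullDim_le_topologicalKrullDim {U : X.Opens} (hU : IsAffineOpen U) :
    ringKrullDim Γ(X, U) ≤ topologicalKrullDim X := by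
  rw [← PrimeSpectrum.topologicalKrullDim_eq_ringKrullDim]
  exact hU.fromSpec.isOpenEmbedding.isInducing.topologicalKrullDim_le

end

end

end SepNonruled

/-! ### Separation of points bounds the degree -/

namespace SepNonruled

noncomputable section

open CategoryTheory AlgebraicGeometry

/-- If global differential forms of top degree on a proper variety `X` separate `n` general points,
then a rational function field over which `k(X)` is finite separable has codegree greater
than `n`. -/
theorem lt_finrank_of_separatesGeneralPoints {k : Type u} [Field k] [IsAlgClosed k]
    {X : Scheme.{u}} [X.Over (Spec (.of k))] [IsIntegral X]
    [LocallyOfFiniteType (X ↘ Spec (.of k))] [UniversallyClosed (X ↘ Spec (.of k))]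
    {N : ℕ} (hN : topologicalKrullDim X = N) {n : ℕ} (hn : 0 < n)
    (h : SeparatesGeneralPoints (globalForms k X N) n)
    {K F : Type u} [Field K] [Algebra k K] [Algebra.EssFiniteType k K] [Field F] [Algebra K F]
    [Algebra k F] [IsScalarTower k K F] (t : F) (ht : Transcendental K t)
    (hgen : IntermediateField.adjoin K {t} = ⊤) [Algebra F X.functionField]
    [IsScalarTower k F X.functionField] [FiniteDimensional F X.functionField]
    [Algebra.IsSeparable F X.functionField] :
    n < Module.finrank F X.functionField := by
  by_contra! hle
  let L := X.functionField
  let : Algebra K L := ((algebraMap F L).comp (algebraMap K F)).toAlgebra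
  have : IsScalarTower K F L := IsScalarTower.of_algebraMap_eq fun _ ↦ rfl
  have : IsScalarTower k K L := IsScalarTower.of_algebraMap_eq fun a ↦ by
    rw [IsScalarTower.algebraMap_apply k F L, IsScalarTower.algebraMap_apply k K F]
    rfl
  have : Algebra.EssFiniteType K F :=
    IntermediateField.fg_top_iff.mp ⟨{t}, by simpa using hgen⟩
  have : Algebra.EssFiniteType k F := Algebra.EssFiniteType.comp k K F
  obtain ⟨N', y, hya, hy⟩ := exists_isEtaleCoord k K
  obtain ⟨hz, hza⟩ := hy.cons (L := L) t ht hgen y hya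
  obtain ⟨bK, hbK⟩ := hy.exists_basis
  obtain ⟨b, hb⟩ := hz.exists_basis
  obtain ⟨U, hU, hsep⟩ := h
  -- a general affine open
  obtain ⟨x₀, hx₀⟩ := hU.nonempty
  obtain ⟨_, ⟨U₀, hU₀, rfl⟩, hxU₀, hU₀U⟩ :=
    X.isBasis_affineOpens.exists_subset_of_mem_open hx₀ U.isOpen
  have : Nonempty U₀ := ⟨⟨x₀, hxU₀⟩⟩
  have : Algebra.FiniteType k Γ(X, U₀) := finiteType_section hU₀
  have : IsFractionRing Γ(X, U₀) X.functionField := functionField_isFractionRing_of_isAffineOpen X U₀ hU₀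
  obtain ⟨c, hc, H⟩ := exists_fiber_of_essFiniteType (k := k) (B := Γ(X, U₀)) (F := F) (L := L) _ hz
  have : Nonempty (X.basicOpen c) := nonempty_basicOpen c hc
  have := isScalarTower_basicOpen_functionField c
  have := hU₀.isLocalization_basicOpen c
  obtain ⟨z, hzz, c₁, hc₁, H⟩ := H Γ(X, X.basicOpen c)
  have hU₁ : IsAffineOpen (X.basicOpen c) := hU₀.basicOpen c
  have : Nonempty (X.basicOpen c₁) := nonempty_basicOpen c₁ hc₁
  have := isScalarTower_basicOpen_functionField c₁
  have := hU₁.isLocalization_basicOpen c₁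
  obtain ⟨hzB, q, hq, hqm, hqt⟩ := H Γ(X, X.basicOpen c₁)
  have hU₂ : IsAffineOpen (X.basicOpen c₁) := hU₁.basicOpen c₁
  have hU₂U : X.basicOpen c₁ ≤ U :=
    ((X.basicOpen_le c₁).trans (X.basicOpen_le c)).trans hU₀U
  let B := Γ(X, X.basicOpen c₁)
  have : Algebra.FiniteType k B := finiteType_section hU₂
  let w : Fin (N' + 1) → B := fun i ↦ algebraMap _ B (z i)
  have hw : ∀ i, algebraMap B L (w i) =
      (Fin.cons (algebraMap F L t) fun i ↦ algebraMap K L (y i) : Fin (N' + 1) → L) i := fun i ↦ by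
    rw [← hzz i]
    exact (IsScalarTower.algebraMap_apply _ B L (z i)).symm
  have hwa : AlgebraicIndependent k w := by
    refine AlgebraicIndependent.of_comp (IsScalarTower.toAlgHom k B L) ?_
    convert! hza using 1
    exact funext hw
  -- The coordinates are N' + 1 algebraically independent functions on an open subset of X. This
  -- inequality suffices, since the strict case is excluded by the vanishing of forms.
  have hrN : N' + 1 ≤ N := by
    have h1 := (natCast_le_ringKrullDim_of_algebraicIndependent w hwa).trans
      (ringKrullDim_le_topologicalKrullDim hU₂)
    rw [hN] at h1
    exact_mod_cast h1
  -- the points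
  have hd : 0 < Module.finrank F L := Module.finrank_pos
  let i₀ : Fin (Module.finrank F L) := ⟨0, hd⟩
  -- The last index, the only one at which the separating section does not vanish.
  let j₀ : Fin n := ⟨n - 1, by omega⟩
  obtain ⟨p, hp, hpm, hpj, hpq⟩ := exists_injective_extension
    (infinite_maximalSpectrum (w 0) (hwa.transcendental 0)) q hq hqm hle i₀ j₀
  choose x hx hxc hxp using fun j ↦ exists_isClosed_primeIdealOf_eq (k := k) hU₂ (p j) (hpm j)
  have hxi : Function.Injective x := fun i j hij ↦ hp <| by
    rw [← hxp i, ← hxp j]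
    congr 3
  obtain ⟨s, hs, hsx⟩ := hsep x hxi fun j ↦ ⟨hU₂U (hx j), hxc j⟩
  have hj₀ : ¬ (j₀ : ℕ) + 1 < n := by
    simp only [j₀]
    omega
  rcases hrN.lt_or_eq with hlt | rfl
  -- The stalk of Ω would be free of rank less than N, so every N-form would vanish, including at
  -- the last point.
  · refine hj₀ ((hsx j₀).mp ?_)
    let : Algebra B (X.presheaf.stalk (x j₀)) := (X.presheaf.germ _ (x j₀) (hx j₀)).hom.toAlgebra
    have : IsScalarTower k B (X.presheaf.stalk (x j₀)) :=
      IsScalarTower.of_algebraMap_eq' (germ_comp_algebraMap k X _ (x j₀) (hx j₀)).symm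
    have hl : IsLocalization.AtPrime (X.presheaf.stalk (x j₀))
        (hU₂.primeIdealOf ⟨x j₀, hx j₀⟩).asIdeal := hU₂.isLocalization_stalk ⟨x j₀, hx j₀⟩
    have : Algebra.FormallyEtale B (X.presheaf.stalk (x j₀)) :=
      Algebra.FormallyEtale.of_isLocalization
        (hU₂.primeIdealOf ⟨x j₀, hx j₀⟩).asIdeal.primeCompl
    obtain ⟨bx, -⟩ := (IsEtaleCoord.comp_of_formallyEtale (z := w)
      (B := X.presheaf.stalk (x j₀)) hzB).exists_basis
    rw [exteriorPower_eq_zero_of_lt bx hlt (s (x j₀))]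
    exact zero_mem _
  · obtain ⟨g, hg, hgx⟩ := exists_section_eq_formsCoord hU₂ w hzB b
      (fun i ↦ by rw [hb, hw]) hs
    have hgp : ∀ j, g ∈ p j ↔ (j : ℕ) + 1 < n := fun j ↦ by
      rw [← hsx j, hgx (x j) (hx j), hxp]
    have htr : Algebra.trace F L (algebraMap B L g) = 0 := by
      rw [hg]
      refine trace_formsCoord_eq_zero t ht hgen bK b ?_ ?_ _ (isRegularForm_globalForms hs)
      · rw [hb]; rfl
      · intro i
        rw [hb, hbK, KaehlerDifferential.map_D]
        rfl
    refine hj₀ ((hgp j₀).mp ?_)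
    rw [hpj]
    -- The other points of the fiber are among the first n - 1 points, where g vanishes.
    refine hqt g htr i₀ fun i hi ↦ ?_
    obtain ⟨j, hj⟩ := hpq i
    rw [← hj, hgp]
    have hne : j ≠ j₀ := by
      rintro rfl
      exact hi (hq (hj.symm.trans hpj))
    have h1 : (j : ℕ) ≠ n - 1 := fun h ↦ hne (Fin.ext h)
    omega

end

end SepNonruled

/-! ### Function fields under rational maps and open immersions -/

namespace SepNonruled

noncomputable section

open CategoryTheory CategoryTheory.Limits AlgebraicGeometry

variable {k : Type u} [Field k]

theorem SpecMap_functionFieldHom {X Y : Scheme.{u}} [IsIntegral X] [IsIntegral Y]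
    (f : X ⤏ Y) [f.IsDominant] :
    Spec.map (CommRingCat.ofHom (functionFieldHom f)) ≫ Y.fromSpecStalk (genericPoint Y) =
      f.fromFunctionField := by
  rw [functionFieldHom, CommRingCat.ofHom_hom, Spec.map_comp, Category.assoc,
    Scheme.SpecMap_stalkSpecializes_fromSpecStalk]
  exact Scheme.Spec_stalkClosedPointTo_fromSpecStalk _

theorem fromFunctionField_over {X Y S : Scheme.{u}} [IsIntegral X] [X.Over S] [Y.Over S]
    (f : X ⤏ Y) [f.IsOver S] :
    f.fromFunctionField ≫ (Y ↘ S) = X.fromSpecStalk (genericPoint X) ≫ (X ↘ S) := by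
  obtain ⟨g, hg, rfl⟩ := f.exists_partialMap_over S
  have h := Scheme.PartialMap.isOver_iff.mp hg
  refine (Scheme.PartialMap.fromSpecStalkOfMem_compHom g (Y ↘ S) (genericPoint X) _).symm.trans ?_
  change g.domain.fromSpecStalkOfMem _ _ ≫ (g.compHom (Y ↘ S)).hom = _
  rw [h]
  exact Scheme.Opens.fromSpecStalkOfMem_ι_assoc _ _ _ _

theorem functionFieldHom_comp_algebraMap {X Y : Scheme.{u}} [IsIntegral X] [IsIntegral Y]
    [X.Over (Spec (.of k))] [Y.Over (Spec (.of k))]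
    (f : X ⤏ Y) [f.IsDominant] [f.IsOver (Spec (.of k))] :
    (functionFieldHom f).comp (algebraMap k Y.functionField) = algebraMap k X.functionField := by
  have h : CommRingCat.ofHom (algebraMap k Y.functionField) ≫
      CommRingCat.ofHom (functionFieldHom f) = CommRingCat.ofHom (algebraMap k X.functionField) := by
    apply Spec.map_injective
    rw [Spec.map_comp, ← fromSpecStalk_over, ← fromSpecStalk_over, ← fromFunctionField_over f,
      ← SpecMap_functionFieldHom f, Category.assoc]
  exact congrArg CommRingCat.Hom.hom h

theorem stalkMap_comp_algebraMap {X Y : Scheme.{u}} [X.Over (Spec (.of k))]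
    [Y.Over (Spec (.of k))] (f : X ⟶ Y) [f.IsOver (Spec (.of k))] (x : X) :
    (f.stalkMap x).hom.comp (algebraMap k (Y.presheaf.stalk (f x))) =
      algebraMap k (X.presheaf.stalk x) := by
  have h : CommRingCat.ofHom (algebraMap k (Y.presheaf.stalk (f x))) ≫ f.stalkMap x =
      CommRingCat.ofHom (algebraMap k (X.presheaf.stalk x)) := by
    apply Spec.map_injective
    rw [Spec.map_comp, ← fromSpecStalk_over, ← fromSpecStalk_over,
      Scheme.SpecMap_stalkMap_fromSpecStalk_assoc, comp_over]
  exact congrArg CommRingCat.Hom.hom h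

/-- An open immersion of integral schemes induces an isomorphism of function fields. -/
theorem nonempty_functionField_algEquiv {X Y : Scheme.{u}} [IsIntegral X] [IsIntegral Y]
    [X.Over (Spec (.of k))] [Y.Over (Spec (.of k))] (f : X ⟶ Y) [IsOpenImmersion f]
    [f.IsOver (Spec (.of k))] : Nonempty (Y.functionField ≃ₐ[k] X.functionField) := by
  have h : f (genericPoint X) = genericPoint Y := genericPoint_eq_of_isOpenImmersion f
  have h1 : Nonempty (Y.functionField ≃ₐ[k] Y.presheaf.stalk (f (genericPoint X))) := by
    rw [h]
    exact ⟨AlgEquiv.refl⟩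
  obtain ⟨e⟩ := h1
  let e2 : Y.presheaf.stalk (f (genericPoint X)) ≃+* X.functionField :=
    (asIso (f.stalkMap (genericPoint X))).commRingCatIsoToRingEquiv
  exact ⟨e.trans (AlgEquiv.ofRingEquiv (f := e2) fun a ↦
    RingHom.congr_fun (stalkMap_comp_algebraMap f (genericPoint X)) a)⟩

/-- The function field of the spectrum of a domain over `k` is its fraction field. -/
theorem isScalarTower_functionField_Spec (D : CommRingCat.{u}) [IsDomain D] [Algebra k D]
    [(Spec D).Over (Spec (.of k))]
    (h : Spec D ↘ Spec (.of k) = Spec.map (CommRingCat.ofHom (algebraMap k D))) :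
    IsScalarTower k D (Spec D).functionField := by
  refine IsScalarTower.of_algebraMap_eq' ?_
  have h2 : CommRingCat.ofHom (algebraMap k (Spec D).functionField) =
      CommRingCat.ofHom (algebraMap k D) ≫
        StructureSheaf.toStalk D (genericPoint (Spec D)) := by
    apply Spec.map_injective
    exact (fromSpecStalk_over k _ _).symm.trans
      ((congrArg₂ (· ≫ ·) (AlgebraicGeometry.Spec.fromSpecStalk_eq' D _) h).trans (Spec.map_comp _ _).symm)
  exact congrArg CommRingCat.Hom.hom h2

end

end SepNonruled

/-! ### The affine chart of the projective line -/

namespace SepNonruled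

noncomputable section

open CategoryTheory CategoryTheory.Limits AlgebraicGeometry

attribute [local instance] MvPolynomial.gradedAlgebra

section

variable (k : Type u) [Field k]

/-- The coordinate ring of the chart of the projective line where `x₀` does not vanish. -/
abbrev ChartRing : Type u :=
  HomogeneousLocalization.Away (MvPolynomial.homogeneousSubmodule (Fin 2) k)
    (MvPolynomial.X 0 : MvPolynomial (Fin 2) k)

theorem X_mem_homogeneousSubmodule (i : Fin 2) :
    (MvPolynomial.X i : MvPolynomial (Fin 2) k) ∈ MvPolynomial.homogeneousSubmodule (Fin 2) k 1 :=
  MvPolynomial.isHomogeneous_X k i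

/-- The constants of the chart of the projective line. -/
def chartConst : k →+* ChartRing k :=
  (HomogeneousLocalization.fromZeroRingHom (MvPolynomial.homogeneousSubmodule (Fin 2) k) _).comp
    (algebraMap k (MvPolynomial.homogeneousSubmodule (Fin 2) k 0))

/-- The chart `Spec k[x₁/x₀] → ℙ¹`. -/
def chartι : Spec (.of (ChartRing k)) ⟶ projLine k :=
  Proj.awayι (MvPolynomial.homogeneousSubmodule (Fin 2) k) _
    (X_mem_homogeneousSubmodule k 0) one_pos

instance : IsOpenImmersion (chartι k) :=
  inferInstanceAs (IsOpenImmersion (Proj.awayι _ _ _ _))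

theorem chartι_projLineHom :
    chartι k ≫ projLineHom k = Spec.map (CommRingCat.ofHom (chartConst k)) := by
  have h := Proj.awayι_toSpecZero_assoc (MvPolynomial.homogeneousSubmodule (Fin 2) k) _
    (X_mem_homogeneousSubmodule k 0) one_pos (Spec.map (CommRingCat.ofHom
      (algebraMap k (MvPolynomial.homogeneousSubmodule (Fin 2) k 0))))
  exact h.trans (Spec.map_comp _ _).symm

-- The isomorphism sends X to x₁/x₀. Setting x₀ = 1 gives a left inverse, and a homogeneous r of
-- degree n equals r(1, x₁/x₀) x₀ⁿ, which gives surjectivity.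
open Polynomial in
theorem exists_chartEquiv : ∃ e : k[X] ≃+* ChartRing k, ∀ a, e (C a) = chartConst k a := by
  let M := Localization.Away (MvPolynomial.X 0 : MvPolynomial (Fin 2) k)
  let v : ChartRing k →+* M := algebraMap (ChartRing k) M
  have hv : Function.Injective v := HomogeneousLocalization.val_injective _
  let x : ChartRing k := HomogeneousLocalization.Away.mk _ (X_mem_homogeneousSubmodule k 0) 1
    (MvPolynomial.X 1) (by simpa using X_mem_homogeneousSubmodule k 1)
  have hx : v x * algebraMap (MvPolynomial (Fin 2) k) M (MvPolynomial.X 0) = algebraMap (MvPolynomial (Fin 2) k) M (MvPolynomial.X 1) := by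
    change (HomogeneousLocalization.Away.mk _ (X_mem_homogeneousSubmodule k 0) 1
      (MvPolynomial.X 1) _).val * _ = _
    rw [HomogeneousLocalization.Away.val_mk, Localization.mk_eq_mk'_apply]
    have h := IsLocalization.mk'_spec M (MvPolynomial.X 1 : MvPolynomial (Fin 2) k)
      (⟨MvPolynomial.X 0 ^ 1, 1, rfl⟩ :
        Submonoid.powers (MvPolynomial.X 0 : MvPolynomial (Fin 2) k))
    simp only [pow_one] at h ⊢
    exact h
  have hc : ∀ a, v (chartConst k a) = algebraMap (MvPolynomial (Fin 2) k) M (MvPolynomial.C a) := fun a ↦ by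
    change Localization.mk _ _ = _
    exact Localization.mk_one_eq_algebraMap _
  let φ : k[X] →+* ChartRing k := eval₂RingHom (chartConst k) x
  have hφC : ∀ a, φ (C a) = chartConst k a := fun a ↦ eval₂_C _ _
  have hφX : φ X = x := eval₂_X _ _
  let E : MvPolynomial (Fin 2) k →+* k[X] := MvPolynomial.eval₂Hom C ![1, X]
  have hEC : ∀ a, E (MvPolynomial.C a) = C a := fun a ↦ MvPolynomial.eval₂Hom_C _ _ a
  have hE0 : E (MvPolynomial.X 0) = 1 := MvPolynomial.eval₂Hom_X' _ _ 0
  have hE1 : E (MvPolynomial.X 1) = X := MvPolynomial.eval₂Hom_X' _ _ 1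
  have hinj : Function.Injective φ := by
    let ψ : M →+* k[X] := IsLocalization.Away.lift (g := E) (MvPolynomial.X 0) (by rw [hE0]; exact isUnit_one)
    have hψ : ∀ r, ψ (algebraMap (MvPolynomial (Fin 2) k) M r) = E r := fun r ↦ IsLocalization.Away.lift_eq _ _ r
    have h1 : (ψ.comp v).comp φ = RingHom.id _ := by
      refine Polynomial.ringHom_ext (fun a ↦ ?_) ?_
      · change ψ (v (φ (C a))) = _
        rw [hφC, hc, hψ, hEC, RingHom.id_apply]
      · have h2 := congrArg ψ hx
        rw [map_mul, hψ, hψ, hE0, hE1, mul_one] at h2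
        change ψ (v (φ X)) = _
        rw [hφX, h2, RingHom.id_apply]
    exact Function.Injective.of_comp (f := ψ.comp v) (by
      rw [← RingHom.coe_comp, h1]
      exact Function.injective_id)
  have hE : ∀ (n : ℕ) (r : MvPolynomial (Fin 2) k), r.IsHomogeneous n →
      algebraMap (MvPolynomial (Fin 2) k) M r = v (φ (E r)) * algebraMap (MvPolynomial (Fin 2) k) M (MvPolynomial.X 0) ^ n := by
    intro n r hr
    rw [r.as_sum, map_sum, map_sum, map_sum, map_sum, Finset.sum_mul]
    refine Finset.sum_congr rfl fun d hd ↦ ?_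
    have hdn : n = d 0 + d 1 := by
      have := hr (MvPolynomial.mem_support_iff.mp hd)
      rw [Finsupp.weight_apply, Finsupp.sum_fintype _ _ (by simp), Fin.sum_univ_two] at this
      simp only [Pi.one_apply, smul_eq_mul, mul_one] at this
      exact this.symm
    rw [hdn, MvPolynomial.monomial_eq, Finsupp.prod_fintype _ _ (by simp), Fin.prod_univ_two]
    simp only [map_mul, map_pow, hEC, hE0, hE1, hφC, hφX, hc, ← hx, map_one]
    ring
  have hsurj : Function.Surjective φ := by
    intro b
    obtain ⟨n, r, hr, rfl⟩ := HomogeneousLocalization.Away.mk_surjective _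
      (X_mem_homogeneousSubmodule k 0) b
    refine ⟨E r, hv ?_⟩
    have hr' : r.IsHomogeneous n := by simpa using hr
    change _ = (HomogeneousLocalization.Away.mk _ (X_mem_homogeneousSubmodule k 0) n r hr).val
    rw [HomogeneousLocalization.Away.val_mk, Localization.mk_eq_mk'_apply, eq_comm,
      IsLocalization.mk'_eq_iff_eq_mul, hE n r hr', map_pow]
  refine ⟨RingEquiv.ofBijective φ ⟨hinj, hsurj⟩, fun a ↦ ?_⟩
  exact hφC a

end

end

end SepNonruled

/-! ### Function fields of ruled varieties -/

namespace SepNonruled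

noncomputable section

open CategoryTheory CategoryTheory.Limits AlgebraicGeometry TensorProduct

attribute [local instance] MvPolynomial.gradedAlgebra

theorem fromSpec_over {k : Type u} [Field k] {X : Scheme.{u}} [X.Over (Spec (.of k))] {U : X.Opens}
    (hU : IsAffineOpen U) :
    hU.fromSpec ≫ (X ↘ Spec (.of k)) = Spec.map (CommRingCat.ofHom (algebraMap k Γ(X, U))) := by
  rw [over_eq_toSpecΓ_comp, hU.fromSpec_toSpecΓ_assoc, ← Spec.map_comp, Category.assoc]
  rfl

open Polynomial in
/-- The fraction field of the polynomial ring `A[X]` over a finitely generated domain `A` is a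
rational function field over the fraction field of `A`. -/
theorem exists_rationalFunctionField {k A F : Type u} [Field k] [CommRing A] [IsDomain A]
    [Algebra k A] [Algebra.FiniteType k A] [Field F] [Algebra k F] [Algebra A[X] F]
    [IsScalarTower k A[X] F] [IsFractionRing A[X] F] :
    ∃ (K : Type u) (_ : Field K) (_ : Algebra k K) (_ : Algebra.EssFiniteType k K)
      (_ : Algebra K F) (_ : IsScalarTower k K F) (t : F), Transcendental K t ∧
      IntermediateField.adjoin K {t} = ⊤ := by
  let K := FractionRing A
  let : Algebra A F := ((algebraMap A[X] F).comp C).toAlgebra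
  have hAF : Function.Injective (algebraMap A F) :=
    (IsFractionRing.injective A[X] F).comp C_injective
  have : FaithfulSMul A F := (faithfulSMul_iff_algebraMap_injective _ _).mpr hAF
  let : Algebra K F := FractionRing.liftAlgebra A F
  have : IsScalarTower A K F := inferInstance
  have : IsScalarTower k A F := IsScalarTower.of_algebraMap_eq fun a ↦ by
    rw [IsScalarTower.algebraMap_apply k A[X] F]
    rfl
  have : IsScalarTower k K F := IsScalarTower.of_algebraMap_eq fun a ↦ by
    rw [IsScalarTower.algebraMap_apply k A K, ← IsScalarTower.algebraMap_apply A K F,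
      ← IsScalarTower.algebraMap_apply k A F]
  have : Algebra.EssFiniteType A K := Algebra.EssFiniteType.of_isLocalization K (nonZeroDivisors A)
  have : Algebra.EssFiniteType k K := Algebra.EssFiniteType.comp k A K
  let t : F := algebraMap A[X] F X
  have hp : ∀ p : A[X], aeval t p = algebraMap A[X] F p := fun p ↦ by
    have h : ((aeval t : A[X] →ₐ[A] F) : A[X] →+* F) = algebraMap A[X] F := by
      refine Polynomial.ringHom_ext (fun a ↦ ?_) ?_
      · exact aeval_C t a
      · exact aeval_X t
    exact RingHom.congr_fun h p
  refine ⟨K, inferInstance, inferInstance, ‹_›, inferInstance, ‹_›, t, ?_, ?_⟩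
  · rw [Transcendental, ← IsFractionRing.isAlgebraic_iff A K F]
    refine transcendental_iff_injective.mpr ?_
    convert! IsFractionRing.injective A[X] F using 1
    exact funext hp
  · rw [eq_top_iff]
    rintro x -
    obtain ⟨p, q, -, rfl⟩ := IsFractionRing.div_surjective (A := A[X]) x
    have hmem : ∀ p : A[X], algebraMap A[X] F p ∈ IntermediateField.adjoin K {t} := fun p ↦ by
      rw [← hp, ← aeval_map_algebraMap K]
      exact IntermediateField.algebra_adjoin_le_adjoin K {t} (aeval_mem_adjoin_singleton K t)
    exact div_mem (hmem p) (hmem q)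

variable {k : Type u} [Field k]

open Polynomial in
/-- The product of an affine open of `Y` with the affine line is open in `Y × ℙ¹`. -/
theorem exists_openImmersion_product {Y : Scheme.{u}} [Y.Over (Spec (.of k))] {U : Y.Opens}
    (hU : IsAffineOpen U) :
    ∃ j : Spec (.of Γ(Y, U)[X]) ⟶ pullback (Y ↘ Spec (.of k)) (projLineHom k),
      IsOpenImmersion j ∧ j ≫ pullback.fst (Y ↘ Spec (.of k)) (projLineHom k) ≫
        (Y ↘ Spec (.of k)) = Spec.map (CommRingCat.ofHom (algebraMap k Γ(Y, U)[X])) := by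
  obtain ⟨e, he⟩ := exists_chartEquiv k
  let A := Γ(Y, U)
  let : Algebra k (ChartRing k) := (chartConst k).toAlgebra
  let e₁ : k[X] ≃ₐ[k] ChartRing k := AlgEquiv.ofRingEquiv (f := e) he
  let e₂ : A[X] ≃ₐ[A] A ⊗[k] ChartRing k :=
    (polyEquivTensor' k A).trans (Algebra.TensorProduct.congr AlgEquiv.refl e₁)
  let i₁ : Spec (.of (A ⊗[k] ChartRing k)) ≅ Spec (.of A[X]) :=
    Scheme.Spec.mapIso e₂.toRingEquiv.toCommRingCatIso.op
  let i₂ : Spec (.of A) ⟶ Y := hU.fromSpec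
  have hi₂ : IsOpenImmersion i₂ := hU.isOpenImmersion_fromSpec
  -- The fiber product over k of two open immersions: the affine open into Y and the chart into P¹.
  let j₀ := pullback.map (Spec.map (CommRingCat.ofHom (algebraMap k A)))
    (Spec.map (CommRingCat.ofHom (algebraMap k (ChartRing k)))) (Y ↘ Spec (.of k)) (projLineHom k)
    i₂ (chartι k) (𝟙 _) (by rw [Category.comp_id]; exact (fromSpec_over hU).symm)
    (by rw [Category.comp_id]; exact (chartι_projLineHom k).symm)
  have hj₀ : IsOpenImmersion j₀ := inferInstance
  refine ⟨i₁.inv ≫ (pullbackSpecIso k A (ChartRing k)).inv ≫ j₀, inferInstance, ?_⟩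
  have h1 : j₀ ≫ pullback.fst _ _ = pullback.fst _ _ ≫ i₂ := pullback.lift_fst _ _ _
  have h2 : i₂ ≫ (Y ↘ Spec (.of k)) = Spec.map (CommRingCat.ofHom (algebraMap k A)) :=
    fromSpec_over hU
  have h3 : i₁.inv = Spec.map (CommRingCat.ofHom (e₂.symm : A ⊗[k] ChartRing k →+* A[X])) := rfl
  simp only [Category.assoc]
  rw [reassoc_of% h1, h2, pullbackSpecIso_inv_fst_assoc, h3, ← Spec.map_comp, ← Spec.map_comp]
  refine congrArg Spec.map (CommRingCat.hom_ext (RingHom.ext fun a ↦ ?_))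
  exact e₂.symm.commutes (algebraMap k A a)

/-- A chart of a variety birational to `R` presents the function field of `R` as a fraction
field. -/
theorem exists_isFractionRing_functionField {R P : Scheme.{u}} [R.Over (Spec (.of k))]
    [IsIntegral R] (sP : P ⟶ Spec (.of k)) (f : Scheme.PartialIso R P)
    (hf : f.iso.hom ≫ f.target.ι ≫ sP = f.source.ι ≫ (R ↘ Spec (.of k)))
    (D : CommRingCat.{u}) [IsDomain D] [Algebra k D] (j : Spec D ⟶ P) [IsOpenImmersion j]
    (hjk : j ≫ sP = Spec.map (CommRingCat.ofHom (algebraMap k D))) :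
    ∃ _ : Algebra D R.functionField, IsFractionRing D R.functionField ∧
      IsScalarTower k D R.functionField := by
  let : (Spec D).Over (Spec (.of k)) := ⟨Spec.map (CommRingCat.ofHom (algebraMap k D))⟩
  let V := j ⁻¹ᵁ f.target
  have hV : Nonempty V := by
    obtain ⟨x⟩ : Nonempty (Spec D) := inferInstance
    obtain ⟨y, ⟨z, rfl⟩, hy⟩ := f.dense_target.inter_open_nonempty _
      j.isOpenEmbedding.isOpen_range ⟨j x, x, rfl⟩
    exact ⟨⟨z, hy⟩⟩
  let : V.toScheme.Over (Spec (.of k)) := ⟨V.ι ≫ Spec.map (CommRingCat.ofHom (algebraMap k D))⟩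
  have : V.ι.IsOver (Spec (.of k)) := ⟨rfl⟩
  -- V, the part of the chart where the birational map is defined, is nonempty by density and open
  -- both in Spec D and in R, so the two function fields are identified.
  let g : V.toScheme ⟶ R := (j ∣_ f.target) ≫ f.iso.inv ≫ f.source.ι
  have hg : g.IsOver (Spec (.of k)) := ⟨by
    change ((j ∣_ f.target) ≫ f.iso.inv ≫ f.source.ι) ≫ _ = V.ι ≫ _
    rw [Category.assoc, Category.assoc, ← hf, Iso.inv_hom_id_assoc, morphismRestrict_ι_assoc, hjk]⟩
  obtain ⟨e₁⟩ := nonempty_functionField_algEquiv (k := k) g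
  obtain ⟨e₂⟩ := nonempty_functionField_algEquiv (k := k) V.ι
  have := isScalarTower_functionField_Spec (k := k) D rfl
  let e : (Spec D).functionField ≃ₐ[k] R.functionField := e₂.trans e₁.symm
  let : Algebra D R.functionField :=
    ((e : (Spec D).functionField →+* R.functionField).comp (algebraMap D _)).toAlgebra
  refine ⟨this, ?_, IsScalarTower.of_algebraMap_eq fun a ↦ ?_⟩
  · let e' : (Spec D).functionField ≃ₐ[D] R.functionField :=
      AlgEquiv.ofRingEquiv (f := e.toRingEquiv) fun _ ↦ rfl
    exact IsLocalization.isLocalization_of_algEquiv _ e'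
  · change _ = e (algebraMap D _ (algebraMap k D a))
    rw [← IsScalarTower.algebraMap_apply, AlgEquiv.commutes]

/-- The function field of a ruled variety is a rational function field. -/
theorem IsRuled.exists_rationalFunctionField {R : Scheme.{u}} [R.Over (Spec (.of k))]
    [IsIntegral R] (hR : IsRuled k R) :
    ∃ (K : Type u) (_ : Field K) (_ : Algebra k K) (_ : Algebra.EssFiniteType k K)
      (_ : Algebra K R.functionField) (_ : IsScalarTower k K R.functionField) (t : R.functionField),
      Transcendental K t ∧ IntermediateField.adjoin K {t} = ⊤ := by
  obtain ⟨Y, _, hY, f, hf⟩ := hR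
  have := hY.isIntegral
  have := hY.locallyOfFiniteType
  obtain ⟨_, ⟨U, hU, rfl⟩, hyU, -⟩ :=
    Y.isBasis_affineOpens.exists_subset_of_mem_open (Set.mem_univ (genericPoint Y)) isOpen_univ
  have : Nonempty U := ⟨⟨_, hyU⟩⟩
  have : Algebra.FiniteType k Γ(Y, U) := finiteType_section hU
  obtain ⟨j, hj, hjk⟩ := exists_openImmersion_product (k := k) hU
  have : IsDomain (CommRingCat.of (Polynomial Γ(Y, U))) :=
    inferInstanceAs (IsDomain (Polynomial Γ(Y, U)))
  let : Algebra k (CommRingCat.of (Polynomial Γ(Y, U))) :=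
    inferInstanceAs (Algebra k (Polynomial Γ(Y, U)))
  obtain ⟨i, hi, hi'⟩ := exists_isFractionRing_functionField _ f hf
    (.of (Polynomial Γ(Y, U))) j hjk
  let : Algebra (Polynomial Γ(Y, U)) R.functionField := i
  have : IsScalarTower k (Polynomial Γ(Y, U)) R.functionField := hi'
  have : IsFractionRing (Polynomial Γ(Y, U)) R.functionField := hi
  exact SepNonruled.exists_rationalFunctionField (A := Γ(Y, U))

end

end SepNonruled

/-! ### The conclusion -/

open CategoryTheory AlgebraicGeometry in
theorem proposition2p4 {k : Type u} [Field k] [IsAlgClosed k]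
    (X : Scheme.{u}) [X.Over (Spec (.of k))] [IsIntegral X]
    [Smooth (X ↘ Spec (.of k))] [IsProper (X ↘ Spec (.of k))]
    (N : ℕ) (hN : topologicalKrullDim X = N)
    (n : ℕ) (hn : 0 < n)
    (h : SepNonruled.SeparatesGeneralPoints (SepNonruled.globalForms k X N) n) :
    (n : ℕ∞) < SepNonruled.snr k X := by
  -- A strict lower bound for an infimum follows from the bound n + 1 on each of its members, which
  -- also covers an empty set of degrees.
  suffices hle : ((n + 1 : ℕ) : ℕ∞) ≤ SepNonruled.snr k X from
    lt_of_lt_of_le (Nat.cast_lt.mpr n.lt_succ_self) hle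
  refine le_sInf ?_
  rintro _ ⟨d, rfl, R, _, _, f, _, -, hR, _, ⟨hfin, rfl⟩, hsep⟩
  rw [Nat.cast_le, Nat.succ_le_iff]
  obtain ⟨K, _, _, _, _, _, t, ht, hgen⟩ := hR.exists_rationalFunctionField
  let : Algebra R.functionField X.functionField := (SepNonruled.functionFieldHom f).toAlgebra
  have : Module.Finite R.functionField X.functionField := hfin
  have : Algebra.IsSeparable R.functionField X.functionField := hsep
  have : IsScalarTower k R.functionField X.functionField :=
    .of_algebraMap_eq' (SepNonruled.functionFieldHom_comp_algebraMap f).symm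
  exact SepNonruled.lt_finrank_of_separatesGeneralPoints hN hn h t ht hgen
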